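/- Let $(M,g)$ be a closed (compact, Hausdorff, without boundary) smooth Riemannian three-manifold of strictly negative sectional curvature, and let $\pi:(\tilde M,\tilde g)\to(M,g)$ be its Riemannian universal cover, $\tilde g=\pi^*g$. Conventions. $\mathrm{Rm}(X,Y)Z=\nabla_X\nabla_YZ-\nabla_Y\nabla_XZ-\nabla_{[X,Y]}Z$; $\mathrm{Ric}(X,Y)=\mathrm{Tr}\,\mathrm{Rm}(\cdot,X)Y$; $\mathrm{Sc}=\mathrm{Tr}_g\mathrm{Ric}$; $E=\mathrm{Ric}-\tfrac{\mathrm{Sc}}{2}g$ is the Einstein tensor; the endomorphism $\hat E$ is given by $E(X,Y)=g(\hat E X,Y)$, and $E^{-1}(X,Y)=g(\hat E^{-1}X,Y)$ (negative curvature makes $\hat E$ positive definite). Put $P=\sqrt{\det\hat E}\;E^{-1}$. A symmetric $(0,2)$-tensor $T$ is Codazzi if the three-tensor $\nabla T$ is totally symmetric. Minkowski space $\mathbb R^{3,1}$ carries $\langle x,y\rangle=x_1y_1+x_2y_2+x_3y_3-x_4y_4$ and its flat connection $D$. An isometric embedding $F:\tilde M\to\mathbb R^{3,1}$ is a smooth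 embedding with $F^*\langle\cdot,\cdot\rangle=\tilde g$; its image is then a spacelike hypersurface. For a smooth timelike unit normal field $\nu$ along $F$ (so $\langle\nu,\nu\rangle=-1$), the second fundamental form $A$ is defined by $D_{F_*X}F_*Y=F_*\nabla_XY+A(X,Y)\nu$. The hypersurface is locally convex if, for a suitable choice of $\nu$, all principal curvatures are positive, i.e. $A$ is positive definite. It is co-compact if it is invariant under a group of isometries of $\mathbb R^{3,1}$ that acts on it freely and properly discontinuously with compact quotient. Then: 1. $P$ is Codazzi on $(M,g)$ if and only if $(\tilde M,\tilde g)$ embeds isometrically into $\mathbb R^{3,1}$ as a locally convex, co-compact, spacelike hypersurface. 2. For every isometric embedding $F$ of $(\tilde M,\tilde g)$ into $\mathbb R^{3,1}$ and every smooth timelike unit normal $\nu$ with respect to which the second fundamental form $A$ of $F$ is positive definite (co-compactness by ambient isometries is not assumed), $P$ is Codazzi on $(M,g)$ and $A$ equals the tensor $P$ of $(\tilde M,\tilde g)$, i.e. the lift of $P$ to $\tilde M$. -/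

import Mathlib

open scoped Manifold ContDiff

noncomputable section

namespace CrossCurv

/-! ### Local Riemannian geometry

Tensor fields on an open piece of `ℝⁿ` are given by their components with respect to the
coordinate frame `∂₀, …, ∂ₙ₋₁`; `γ p i j` denotes the components of a metric at `p`. -/

section LocalGeometry

variable {n : ℕ}

/-- The partial derivative `∂ᵢ f` at `p`. -/
def pd {V : Type*} [NormedAddCommGroup V] [NormedSpace ℝ V] (i : Fin n)
    (f : EuclideanSpace ℝ (Fin n) → V) (p : EuclideanSpace ℝ (Fin n)) : V :=
  fderiv ℝ f p (EuclideanSpace.single i 1)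

/-- The Christoffel symbols `Γᵏᵢⱼ` of the Levi-Civita connection, `∇_{∂ᵢ} ∂ⱼ = Σₖ Γᵏᵢⱼ ∂ₖ`. -/
def christoffel (γ : EuclideanSpace ℝ (Fin n) → Matrix (Fin n) (Fin n) ℝ)
    (p : EuclideanSpace ℝ (Fin n)) (k i j : Fin n) : ℝ :=
  (1 / 2) * ∑ l, (γ p)⁻¹ k l *
    (pd i (fun q => γ q j l) p + pd j (fun q => γ q i l) p - pd l (fun q => γ q i j) p)

/-- The curvature tensor `Rm(X, Y) Z = ∇_X ∇_Y Z - ∇_Y ∇_X Z - ∇_{[X, Y]} Z`: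
`curv γ p l i j k` is the `l`-th component of `Rm(∂ᵢ, ∂ⱼ) ∂ₖ`. -/
def curv (γ : EuclideanSpace ℝ (Fin n) → Matrix (Fin n) (Fin n) ℝ)
    (p : EuclideanSpace ℝ (Fin n)) (l i j k : Fin n) : ℝ :=
  pd i (fun q => christoffel γ q l j k) p - pd j (fun q => christoffel γ q l i k) p
    + ∑ m, (christoffel γ p m j k * christoffel γ p l i m
        - christoffel γ p m i k * christoffel γ p l j m)

/-- The sectional curvature `Rm(X, Y, Y, X) / |X ∧ Y|²`, where
`Rm(X, Y, Z, W) = γ(Rm(X, Y) Z, W)`. -/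
def sectionalCurv (γ : EuclideanSpace ℝ (Fin n) → Matrix (Fin n) (Fin n) ℝ)
    (p : EuclideanSpace ℝ (Fin n)) (X Y : Fin n → ℝ) : ℝ :=
  (∑ i, ∑ j, ∑ k, ∑ l, ∑ m, X i * Y j * Y k * X l * (curv γ p m i j k * γ p m l)) /
    ((∑ i, ∑ j, γ p i j * X i * X j) * (∑ i, ∑ j, γ p i j * Y i * Y j)
      - (∑ i, ∑ j, γ p i j * X i * Y j) ^ 2)

/-- The Ricci tensor: `Ric(X, Y)` is the trace of the endomorphism `Z ↦ Rm(Z, X) Y`. -/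
def ricci (γ : EuclideanSpace ℝ (Fin n) → Matrix (Fin n) (Fin n) ℝ)
    (p : EuclideanSpace ℝ (Fin n)) : Matrix (Fin n) (Fin n) ℝ :=
  fun i j => ∑ m, curv γ p m m i j

/-- The scalar curvature, the metric trace of the Ricci tensor. -/
def scalarCurv (γ : EuclideanSpace ℝ (Fin n) → Matrix (Fin n) (Fin n) ℝ)
    (p : EuclideanSpace ℝ (Fin n)) : ℝ :=
  ∑ i, ∑ j, (γ p)⁻¹ i j * ricci γ p i j

/-- The Einstein tensor `E = Ric - (Sc / 2) γ`. -/
def einstein (γ : EuclideanSpace ℝ (Fin n) → Matrix (Fin n) (Fin n) ℝ)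
    (p : EuclideanSpace ℝ (Fin n)) : Matrix (Fin n) (Fin n) ℝ :=
  ricci γ p - (scalarCurv γ p / 2) • γ p

/-- The Einstein tensor as an endomorphism `Ê`, where `E(X, Y) = γ(Ê X, Y)`:
`einsteinOp γ p k i` is the `k`-th component of `Ê ∂ᵢ`. -/
def einsteinOp (γ : EuclideanSpace ℝ (Fin n) → Matrix (Fin n) (Fin n) ℝ)
    (p : EuclideanSpace ℝ (Fin n)) : Matrix (Fin n) (Fin n) ℝ :=
  fun k i => ∑ l, (γ p)⁻¹ k l * einstein γ p i l

/-- The bilinear form `E⁻¹(X, Y) = γ(Ê⁻¹ X, Y)`. -/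
def einsteinInv (γ : EuclideanSpace ℝ (Fin n) → Matrix (Fin n) (Fin n) ℝ)
    (p : EuclideanSpace ℝ (Fin n)) : Matrix (Fin n) (Fin n) ℝ :=
  fun i j => ∑ k, (einsteinOp γ p)⁻¹ k i * γ p k j

/-- The tensor `P = √(det Ê) E⁻¹`. -/
def tensorP (γ : EuclideanSpace ℝ (Fin n) → Matrix (Fin n) (Fin n) ℝ)
    (p : EuclideanSpace ℝ (Fin n)) : Matrix (Fin n) (Fin n) ℝ :=
  Real.sqrt (einsteinOp γ p).det • einsteinInv γ p

/-- The covariant derivative of a `(0,2)`-tensor field: `covDeriv γ T p k i j` is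
`(∇_{∂ₖ} T)(∂ᵢ, ∂ⱼ)`. -/
def covDeriv (γ T : EuclideanSpace ℝ (Fin n) → Matrix (Fin n) (Fin n) ℝ)
    (p : EuclideanSpace ℝ (Fin n)) (k i j : Fin n) : ℝ :=
  pd k (fun q => T q i j) p
    - ∑ m, (christoffel γ p m k i * T p m j + christoffel γ p m k j * T p i m)

/-- `T` is Codazzi at `p`: `T` is symmetric and the three-tensor `∇T` is totally symmetric. -/
def IsCodazziAt (γ T : EuclideanSpace ℝ (Fin n) → Matrix (Fin n) (Fin n) ℝ)
    (p : EuclideanSpace ℝ (Fin n)) : Prop :=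
  (T p).IsSymm ∧ ∀ k i j, covDeriv γ T p k i j = covDeriv γ T p i k j ∧
    covDeriv γ T p k i j = covDeriv γ T p k j i

end LocalGeometry

/-! ### Riemannian manifolds -/

section Manifolds

variable {n : ℕ} {M : Type*} [TopologicalSpace M] [ChartedSpace (EuclideanSpace ℝ (Fin n)) M]
  [IsManifold (𝓡 n) ∞ M]

variable (n M) in
/-- Smooth Riemannian metrics on the smooth `n`-manifold `M`. -/
abbrev Metric : Type _ :=
  Bundle.ContMDiffRiemannianMetric (𝓡 n) ∞ (EuclideanSpace ℝ (Fin n))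
    (fun x : M => TangentSpace (𝓡 n) x)

variable (n M) in
/-- Smooth charts of `M`. -/
abbrev Charts : Set (OpenPartialHomeomorph M (EuclideanSpace ℝ (Fin n))) :=
  IsManifold.maximalAtlas (𝓡 n) ∞ M

/-- The coordinate vector field `∂ᵢ` of the chart `φ`, at the point with coordinates `p`. -/
def coordVec (φ : OpenPartialHomeomorph M (EuclideanSpace ℝ (Fin n)))
    (p : EuclideanSpace ℝ (Fin n)) (i : Fin n) : TangentSpace (𝓡 n) (φ.symm p) :=
  mfderiv (𝓡 n) (𝓡 n) φ.symm p (EuclideanSpace.single i (1 : ℝ) : EuclideanSpace ℝ (Fin n))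

/-- The components `g(∂ᵢ, ∂ⱼ)` of the metric `g` in the chart `φ`. -/
def coordMetric (g : Metric n M) (φ : OpenPartialHomeomorph M (EuclideanSpace ℝ (Fin n)))
    (p : EuclideanSpace ℝ (Fin n)) : Matrix (Fin n) (Fin n) ℝ :=
  fun i j => g.inner (φ.symm p) (coordVec φ p i) (coordVec φ p j)

/-- Strictly negative sectional curvature. -/
def NegativeSectionalCurvature (g : Metric n M) : Prop :=
  ∀ φ ∈ Charts n M, ∀ p ∈ φ.target, ∀ X Y : Fin n → ℝ, LinearIndependent ℝ ![X, Y] →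
    sectionalCurv (coordMetric g φ) p X Y < 0

/-- The tensor `P = √(det Ê) E⁻¹` of `g` is Codazzi. -/
def CodazziP (g : Metric n M) : Prop :=
  ∀ φ ∈ Charts n M, ∀ p ∈ φ.target,
    IsCodazziAt (coordMetric g φ) (tensorP (coordMetric g φ)) p

/-- `π : (N, h) → (M, g)` is a Riemannian universal cover: `N` is simply connected and `π` is a
surjective smooth covering map with `h = π^* g`. -/
structure IsRiemannianUniversalCover {N : Type*} [TopologicalSpace N]
    [ChartedSpace (EuclideanSpace ℝ (Fin n)) N] [IsManifold (𝓡 n) ∞ N]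
    (h : Metric n N) (g : Metric n M) (π : N → M) : Prop where
  simplyConnected : SimplyConnectedSpace N
  isCoveringMap : IsCoveringMap π
  surjective : Function.Surjective π
  contMDiff : ContMDiff (𝓡 n) (𝓡 n) ∞ π
  pullback : ∀ (y : N) (u v : TangentSpace (𝓡 n) y),
    h.inner y u v = g.inner (π y) (mfderiv (𝓡 n) (𝓡 n) π y u) (mfderiv (𝓡 n) (𝓡 n) π y v)

/-! ### Hypersurfaces of Minkowski space -/

variable (n) in
/-- The vector space underlying Minkowski space `ℝ^{n,1}`: `n` space directions and one time
direction. Only the vector space structure and the topology of the product are used. -/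
abbrev Minkowski : Type := EuclideanSpace ℝ (Fin n) × ℝ

/-- The Minkowski inner product `⟨x, y⟩ = x₁ y₁ + ⋯ + xₙ yₙ - xₙ₊₁ yₙ₊₁`. -/
def mink (x y : Minkowski n) : ℝ := inner ℝ x.1 y.1 - x.2 * y.2

/-- The differential of `F : M → ℝ^{n,1}` at `y`. -/
def dMink (F : M → Minkowski n) (y : M) : TangentSpace (𝓡 n) y →L[ℝ] Minkowski n :=
  mfderiv (𝓡 n) 𝓘(ℝ, Minkowski n) F y

/-- `F` is spacelike: the Minkowski inner product is positive definite on its tangent spaces. -/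
def IsSpacelike (F : M → Minkowski n) : Prop :=
  ∀ (y : M) (u : TangentSpace (𝓡 n) y), u ≠ 0 → 0 < mink (dMink F y u) (dMink F y u)

/-- `F` is a smooth embedding which is isometric, i.e. pulls back the Minkowski inner product
to the metric `h`. -/
structure IsIsometricEmbedding (h : Metric n M) (F : M → Minkowski n) : Prop where
  isSmoothEmbedding : Manifold.IsSmoothEmbedding (𝓡 n) 𝓘(ℝ, Minkowski n) ∞ F
  isometric : ∀ (y : M) (u v : TangentSpace (𝓡 n) y),
    mink (dMink F y u) (dMink F y v) = h.inner y u v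

/-- `ν` is a smooth timelike unit normal field along `F`. -/
structure IsUnitNormal (F ν : M → Minkowski n) : Prop where
  contMDiff : ContMDiff (𝓡 n) 𝓘(ℝ, Minkowski n) ∞ ν
  unit : ∀ y, mink (ν y) (ν y) = -1
  normal : ∀ (y : M) (u : TangentSpace (𝓡 n) y), mink (dMink F y u) (ν y) = 0

/-- The components `A(∂ᵢ, ∂ⱼ)`, in the chart `φ`, of the second fundamental form of `F` with
respect to the timelike unit normal `ν`. By definition `D_{F_* X} F_* Y = F_* ∇_X Y + A(X, Y) ν`;
since `⟨ν, ν⟩ = -1` and `ν` is normal, `A(∂ᵢ, ∂ⱼ) = -⟨∂ᵢ ∂ⱼ F, ν⟩`. -/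
def secondFF (F ν : M → Minkowski n) (φ : OpenPartialHomeomorph M (EuclideanSpace ℝ (Fin n)))
    (p : EuclideanSpace ℝ (Fin n)) : Matrix (Fin n) (Fin n) ℝ :=
  fun i j => -mink (pd i (pd j (fun q => F (φ.symm q))) p) (ν (φ.symm p))

/-- The second fundamental form with respect to `ν` is positive definite, i.e. all principal
curvatures are positive. -/
def PosDefSecondFF (F ν : M → Minkowski n) : Prop :=
  ∀ φ ∈ Charts n M, ∀ p ∈ φ.target, (secondFF F ν φ p).PosDef

/-- `F` is locally convex: for one of the choices of the timelike unit normal, all principal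
curvatures are positive. -/
def IsLocallyConvex (F : M → Minkowski n) : Prop :=
  ∃ ν : M → Minkowski n, IsUnitNormal F ν ∧ PosDefSecondFF F ν

/-- Affine isometries of Minkowski space. -/
def IsMinkowskiIsometry (L : Minkowski n ≃ᵃ[ℝ] Minkowski n) : Prop :=
  ∀ x y, mink (L x - L y) (L x - L y) = mink (x - y) (x - y)

/-- The hypersurface `S` of Minkowski space is co-compact: it is invariant under a group `Γ` of
isometries of Minkowski space that acts freely and properly discontinuously on `S` with compact
quotient (`S` is covered by the translates of a compact subset). -/
def IsCoCompact (S : Set (Minkowski n)) : Prop :=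
  ∃ Γ : Subgroup (Minkowski n ≃ᵃ[ℝ] Minkowski n),
    (∀ L ∈ Γ, IsMinkowskiIsometry L) ∧
    (∀ L ∈ Γ, L '' S = S) ∧
    (∀ L ∈ Γ, ∀ x ∈ S, L x = x → L = 1) ∧
    (∀ K ⊆ S, IsCompact K → {L | L ∈ Γ ∧ (L '' K ∩ K).Nonempty}.Finite) ∧
    (∃ K ⊆ S, IsCompact K ∧ S ⊆ ⋃ L ∈ Γ, L '' K)

end Manifolds

end CrossCurv

end

/-!
The theorem rests on an algebraic fact in dimension three. There the lowered curvature tensor is a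
symmetric bilinear form `C` on bivectors, which form a space of dimension three again, and the Gauss
equation for a hypersurface of Minkowski space says that `C` is the cofactor matrix `adj A` of the
second fundamental form `A`. Since `√(det C) • C⁻¹` recovers a positive definite `A` from `C = adj A`,
and since this expression is the tensor `P` written in terms of `C` (`tensorP_eq_of_curvForm`), the
second fundamental form of a locally convex hypersurface is `P` (`tensorP_eq_of_gauss`,
`IsHypersurface.tensorP_eq`). The Codazzi equation of the hypersurface then says that `P` is Codazzi.
The charts of `M` lift to charts of the universal cover with the same components of the metric
(`IsRiemannianUniversalCover.exists_chart`), so this holds on `M` as well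
(`IsConvexImmersionOn.codazziP`). This is the second part of the theorem and one implication of the
first.

Conversely, negative curvature makes `C` positive definite, so that `P` is positive definite and
solves the Gauss equation (`tensorP_posDef_and_gauss`). If `P` is also Codazzi, then the linear total
differential equation for the position, the frame and the normal of a hypersurface is flat
(`flat_frameMatrix`), and the Frobenius theorem (`exists_isTotalSol`) solves it: locally there are
hypersurfaces with second fundamental form `P` (`exists_isHypersurface`). They are unique up to
isometries of Minkowski space (`IsHypersurface.exists_isometry`), so they patch together over the
simply connected cover to a convex immersion `F` (`exists_global_of_local`,
`exists_isConvexImmersionOn_univ`).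

That `F` is an embedding uses the compactness of `M`. The projection of a spacelike hypersurface to
the spatial directions does not decrease lengths. Hence segments lift through it along integral
curves (`exists_segment_lift_of_expanding`), with a length that is uniform because `M` is compact
(`exists_hasSegmentLifts`), and the projection is a homeomorphism onto `ℝ³`
(`HasSegmentLifts.bijective`). So the image of `F` is an entire graph
(`IsImmersedOn.isSmoothEmbedding`). Finally, the composition of `F` with a deck transformation is a
convex immersion of the same manifold, and therefore differs from `F` by an isometry of Minkowski
space (`IsConvexImmersionOn.exists_global_isometry`). The isometries obtained in this way act on the
image of `F` as the deck transformations act on the cover, that is, freely and properly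
discontinuously with compact quotient (`IsConvexImmersionOn.isCoCompact`).
-/

noncomputable section

namespace CrossCurv

/-! ### The Gauss equation in dimension three -/

section Algebra

open Matrix

variable {γ : EuclideanSpace ℝ (Fin 3) → Matrix (Fin 3) (Fin 3) ℝ} {p : EuclideanSpace ℝ (Fin 3)}

/-- The curvature tensor with all indices lowered, `Rm(∂ₖ, ∂ᵢ, ∂ⱼ, ∂ₗ) = γ(Rm(∂ₖ, ∂ᵢ) ∂ⱼ, ∂ₗ)`. -/
def curvLow {n : ℕ} (γ : EuclideanSpace ℝ (Fin n) → Matrix (Fin n) (Fin n) ℝ)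
    (p : EuclideanSpace ℝ (Fin n)) (k i j l : Fin n) : ℝ :=
  ∑ m, curv γ p m k i j * γ p m l

/-- In dimension three the lowered curvature tensor is a bilinear form on the bivectors
`∂₁ ∧ ∂₂, ∂₂ ∧ ∂₀, ∂₀ ∧ ∂₁`; this is its matrix. The indices are taken modulo three. -/
def curvForm (γ : EuclideanSpace ℝ (Fin 3) → Matrix (Fin 3) (Fin 3) ℝ)
    (p : EuclideanSpace ℝ (Fin 3)) : Matrix (Fin 3) (Fin 3) ℝ :=
  fun a b => curvLow γ p (a + 1) (a + 2) (b + 1) (b + 2)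

/-- The algebraic symmetries of the lowered curvature tensor of a metric. -/
structure IsCurvLike {n : ℕ} (R : Fin n → Fin n → Fin n → Fin n → ℝ) : Prop where
  antisymm_left : ∀ k i j l, R k i j l = -R i k j l
  antisymm_right : ∀ k i j l, R k i j l = -R k i l j
  pair_symm : ∀ k i j l, R k i j l = R j l k i

/-- Raising the last index of the lowered curvature tensor. -/
lemma curv_eq_sum_curvLow {n : ℕ} {γ : EuclideanSpace ℝ (Fin n) → Matrix (Fin n) (Fin n) ℝ}
    {p : EuclideanSpace ℝ (Fin n)} (hγ : (γ p).PosDef) (l k i j : Fin n) :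
    curv γ p l k i j = ∑ m, (γ p)⁻¹ l m * curvLow γ p k i j m := by
  have hu : IsUnit (γ p).det := (Matrix.isUnit_iff_isUnit_det _).1 hγ.isUnit
  have hs : ∀ a b, γ p a b = γ p b a := fun a b => by
    simpa using (hγ.isHermitian.apply b a)
  have h1 : (γ p)⁻¹ *ᵥ ((γ p) *ᵥ fun m => curv γ p m k i j) = fun m => curv γ p m k i j := by
    rw [Matrix.mulVec_mulVec, Matrix.nonsing_inv_mul _ hu, Matrix.one_mulVec]
  have := congrFun h1 l
  simp only [Matrix.mulVec, dotProduct] at this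
  rw [← this]
  refine Finset.sum_congr rfl fun m _ => ?_
  congr 1
  simp only [curvLow]
  exact Finset.sum_congr rfl fun a _ => by rw [hs m a, mul_comm]

/-- The Einstein tensor as an expression in the curvature form `C`: the endomorphism `Ê`
is `C * adj(γ⁻¹)`. Both sides are expanded in the six independent components of the curvature. -/
lemma einsteinOp_eq_mul_adjugate (hγ : (γ p).PosDef) (hR : IsCurvLike (curvLow γ p)) :
    einsteinOp γ p = curvForm γ p * (γ p)⁻¹.adjugate := by
  have hu : IsUnit (γ p).det := (Matrix.isUnit_iff_isUnit_det _).1 hγ.isUnit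
  have hc := curv_eq_sum_curvLow hγ
  set R := curvLow γ p with hRdef
  have hI : ∀ a b, (γ p)⁻¹ a b = (γ p)⁻¹ b a := fun a b => by
    simpa using (hγ.inv.isHermitian.apply b a)
  have hIγ : ∀ a b, ∑ l, (γ p)⁻¹ a l * γ p b l = if a = b then 1 else 0 := fun a b => by
    have h1 := congrFun (congrFun (Matrix.nonsing_inv_mul _ hu) a) b
    rw [Matrix.mul_apply, Matrix.one_apply] at h1
    rw [← h1]
    exact Finset.sum_congr rfl fun l _ => by
      rw [show γ p b l = γ p l b by simpa using hγ.isHermitian.apply l b]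
  have h0 : einsteinOp γ p = fun k i => ∑ l, (γ p)⁻¹ k l * ricci γ p i l
      - scalarCurv γ p / 2 * (if k = i then 1 else 0) := by
    ext k i
    simp only [einsteinOp, einstein, Matrix.sub_apply, Matrix.smul_apply, smul_eq_mul]
    rw [← hIγ k i, Finset.mul_sum, ← Finset.sum_sub_distrib]
    exact Finset.sum_congr rfl fun l _ => by ring
  rw [h0]
  have aL : ∀ k j l, R k k j l = 0 := fun k j l => by linarith [hR.antisymm_left k k j l]
  have aR : ∀ k i j, R k i j j = 0 := fun k i j => by linarith [hR.antisymm_right k i j j]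
  have hL10 := hR.antisymm_left 1 0
  have hL21 := hR.antisymm_left 2 1
  have hL02 := hR.antisymm_left 0 2
  have hR10 := fun k i => hR.antisymm_right k i 1 0
  have hR21 := fun k i => hR.antisymm_right k i 2 1
  have hR02 := fun k i => hR.antisymm_right k i 0 2
  have s1 := hR.pair_symm 1 2 0 1
  have s2 := hR.pair_symm 2 0 0 1
  have s3 := hR.pair_symm 1 2 2 0
  have i10 := hI 1 0
  have i20 := hI 2 0
  have i21 := hI 2 1
  generalize hG : (γ p)⁻¹ = G at *
  have hric : ∀ i j, ricci γ p i j = ∑ m, ∑ l, G m l * R m i j l := fun i j => by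
    simp only [ricci, hc]
  have e1 : (1 : Fin 3) + 1 = 2 := rfl
  have e2 : (2 : Fin 3) + 1 = 0 := rfl
  have e3 : (1 : Fin 3) + 2 = 0 := rfl
  have e4 : (2 : Fin 3) + 2 = 1 := rfl
  simp only [scalarCurv, hric, hG]
  ext k i
  rw [Matrix.mul_apply, Matrix.adjugate_fin_three]
  fin_cases k <;> fin_cases i <;>
  · simp [Fin.sum_univ_three, curvForm, ← hRdef, aL, aR, hL10, hL21, hL02, hR10, hR21, hR02, i10,
      i20, i21, e1, e2, e3, e4, s1, s2, s3]
    ring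

/-- Since `Ê = det(γ⁻¹) • C * γ`, the factors of `det γ` in the definition of `P` cancel, and
`P = √(det C) • C⁻¹` depends on the metric through the curvature form `C` only. -/
lemma tensorP_eq_of_curvForm (hγ : (γ p).PosDef) (hR : IsCurvLike (curvLow γ p))
    (hC : (curvForm γ p).PosDef) :
    tensorP γ p = √(curvForm γ p).det • (curvForm γ p)⁻¹ := by
  have hu : IsUnit (γ p).det := (Matrix.isUnit_iff_isUnit_det _).1 hγ.isUnit
  have huC : IsUnit (curvForm γ p).det := (Matrix.isUnit_iff_isUnit_det _).1 hC.isUnit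
  have hE := einsteinOp_eq_mul_adjugate hγ hR
  set C := curvForm γ p
  set d := (γ p)⁻¹.det
  have hd : 0 < d := hγ.inv.det_pos
  have hdγ : d * (γ p).det = 1 := by
    rw [← Matrix.det_mul, Matrix.nonsing_inv_mul _ hu, Matrix.det_one]
  have hadj : (γ p)⁻¹.adjugate = d • γ p := by
    have h1 : (γ p)⁻¹ * (γ p)⁻¹.adjugate = d • 1 := Matrix.mul_adjugate _
    calc (γ p)⁻¹.adjugate = γ p * ((γ p)⁻¹ * (γ p)⁻¹.adjugate) := by
          rw [← Matrix.mul_assoc, Matrix.mul_nonsing_inv _ hu, Matrix.one_mul]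
      _ = d • γ p := by rw [h1, Matrix.mul_smul, Matrix.mul_one]
  have hE' : einsteinOp γ p = d • (C * γ p) := by rw [hE, hadj, Matrix.mul_smul]
  have hdet : (einsteinOp γ p).det = d ^ 2 * C.det := by
    rw [hE', Matrix.det_smul, Matrix.det_mul, Fintype.card_fin]
    linear_combination (d ^ 2 * C.det) * hdγ
  have hinv : (einsteinOp γ p)⁻¹ = d⁻¹ • ((γ p)⁻¹ * C⁻¹) := by
    apply Matrix.inv_eq_left_inv
    rw [hE', Matrix.smul_mul, Matrix.mul_smul, smul_smul, inv_mul_cancel₀ hd.ne', one_smul,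
      Matrix.mul_assoc, ← Matrix.mul_assoc C⁻¹, Matrix.nonsing_inv_mul _ huC, Matrix.one_mul,
      Matrix.nonsing_inv_mul _ hu]
  have hform : einsteinInv γ p = d⁻¹ • C⁻¹ := by
    have h1 : einsteinInv γ p = ((einsteinOp γ p)⁻¹)ᵀ * γ p := by
      ext i j; simp [einsteinInv, Matrix.mul_apply]
    rw [h1, hinv, Matrix.transpose_smul, Matrix.transpose_mul, Matrix.smul_mul]
    rw [show (C⁻¹)ᵀ = C⁻¹ by simpa using hC.inv.isHermitian.eq,
      show ((γ p)⁻¹)ᵀ = (γ p)⁻¹ by simpa using hγ.inv.isHermitian.eq, Matrix.mul_assoc,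
      Matrix.nonsing_inv_mul _ hu, Matrix.mul_one]
  rw [tensorP, hdet, hform, smul_smul, Real.sqrt_mul (sq_nonneg d), Real.sqrt_sq hd.le]
  congr 1
  field_simp

/-- A symmetric matrix whose cofactor matrix is the matrix of the curvature form solves the Gauss
equation: the cofactors are the minors on its right hand side. -/
lemma curvLow_eq_minor {R : Fin 3 → Fin 3 → Fin 3 → Fin 3 → ℝ} (hR : IsCurvLike R)
    {A : Matrix (Fin 3) (Fin 3) ℝ} (hA : A.IsSymm)
    (h : A.adjugate = fun a b => R (a + 1) (a + 2) (b + 1) (b + 2)) (k i j l : Fin 3) :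
    R k i j l = A k j * A i l - A i j * A k l := by
  have aL : ∀ k j l, R k k j l = 0 := fun k j l => by linarith [hR.antisymm_left k k j l]
  have aR : ∀ k i j, R k i j j = 0 := fun k i j => by linarith [hR.antisymm_right k i j j]
  have hL10 := hR.antisymm_left 1 0
  have hL21 := hR.antisymm_left 2 1
  have hL02 := hR.antisymm_left 0 2
  have hR10 := fun k i => hR.antisymm_right k i 1 0
  have hR21 := fun k i => hR.antisymm_right k i 2 1
  have hR02 := fun k i => hR.antisymm_right k i 0 2
  have e1 : (1 : Fin 3) + 1 = 2 := rfl
  have e2 : (2 : Fin 3) + 1 = 0 := rfl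
  have e3 : (1 : Fin 3) + 2 = 0 := rfl
  have e4 : (2 : Fin 3) + 2 = 1 := rfl
  have i10 : A 1 0 = A 0 1 := hA.apply 0 1
  have i20 : A 2 0 = A 0 2 := hA.apply 0 2
  have i21 : A 2 1 = A 1 2 := hA.apply 1 2
  have key : ∀ a b, R (a + 1) (a + 2) (b + 1) (b + 2) = A.adjugate a b := fun a b => by rw [h]
  rw [Matrix.adjugate_fin_three] at key
  have k00 := key 0 0
  have k01 := key 0 1
  have k02 := key 0 2
  have k10 := key 1 0
  have k11 := key 1 1
  have k12 := key 1 2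
  have k20 := key 2 0
  have k21 := key 2 1
  have k22 := key 2 2
  simp [e1, e2, e3, e4] at k00 k01 k02 k10 k11 k12 k20 k21 k22
  fin_cases k <;> fin_cases i <;> fin_cases j <;> fin_cases l <;>
    simp [aL, aR, hL10, hL21, hL02, hR10, hR21, hR02, k00, k01, k02, k10, k11, k12, k20, k21, k22,
      i10, i20, i21] <;> ring

/-- With `sqrt_det_adjugate_smul_inv`: on positive definite `3 × 3` matrices, `C ↦ √(det C) • C⁻¹` is
the inverse of `A ↦ adj A`. -/
lemma adjugate_sqrt_det_smul_inv {C : Matrix (Fin 3) (Fin 3) ℝ} (hC : C.PosDef) :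
    (√C.det • C⁻¹).adjugate = C := by
  have hd := hC.det_pos
  have huC : IsUnit C.det := (Matrix.isUnit_iff_isUnit_det _).1 hC.isUnit
  have h1 : C⁻¹.adjugate = C.det⁻¹ • C := by
    calc C⁻¹.adjugate = C * (C⁻¹ * C⁻¹.adjugate) := by
          rw [← Matrix.mul_assoc, Matrix.mul_nonsing_inv _ huC, Matrix.one_mul]
      _ = _ := by
          rw [Matrix.mul_adjugate, Matrix.mul_smul, Matrix.mul_one, Matrix.det_nonsing_inv,
            Ring.inverse_eq_inv']
  rw [Matrix.adjugate_smul, h1, smul_smul, Fintype.card_fin, Real.sq_sqrt hd.le,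
    mul_inv_cancel₀ hd.ne', one_smul]

lemma posDef_adjugate {A : Matrix (Fin 3) (Fin 3) ℝ} (hA : A.PosDef) : A.adjugate.PosDef := by
  have hd := hA.det_pos
  have hu : IsUnit A.det := (Matrix.isUnit_iff_isUnit_det _).1 hA.isUnit
  have h1 : A.adjugate = A.det • A⁻¹ := by
    calc A.adjugate = A⁻¹ * (A * A.adjugate) := by
          rw [← Matrix.mul_assoc, Matrix.nonsing_inv_mul _ hu, Matrix.one_mul]
      _ = _ := by rw [Matrix.mul_adjugate, Matrix.mul_smul, Matrix.mul_one]
  rw [h1]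
  exact hA.inv.smul hd

lemma sqrt_det_adjugate_smul_inv {A : Matrix (Fin 3) (Fin 3) ℝ} (hA : A.PosDef) :
    √A.adjugate.det • A.adjugate⁻¹ = A := by
  have hd := hA.det_pos
  have h1 : A.adjugate⁻¹ = A.det⁻¹ • A := by
    apply Matrix.inv_eq_left_inv
    rw [Matrix.smul_mul, Matrix.mul_adjugate, smul_smul, inv_mul_cancel₀ hd.ne', one_smul]
  rw [Matrix.det_adjugate, Fintype.card_fin, Real.sqrt_sq hd.le, h1, smul_smul,
    mul_inv_cancel₀ hd.ne', one_smul]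

/-- A positive definite solution of the Gauss equation is the tensor `P`: it is recovered from its
cofactor matrix, which is the curvature form. -/
lemma tensorP_eq_of_gauss (hγ : (γ p).PosDef) {A : Matrix (Fin 3) (Fin 3) ℝ} (hA : A.PosDef)
    (hG : ∀ k i j l, curvLow γ p k i j l = A k j * A i l - A i j * A k l) :
    tensorP γ p = A := by
  have hs : ∀ a b, A a b = A b a := fun a b => by simpa using hA.isHermitian.apply b a
  have hR : IsCurvLike (curvLow γ p) := by
    constructor <;> intro k i j l <;> simp only [hG]
    · ring
    · ring
    · rw [hs j k, hs l i, hs l k, hs j i]; ring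
  have hC : curvForm γ p = A.adjugate := by
    ext a b
    rw [Matrix.adjugate_fin_three]
    fin_cases a <;> fin_cases b <;>
      · simp [curvForm, hG, show (1 : Fin 3) + 1 = 2 from rfl, show (2 : Fin 3) + 1 = 0 from rfl,
          show (1 : Fin 3) + 2 = 0 from rfl, show (2 : Fin 3) + 2 = 1 from rfl, hs 1 0, hs 2 0,
          hs 2 1]
        try ring
  rw [tensorP_eq_of_curvForm hγ hR (hC ▸ posDef_adjugate hA), hC, sqrt_det_adjugate_smul_inv hA]

/-- Negative sectional curvature makes the curvature form positive definite, since every vector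
is a cross product and `Rm(X, Y, Y, X) = -C(X × Y, X × Y)`. -/
lemma posDef_curvForm (hγ : (γ p).PosDef) (hR : IsCurvLike (curvLow γ p))
    (hneg : ∀ X Y : Fin 3 → ℝ, LinearIndependent ℝ ![X, Y] → sectionalCurv γ p X Y < 0) :
    (curvForm γ p).PosDef := by
  have hquad : ∀ X : Fin 3 → ℝ, X ≠ 0 → 0 < ∑ i, ∑ j, γ p i j * X i * X j := fun X hX => by
    have := hγ.dotProduct_mulVec_pos hX
    simp only [dotProduct, Matrix.mulVec, Finset.mul_sum] at this
    refine this.trans_eq (Finset.sum_congr rfl fun i _ => Finset.sum_congr rfl fun j _ => ?_)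
    simp; ring
  have hs : ∀ a b, γ p a b = γ p b a := fun a b => by simpa using hγ.isHermitian.apply b a
  have hcross : ∀ X Y : Fin 3 → ℝ, (crossProduct X Y) ≠ 0 →
      0 < (crossProduct X Y) ⬝ᵥ (curvForm γ p *ᵥ (crossProduct X Y)) := fun X Y hXY => by
    have hli := (crossProduct_ne_zero_iff_linearIndependent).1 hXY
    have hK := hneg X Y hli
    have hY : Y ≠ 0 := by simpa using hli.ne_zero 1
    rw [sectionalCurv] at hK
    set D := (∑ i, ∑ j, γ p i j * X i * X j) * (∑ i, ∑ j, γ p i j * Y i * Y j)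
      - (∑ i, ∑ j, γ p i j * X i * Y j) ^ 2 with hD
    -- the denominator of the sectional curvature is nonnegative, so that `K < 0` forces the
    -- numerator to be negative
    have hD0 : 0 ≤ D := by
      set a := ∑ i, ∑ j, γ p i j * Y i * Y j with ha
      set b := ∑ i, ∑ j, γ p i j * X i * Y j with hb
      have h1 : ∑ i, ∑ j, γ p i j * (a • X - b • Y) i * (a • X - b • Y) j = a * D := by
        rw [hD, ha, hb]
        simp only [Fin.sum_univ_three, Pi.sub_apply, Pi.smul_apply, smul_eq_mul]
        rw [hs 1 0, hs 2 0, hs 2 1]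
        ring
      have h2 : 0 < a := hquad Y hY
      have h3 : 0 ≤ a * D := by
        rw [← h1]
        by_cases h0 : a • X - b • Y = 0
        · rw [h0]; simp
        · exact (hquad _ h0).le
      exact nonneg_of_mul_nonneg_right h3 h2
    have hnum : ∑ i, ∑ j, ∑ k, ∑ l, ∑ m, X i * Y j * Y k * X l * (curv γ p m i j k * γ p m l) =
        -((crossProduct X Y) ⬝ᵥ (curvForm γ p *ᵥ (crossProduct X Y))) := by
      have h1 : ∀ i j k l, ∑ m, X i * Y j * Y k * X l * (curv γ p m i j k * γ p m l) =
          X i * Y j * Y k * X l * curvLow γ p i j k l := fun i j k l => by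
        rw [curvLow, Finset.mul_sum]
      simp only [h1]
      have aL : ∀ k j l, curvLow γ p k k j l = 0 := fun k j l => by
        linarith [hR.antisymm_left k k j l]
      have aR : ∀ k i j, curvLow γ p k i j j = 0 := fun k i j => by
        linarith [hR.antisymm_right k i j j]
      have hL10 := hR.antisymm_left 1 0
      have hL21 := hR.antisymm_left 2 1
      have hL02 := hR.antisymm_left 0 2
      have hR10 := fun k i => hR.antisymm_right k i 1 0
      have hR21 := fun k i => hR.antisymm_right k i 2 1
      have hR02 := fun k i => hR.antisymm_right k i 0 2
      simp [dotProduct, Matrix.mulVec, Fin.sum_univ_three, curvForm, cross_apply, aL, aR, hL10,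
        hL21, hL02, hR10, hR21, hR02, show (1 : Fin 3) + 1 = 2 from rfl,
        show (2 : Fin 3) + 1 = 0 from rfl, show (1 : Fin 3) + 2 = 0 from rfl,
        show (2 : Fin 3) + 2 = 1 from rfl]
      ring
    rw [hnum] at hK
    by_contra hcon
    exact absurd hK (not_lt.2 (div_nonneg (by linarith) hD0))
  refine Matrix.PosDef.of_dotProduct_mulVec_pos ?_ fun w hw => ?_
  · ext a b
    simpa [curvForm] using hR.pair_symm _ _ _ _
  -- every `w ≠ 0` is a cross product up to a nonzero factor
  have hscale : ∀ (X Y : Fin 3 → ℝ) (c : ℝ), c ≠ 0 → crossProduct X Y = c • w →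
      0 < star w ⬝ᵥ (curvForm γ p *ᵥ w) := fun X Y c hc h => by
    have h1 := hcross X Y (by rw [h]; exact smul_ne_zero hc hw)
    rw [h, Matrix.mulVec_smul, smul_dotProduct, dotProduct_smul, smul_smul, smul_eq_mul] at h1
    have h2 : 0 < c * c := mul_self_pos.2 hc
    have := pos_of_mul_pos_right h1 h2.le
    simpa using this
  by_cases h0 : w 0 = 0
  · by_cases h1 : w 1 = 0
    · have h2 : w 2 ≠ 0 := fun h2 => hw (by ext i; fin_cases i <;> simp [h0, h1, h2])
      refine hscale ![w 2, 0, -w 0] ![0, w 2, -w 1] (w 2) h2 ?_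
      ext i; fin_cases i <;> simp [cross_apply]; ring
    · refine hscale ![0, -w 2, w 1] ![w 1, -w 0, 0] (w 1) h1 ?_
      ext i; fin_cases i <;> simp [cross_apply]; ring
  · refine hscale ![-w 1, w 0, 0] ![-w 2, 0, w 0] (w 0) h0 ?_
    ext i; fin_cases i <;> simp [cross_apply]; ring

/-- In negative curvature the tensor `P` is positive definite and solves the Gauss equation. -/
lemma tensorP_posDef_and_gauss (hγ : (γ p).PosDef) (hR : IsCurvLike (curvLow γ p))
    (hneg : ∀ X Y : Fin 3 → ℝ, LinearIndependent ℝ ![X, Y] → sectionalCurv γ p X Y < 0) :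
    (tensorP γ p).PosDef ∧ ∀ k i j l, curvLow γ p k i j l =
      tensorP γ p k j * tensorP γ p i l - tensorP γ p i j * tensorP γ p k l := by
  have hC := posDef_curvForm hγ hR hneg
  have hP := tensorP_eq_of_curvForm hγ hR hC
  have hpos : (tensorP γ p).PosDef := by
    rw [hP]
    exact hC.inv.smul (Real.sqrt_pos.2 hC.det_pos)
  refine ⟨hpos, curvLow_eq_minor hR (by simpa using hpos.isHermitian) ?_⟩
  rw [hP, adjugate_sqrt_det_smul_inv hC]
  rfl

end Algebra

/-! ### The Frobenius theorem for linear equations -/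

section Frobenius

open Metric Set Filter Topology

variable {E X : Type*} [NormedAddCommGroup E] [NormedSpace ℝ E]
  [NormedAddCommGroup X] [NormedSpace ℝ X]

/-- The solutions near `p₀` of the linear total differential equation `dΦ = Ω Φ`. -/
def IsTotalSol (Ω : E → E →L[ℝ] X →L[ℝ] X) (p₀ : E) (Φ : E → X) : Prop :=
  ∀ᶠ p in 𝓝 p₀, HasFDerivAt Φ ((Ω p).flip (Φ p)) p

/-- Along the ray through `w` the equation is an ordinary differential equation, which is solvable
up to time one if `w` is short. -/
lemma exists_radial_solution [CompleteSpace X] {Ω : E → E →L[ℝ] X →L[ℝ] X} {p₀ : E} {r M : ℝ}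
    (hM : 0 ≤ M) (hMr : M * r ≤ 1 / 2) (hcont : ContinuousOn Ω (ball p₀ r))
    (hΩ : ∀ p ∈ ball p₀ r, ‖Ω p‖ ≤ M) (x₀ : X) {w : E} (hw : ‖w‖ < r) :
    ∃ α : ℝ → X, α 0 = x₀ ∧ ∀ t ∈ Icc (0 : ℝ) 1, ‖α t‖ ≤ 2 * ‖x₀‖ ∧
      HasDerivWithinAt α (Ω (p₀ + t • w) w (α t)) (Icc 0 1) t := by
  have hmem : ∀ t ∈ Icc (0 : ℝ) 1, p₀ + t • w ∈ ball p₀ r := fun t ht => by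
    rw [mem_ball, dist_eq_norm, add_sub_cancel_left, norm_smul, Real.norm_of_nonneg ht.1]
    nlinarith [norm_nonneg w, ht.1, ht.2]
  have hop : ∀ t ∈ Icc (0 : ℝ) 1, ‖Ω (p₀ + t • w) w‖ ≤ 1 / 2 := fun t ht =>
    calc _ ≤ M * ‖w‖ := (Ω _).le_of_opNorm_le (hΩ _ (hmem t ht)) w
      _ ≤ M * r := by gcongr
      _ ≤ _ := hMr
  have hPL : IsPicardLindelof (fun t x => Ω (p₀ + t • w) w x)
      (⟨0, by simp⟩ : Icc (0 : ℝ) 1) x₀ ‖x₀‖₊ 0 ‖x₀‖₊ 1 := by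
    refine ⟨fun t ht => ?_, fun x _ => ?_, fun t ht x hx => ?_, by simp⟩
    · refine ((Ω (p₀ + t • w) w).lipschitz.weaken ?_).lipschitzOnWith
      rw [← NNReal.coe_le_coe, coe_nnnorm]
      exact (hop t ht).trans (by norm_num)
    · have h1 : ContinuousOn (fun t : ℝ => Ω (p₀ + t • w)) (Icc 0 1) :=
        hcont.comp (by fun_prop) hmem
      exact (h1.clm_apply continuousOn_const).clm_apply continuousOn_const
    · have hx' : ‖x‖ ≤ 2 * ‖x₀‖ := by
        have : ‖x - x₀‖ ≤ ‖x₀‖ := by simpa [dist_eq_norm] using hx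
        linarith [norm_le_norm_add_norm_sub' x x₀]
      calc ‖Ω (p₀ + t • w) w x‖ ≤ 1 / 2 * ‖x‖ :=
            (Ω (p₀ + t • w) w).le_of_opNorm_le (hop t ht) x
        _ ≤ 1 / 2 * (2 * ‖x₀‖) := by gcongr
        _ = _ := by simp
  obtain ⟨α, h0, hα⟩ := hPL.exists_eq_forall_mem_Icc_hasDerivWithinAt₀
  have h0 : α 0 = x₀ := h0
  refine ⟨α, h0, fun t ht => ⟨?_, hα t ht⟩⟩
  have hgr := norm_le_gronwallBound_of_norm_deriv_right_le (f := α)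
    (f' := fun t => Ω (p₀ + t • w) w (α t)) (δ := ‖x₀‖) (K := 1 / 2) (ε := 0) (a := 0) (b := 1)
    (fun t ht => (hα t ht).continuousWithinAt)
    (fun t ht => (hα t ⟨ht.1, ht.2.le⟩).mono_of_mem_nhdsWithin (Icc_mem_nhdsGE_of_mem ht))
    (by rw [h0])
    (fun t ht => by
      rw [add_zero]
      exact (Ω (p₀ + t • w) w).le_of_opNorm_le (hop t ⟨ht.1, ht.2.le⟩) _) t ht
  rw [gronwallBound_ε0] at hgr
  have h2 : Real.exp (1 / 2 * (t - 0)) ≤ 2 := by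
    have h3 : Real.exp (1 / 2 * (t - 0)) ≤ Real.exp (1 / 2) := Real.exp_le_exp.2 (by linarith [ht.2])
    have h4 : Real.exp (1 / 2) ^ 2 ≤ 2 ^ 2 := by
      rw [← Real.exp_nat_mul]
      norm_num
      linarith [Real.exp_one_lt_d9]
    have h5 := abs_le_of_sq_le_sq h4 (by norm_num)
    exact h3.trans (le_of_abs_le h5)
  calc ‖α t‖ ≤ ‖x₀‖ * Real.exp (1 / 2 * (t - 0)) := hgr
    _ ≤ ‖x₀‖ * 2 := by gcongr
    _ = _ := by ring

set_option maxSynthPendingDepth 4 in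
/-- **Frobenius theorem** for linear equations: if `Ω` is flat, then `dΦ = Ω Φ` has a solution
near `p₀` with any prescribed value at `p₀`. The solution is found along rays from `p₀`; that it
has the right derivative in the other directions follows by comparing the solutions along nearby
rays, with Grönwall's inequality and the flatness of `Ω`. -/
theorem exists_isTotalSol [CompleteSpace X] {Ω : E → E →L[ℝ] X →L[ℝ] X} {p₀ : E}
    (hΩ : ContDiffAt ℝ 2 Ω p₀)
    (hflat : ∀ᶠ p in 𝓝 p₀, ∀ (u v : E) (x : X),
      fderiv ℝ Ω p u v x + Ω p v (Ω p u x) = fderiv ℝ Ω p v u x + Ω p u (Ω p v x)) (x₀ : X) :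
    ∃ Φ : E → X, Φ p₀ = x₀ ∧ IsTotalSol Ω p₀ Φ := by
  -- uniform bounds for `Ω`, its derivative, and the modulus of continuity of its derivative
  obtain ⟨M, r, hM, hr, hMr, hball⟩ : ∃ M r : ℝ, 0 ≤ M ∧ 0 < r ∧ M * r ≤ 1 / 2 ∧
      ∀ p ∈ ball p₀ r, HasFDerivAt Ω (fderiv ℝ Ω p) p ∧ ‖Ω p‖ ≤ M ∧ ‖fderiv ℝ Ω p‖ ≤ M ∧
        (∀ q ∈ ball p₀ r, ‖fderiv ℝ Ω q - fderiv ℝ Ω p‖ ≤ M * ‖q - p‖) ∧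
        ∀ (u v : E) (x : X),
          fderiv ℝ Ω p u v x + Ω p v (Ω p u x) = fderiv ℝ Ω p v u x + Ω p u (Ω p v x) := by
    have hD : ContDiffAt ℝ 1 (fderiv ℝ Ω) p₀ := hΩ.fderiv_right (by norm_num)
    obtain ⟨K, t, ht, hK⟩ := hD.exists_lipschitzOnWith
    have h1 : ∀ᶠ p in 𝓝 p₀, DifferentiableAt ℝ Ω p :=
      (hΩ.eventually (by simp)).mono fun p hp => hp.differentiableAt (by norm_num)
    have h2 : ∀ᶠ p in 𝓝 p₀, ‖Ω p‖ < ‖Ω p₀‖ + 1 :=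
      hΩ.continuousAt.norm.eventually_lt continuousAt_const (by linarith)
    have h3 : ∀ᶠ p in 𝓝 p₀, ‖fderiv ℝ Ω p‖ < ‖fderiv ℝ Ω p₀‖ + 1 :=
      hD.continuousAt.norm.eventually_lt continuousAt_const (by linarith)
    obtain ⟨ε, hε, hεs⟩ := Metric.eventually_nhds_iff_ball.1 (h1.and (h2.and (h3.and
      (hflat.and ht))))
    set M := max (K : ℝ) (max (‖Ω p₀‖ + 1) (‖fderiv ℝ Ω p₀‖ + 1)) with hMdef
    have hM : 0 ≤ M := le_max_of_le_left K.2
    refine ⟨M, min ε (1 / (2 * (M + 1))), hM, lt_min hε (by positivity), ?_, fun p hp => ?_⟩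
    · calc M * min ε (1 / (2 * (M + 1))) ≤ M * (1 / (2 * (M + 1))) := by
            gcongr; exact min_le_right _ _
        _ ≤ 1 / 2 := by
            rw [mul_one_div, div_le_div_iff₀ (by positivity) (by norm_num)]; linarith
    · have hsub := ball_subset_ball (x := p₀) (min_le_left ε (1 / (2 * (M + 1))))
      obtain ⟨a1, a2, a3, a4, a5⟩ := hεs p (hsub hp)
      refine ⟨a1.hasFDerivAt, ?_, ?_, fun q hq => ?_, a4⟩
      · exact a2.le.trans ((le_max_left _ _).trans (le_max_right _ _))
      · exact a3.le.trans ((le_max_right _ _).trans (le_max_right _ _))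
      · have := hK.dist_le_mul _ (hεs q (hsub hq)).2.2.2.2 _ a5
        rw [dist_eq_norm, dist_eq_norm] at this
        exact this.trans (by gcongr; exact le_max_left _ _)
  have hcont : ContinuousOn Ω (ball p₀ r) := fun p hp =>
    (hball p hp).1.continuousAt.continuousWithinAt
  choose! α hα0 hα using fun w (hw : ‖w‖ < r) =>
    exists_radial_solution hM hMr hcont (fun p hp => (hball p hp).2.1) x₀ hw
  refine ⟨fun p => α (p - p₀) 1, ?_, ?_⟩
  · -- along the constant ray the solution is constant
    have h0 := hα 0 (by simpa using hr)
    have hz := eq_zero_of_abs_deriv_le_mul_abs_self_of_eq_zero_right (f := fun t => α 0 t - x₀)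
      (f' := fun _ => 0) (K := 0) (a := 0) (b := 1)
      (fun t ht => ((h0 t ht).2.continuousWithinAt).sub continuousWithinAt_const)
      (fun t ht => by
        have := ((h0 t ⟨ht.1, ht.2.le⟩).2.mono_of_mem_nhdsWithin
          (Icc_mem_nhdsGE_of_mem ht)).sub_const x₀
        simpa using this)
      (by simp [hα0 0 (by simpa using hr)]) (by simp) 1 (by simp)
    simpa [sub_eq_zero] using hz
  · filter_upwards [ball_mem_nhds p₀ hr] with p hp
    obtain ⟨w, rfl⟩ : ∃ w, p = p₀ + w := ⟨p - p₀, by simp⟩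
    have hw : ‖w‖ < r := by simpa [dist_eq_norm] using hp
    have hmem : ∀ (w : E), ‖w‖ < r → ∀ t ∈ Icc (0 : ℝ) 1, p₀ + t • w ∈ ball p₀ r :=
      fun w hw t ht => by
        rw [mem_ball, dist_eq_norm, add_sub_cancel_left, norm_smul, Real.norm_of_nonneg ht.1]
        nlinarith [norm_nonneg w, ht.1, ht.2]
    set B := 2 * ‖x₀‖ with hB
    set C := M * (r + 1) * B + M * (r + 1) * (M * B) with hC
    -- the values on the rays through `w` and `w + v` differ by `Ω v` up to second order in `v`
    have key : ∀ v : E, ‖w + v‖ < r →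
        ‖α (w + v) 1 - α w 1 - Ω (p₀ + w) v (α w 1)‖ ≤ C * (Real.exp 1 - 1) * ‖v‖ ^ 2 := by
      intro v hv
      have hpt : ∀ t ∈ Icc (0 : ℝ) 1,
          ‖Ω (p₀ + t • (w + v)) - Ω (p₀ + t • w)‖ ≤ M * ‖v‖ ∧
          ‖Ω (p₀ + t • (w + v)) - Ω (p₀ + t • w) - fderiv ℝ Ω (p₀ + t • w) (t • v)‖ ≤
            M * ‖v‖ * ‖v‖ := by
        intro t ht
        have ha := hmem w hw t ht
        have hb := hmem (w + v) hv t ht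
        have hd : p₀ + t • (w + v) - (p₀ + t • w) = t • v := by rw [smul_add]; abel
        have htv : ‖t • v‖ ≤ ‖v‖ := by
          rw [norm_smul, Real.norm_of_nonneg ht.1]
          exact mul_le_of_le_one_left (norm_nonneg _) ht.2
        constructor
        · have := (convex_ball p₀ r).norm_image_sub_le_of_norm_hasFDerivWithin_le
            (fun q hq => (hball q hq).1.hasFDerivWithinAt) (fun q hq => (hball q hq).2.2.1) ha hb
          rw [hd] at this
          exact this.trans (by gcongr)
        · have hseg : segment ℝ (p₀ + t • w) (p₀ + t • (w + v)) ⊆ ball p₀ r :=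
            (convex_ball p₀ r).segment_subset ha hb
          have := (convex_segment (p₀ + t • w) (p₀ + t • (w + v))
            ).norm_image_sub_le_of_norm_hasFDerivWithin_le'
            (φ := fderiv ℝ Ω (p₀ + t • w)) (C := M * ‖v‖)
            (fun q hq => (hball q (hseg hq)).1.hasFDerivWithinAt)
            (fun q hq => ((hball _ ha).2.2.2.1 q (hseg hq)).trans (by
              gcongr
              have := norm_sub_le_of_mem_segment hq
              rw [hd] at this
              exact this.trans htv))
            (left_mem_segment ℝ _ _) (right_mem_segment ℝ _ _)
          rw [hd] at this
          exact this.trans (by gcongr)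
      -- by flatness, `t Ω v α` solves the linearised equation along the ray through `w`, in the
      -- direction `v`
      set W : ℝ → X := fun t => t • Ω (p₀ + t • w) v (α w t) with hW
      have hWd : ∀ t ∈ Icc (0 : ℝ) 1, HasDerivWithinAt W
          (Ω (p₀ + t • w) w (W t) + t • fderiv ℝ Ω (p₀ + t • w) v w (α w t)
            + Ω (p₀ + t • w) v (α w t)) (Icc 0 1) t := by
        intro t ht
        have hray : HasDerivWithinAt (fun t : ℝ => p₀ + t • w) w (Icc 0 1) t := by
          simpa using ((hasDerivAt_id t).smul_const w).const_add p₀ |>.hasDerivWithinAt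
        have h1 := (hball _ (hmem w hw t ht)).1.comp_hasDerivWithinAt t hray
        have h2 := (h1.clm_apply (hasDerivWithinAt_const t (Icc 0 1) v)).clm_apply (hα w hw t ht).2
        have h3 := (hasDerivWithinAt_id t (Icc 0 1)).smul h2
        refine h3.congr_deriv ?_
        have hf := (hball _ (hmem w hw t ht)).2.2.2.2 w v (α w t)
        simp only [hW, Function.comp, id, map_zero, add_zero, map_smul, one_smul]
        rw [hf, smul_add]
        abel
      have hop : ∀ t ∈ Icc (0 : ℝ) 1, ‖Ω (p₀ + t • (w + v)) (w + v)‖ ≤ 1 := fun t ht =>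
        calc _ ≤ M * ‖w + v‖ := (Ω _).le_of_opNorm_le (hball _ (hmem _ hv t ht)).2.1 _
          _ ≤ M * r := by gcongr
          _ ≤ 1 := by linarith
      have hgr := dist_le_of_approx_trajectories_ODE_of_mem
        (v := fun t x => Ω (p₀ + t • (w + v)) (w + v) x) (s := fun _ => univ) (K := 1)
        (f := α (w + v)) (f' := fun t => Ω (p₀ + t • (w + v)) (w + v) (α (w + v) t))
        (g := fun t => α w t + W t)
        (g' := fun t => Ω (p₀ + t • w) w (α w t) + (Ω (p₀ + t • w) w (W t)
          + t • fderiv ℝ Ω (p₀ + t • w) v w (α w t) + Ω (p₀ + t • w) v (α w t)))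
        (a := 0) (b := 1) (εf := 0) (εg := C * ‖v‖ ^ 2) (δ := 0)
        (fun t ht => by
          refine ((Ω (p₀ + t • (w + v)) (w + v)).lipschitz.weaken ?_).lipschitzOnWith
          rw [← NNReal.coe_le_coe, coe_nnnorm]
          exact hop t ⟨ht.1, ht.2.le⟩)
        (fun t ht => (hα _ hv t ht).2.continuousWithinAt)
        (fun t ht => (hα _ hv t ⟨ht.1, ht.2.le⟩).2.mono_of_mem_nhdsWithin
          (Icc_mem_nhdsGE_of_mem ht))
        (fun t _ => by simp) (fun _ _ => mem_univ _)
        (fun t ht => (hα _ hw t ht).2.continuousWithinAt.add (hWd t ht).continuousWithinAt)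
        (fun t ht => ((hα _ hw t ⟨ht.1, ht.2.le⟩).2.add (hWd t ⟨ht.1, ht.2.le⟩)
          ).mono_of_mem_nhdsWithin (Icc_mem_nhdsGE_of_mem ht))
        (fun t ht => by
          have ht' : t ∈ Icc (0 : ℝ) 1 := ⟨ht.1, ht.2.le⟩
          obtain ⟨h1, h2⟩ := hpt t ht'
          have hαB := (hα w hw t ht').1
          have hWB : ‖W t‖ ≤ M * ‖v‖ * B := by
            have hb1 : ‖Ω (p₀ + t • w) v (α w t)‖ ≤ M * ‖v‖ * B :=
              ((Ω (p₀ + t • w)).le_of_opNorm₂_le_of_le (hball _ (hmem w hw t ht')).2.1 le_rfl hαB)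
            simp only [hW]
            rw [norm_smul, Real.norm_of_nonneg ht.1]
            exact (mul_le_of_le_one_left (norm_nonneg _) ht.2.le).trans hb1
          set Ω₁ := Ω (p₀ + t • (w + v))
          set Ω₀ := Ω (p₀ + t • w)
          set D := fderiv ℝ Ω (p₀ + t • w)
          have hsplit : Ω₀ w (α w t) + (Ω₀ w (W t) + t • D v w (α w t) + Ω₀ v (α w t))
              - Ω₁ (w + v) (α w t + W t) =
              -(((Ω₁ - Ω₀ - D (t • v)) w + (Ω₁ - Ω₀) v) (α w t)
                + ((Ω₁ - Ω₀) w + Ω₁ v) (W t)) := by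
            simp only [map_add, map_smul, add_apply,
              sub_apply, smul_apply]
            abel
          rw [dist_eq_norm, hsplit, norm_neg]
          have e1 : ‖(Ω₁ - Ω₀ - D (t • v)) w + (Ω₁ - Ω₀) v‖ ≤ M * (r + 1) * ‖v‖ ^ 2 :=
            calc _ ≤ ‖(Ω₁ - Ω₀ - D (t • v)) w‖ + ‖(Ω₁ - Ω₀) v‖ := norm_add_le _ _
              _ ≤ M * ‖v‖ * ‖v‖ * r + M * ‖v‖ * ‖v‖ :=
                  add_le_add ((ContinuousLinearMap.le_of_opNorm_le_of_le _ h2 hw.le))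
                    (ContinuousLinearMap.le_of_opNorm_le_of_le _ h1 le_rfl)
              _ = _ := by ring
          have e2 : ‖(Ω₁ - Ω₀) w + Ω₁ v‖ ≤ M * (r + 1) * ‖v‖ :=
            calc _ ≤ ‖(Ω₁ - Ω₀) w‖ + ‖Ω₁ v‖ := norm_add_le _ _
              _ ≤ M * ‖v‖ * r + M * ‖v‖ :=
                  add_le_add ((ContinuousLinearMap.le_of_opNorm_le_of_le _ h1 hw.le))
                    (ContinuousLinearMap.le_of_opNorm_le_of_le _
                      (hball _ (hmem _ hv t ht')).2.1 le_rfl)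
              _ = _ := by ring
          calc _ ≤ ‖((Ω₁ - Ω₀ - D (t • v)) w + (Ω₁ - Ω₀) v) (α w t)‖
                + ‖((Ω₁ - Ω₀) w + Ω₁ v) (W t)‖ := norm_add_le _ _
            _ ≤ M * (r + 1) * ‖v‖ ^ 2 * B + M * (r + 1) * ‖v‖ * (M * ‖v‖ * B) :=
                add_le_add (ContinuousLinearMap.le_of_opNorm_le_of_le _ e1 hαB)
                  (ContinuousLinearMap.le_of_opNorm_le_of_le _ e2 hWB)
            _ = C * ‖v‖ ^ 2 := by rw [hC]; ring)
        (fun _ _ => mem_univ _)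
        (by simp [hα0 w hw, hα0 _ hv, hW]) 1 (by simp)
      rw [NNReal.coe_one, gronwallBound_of_K_ne_0 one_ne_zero, dist_eq_norm] at hgr
      simp only [hW, one_smul] at hgr
      rw [sub_sub]
      refine hgr.trans (le_of_eq ?_)
      simp; ring
    rw [hasFDerivAt_iff_isLittleO_nhds_zero]
    have hO : (fun v : E => α (p₀ + w + v - p₀) 1 - α (p₀ + w - p₀) 1
        - ((Ω (p₀ + w)).flip (α (p₀ + w - p₀) 1)) v) =O[𝓝 0] fun v : E => ‖v‖ ^ 2 := by
      refine Asymptotics.IsBigO.of_bound (C * (Real.exp 1 - 1)) ?_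
      have hev : ∀ᶠ v : E in 𝓝 0, ‖w + v‖ < r := by
        have : ContinuousAt (fun v : E => ‖w + v‖) 0 := by fun_prop
        exact this.eventually_lt continuousAt_const (by simpa using hw)
      filter_upwards [hev] with v hv
      rw [add_sub_cancel_left, show p₀ + w + v - p₀ = w + v by abel,
        ContinuousLinearMap.flip_apply, norm_pow, norm_norm]
      exact key v hv
    exact hO.trans_isLittleO (by simpa using Asymptotics.isLittleO_norm_pow_id one_lt_two)

set_option maxSynthPendingDepth 4 in
/-- Solutions of `dΦ = Ω Φ` are determined near `p₀` by their value at `p₀`. -/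
theorem IsTotalSol.eventuallyEq {Ω : E → E →L[ℝ] X →L[ℝ] X} {p₀ : E} {Φ Ψ : E → X}
    (hΩ : ContinuousAt Ω p₀) (hΦ : IsTotalSol Ω p₀ Φ) (hΨ : IsTotalSol Ω p₀ Ψ)
    (h0 : Φ p₀ = Ψ p₀) : Φ =ᶠ[𝓝 p₀] Ψ := by
  have h2 : ∀ᶠ p in 𝓝 p₀, ‖Ω p‖ < ‖Ω p₀‖ + 1 :=
    hΩ.norm.eventually_lt continuousAt_const (lt_add_one _)
  obtain ⟨r, hr, hball⟩ := Metric.eventually_nhds_iff_ball.1 (hΦ.and (hΨ.and h2))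
  filter_upwards [ball_mem_nhds p₀ hr] with p hp
  obtain ⟨w, rfl⟩ : ∃ w, p = p₀ + w := ⟨p - p₀, by simp⟩
  have hw : ‖w‖ < r := by simpa [dist_eq_norm] using hp
  have hmem : ∀ t ∈ Icc (0 : ℝ) 1, p₀ + t • w ∈ ball p₀ r := fun t ht => by
    rw [mem_ball, dist_eq_norm, add_sub_cancel_left, norm_smul, Real.norm_of_nonneg ht.1]
    nlinarith [norm_nonneg w, ht.1, ht.2]
  have hd : ∀ t ∈ Icc (0 : ℝ) 1, HasDerivAt (fun t : ℝ => Φ (p₀ + t • w) - Ψ (p₀ + t • w))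
      (Ω (p₀ + t • w) w (Φ (p₀ + t • w) - Ψ (p₀ + t • w))) t := fun t ht => by
    have hray : HasDerivAt (fun t : ℝ => p₀ + t • w) w t := by
      simpa using ((hasDerivAt_id t).smul_const w).const_add p₀
    obtain ⟨a, b, -⟩ := hball _ (hmem t ht)
    have := (a.comp_hasDerivAt t hray).sub (b.comp_hasDerivAt t hray)
    refine this.congr_deriv ?_
    simp
  have := eq_zero_of_abs_deriv_le_mul_abs_self_of_eq_zero_right
    (f := fun t : ℝ => Φ (p₀ + t • w) - Ψ (p₀ + t • w)) (K := (‖Ω p₀‖ + 1) * ‖w‖)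
    (fun t ht => (hd t ht).continuousAt.continuousWithinAt)
    (fun t ht => (hd t ⟨ht.1, ht.2.le⟩).hasDerivWithinAt) (by simp [h0])
    (fun t ht => (Ω (p₀ + t • w)).le_of_opNorm₂_le_of_le
      (hball _ (hmem t ⟨ht.1, ht.2.le⟩)).2.2.le le_rfl le_rfl) 1 (by simp)
  simpa [sub_eq_zero] using this

set_option maxSynthPendingDepth 4 in
/-- Solutions of `dΦ = Ω Φ` with smooth `Ω` are smooth. -/
theorem contDiffOn_of_total {Ω : E → E →L[ℝ] X →L[ℝ] X} {U : Set E} (hU : IsOpen U) {Φ : E → X}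
    (hΩ : ContDiffOn ℝ ∞ Ω U) (hΦ : ∀ p ∈ U, HasFDerivAt Φ ((Ω p).flip (Φ p)) p) :
    ContDiffOn ℝ ∞ Φ U := by
  rw [contDiffOn_infty]
  intro n
  induction n with
  | zero =>
    simp only [Nat.cast_zero, contDiffOn_zero]
    exact fun p hp => (hΦ p hp).continuousAt.continuousWithinAt
  | succ n ih =>
    have := (contDiffOn_succ_iff_fderiv_of_isOpen (𝕜 := ℝ) (n := n) (f := Φ) hU).2
      ⟨fun p hp => (hΦ p hp).differentiableAt.differentiableWithinAt, by simp, ?_⟩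
    · exact_mod_cast this
    · have h1 : ContDiffOn ℝ n (fun p => (Ω p).flip) U :=
        (ContinuousLinearMap.flipₗᵢ ℝ E X X).toContinuousLinearEquiv.contDiff.comp_contDiffOn
          (contDiffOn_infty.1 hΩ n)
      exact (h1.clm_apply ih).congr fun p hp => (hΦ p hp).fderiv

end Frobenius

/-! ### Partial derivatives and the Minkowski inner product -/

section Calculus

open Filter Topology

variable {n : ℕ} {V : Type*} [NormedAddCommGroup V] [NormedSpace ℝ V]
  {U : Set (EuclideanSpace ℝ (Fin n))} {p : EuclideanSpace ℝ (Fin n)}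

lemma pd_congr {f g : EuclideanSpace ℝ (Fin n) → V} (h : f =ᶠ[𝓝 p] g) (i : Fin n) :
    pd i f p = pd i g p := by
  rw [pd, pd, h.fderiv_eq]

lemma pd_congr_on {f g : EuclideanSpace ℝ (Fin n) → V} (hU : IsOpen U) (h : ∀ q ∈ U, f q = g q)
    (hp : p ∈ U) (i : Fin n) : pd i f p = pd i g p :=
  pd_congr (Filter.eventuallyEq_of_mem (hU.mem_nhds hp) h) i

lemma eq_sum_smul_single (v : EuclideanSpace ℝ (Fin n)) :
    v = ∑ i, v i • EuclideanSpace.single i (1 : ℝ) := by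
  ext j; simp [Finset.sum_apply, Pi.single_apply]

lemma fderiv_apply_eq_sum_pd {f : EuclideanSpace ℝ (Fin n) → V} (v : EuclideanSpace ℝ (Fin n)) :
    fderiv ℝ f p v = ∑ i, v i • pd i f p := by
  conv_lhs => rw [eq_sum_smul_single v]
  simp [map_sum, pd]

/-- The derivative of a differentiable function is determined by its partial derivatives. -/
lemma hasFDerivAt_ext_pd {f : EuclideanSpace ℝ (Fin n) → V}
    {L : EuclideanSpace ℝ (Fin n) →L[ℝ] V} (hf : DifferentiableAt ℝ f p)
    (h : ∀ i, pd i f p = L (EuclideanSpace.single i 1)) : HasFDerivAt f L p := by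
  convert hf.hasFDerivAt using 1
  ext v
  rw [fderiv_apply_eq_sum_pd]
  conv_lhs => rw [eq_sum_smul_single v]
  simp [map_sum, h]

lemma contDiffOn_pd {f : EuclideanSpace ℝ (Fin n) → V} (hU : IsOpen U) (hf : ContDiffOn ℝ ∞ f U)
    (i : Fin n) : ContDiffOn ℝ ∞ (pd i f) U :=
  (hf.fderiv_of_isOpen hU (by simp)).clm_apply contDiffOn_const

lemma differentiableAt_of_contDiffOn {f : EuclideanSpace ℝ (Fin n) → V} (hU : IsOpen U)
    (hf : ContDiffOn ℝ ∞ f U) (hp : p ∈ U) : DifferentiableAt ℝ f p :=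
  (hf.contDiffAt (hU.mem_nhds hp)).differentiableAt (by simp)

lemma pd_comm {f : EuclideanSpace ℝ (Fin n) → V} (hU : IsOpen U) (hf : ContDiffOn ℝ ∞ f U)
    (hp : p ∈ U) (i j : Fin n) : pd i (pd j f) p = pd j (pd i f) p := by
  have hc := hf.contDiffAt (hU.mem_nhds hp)
  have hs := (contDiffAt_infty.1 hc 2).isSymmSndFDerivAt (by simp)
  have hd : DifferentiableAt ℝ (fderiv ℝ f) p :=
    (hc.fderiv_right (m := 1) (by norm_cast)).differentiableAt (by simp)
  have h : ∀ i j : Fin n, pd i (pd j f) p =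
      fderiv ℝ (fderiv ℝ f) p (EuclideanSpace.single i 1) (EuclideanSpace.single j 1) := fun i j => by
    unfold pd
    rw [fderiv_clm_apply hd (differentiableAt_const _)]
    simp
  rw [h, h, hs.eq]

lemma pd_add {f g : EuclideanSpace ℝ (Fin n) → V} (hf : DifferentiableAt ℝ f p)
    (hg : DifferentiableAt ℝ g p) (i : Fin n) :
    pd i (fun q => f q + g q) p = pd i f p + pd i g p := by
  simp [pd, fderiv_fun_add hf hg]

lemma pd_sub {f g : EuclideanSpace ℝ (Fin n) → V} (hf : DifferentiableAt ℝ f p)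
    (hg : DifferentiableAt ℝ g p) (i : Fin n) :
    pd i (fun q => f q - g q) p = pd i f p - pd i g p := by
  simp [pd, fderiv_fun_sub hf hg]

lemma pd_neg {f : EuclideanSpace ℝ (Fin n) → V} (i : Fin n) :
    pd i (fun q => -f q) p = -pd i f p := by
  simp [pd]

@[simp] lemma pd_const (c : V) (i : Fin n) : pd i (fun _ => c) p = 0 := by
  simp [pd]

lemma pd_sum {ι : Type*} {s : Finset ι} {f : ι → EuclideanSpace ℝ (Fin n) → V}
    (hf : ∀ a ∈ s, DifferentiableAt ℝ (f a) p) (i : Fin n) :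
    pd i (fun q => ∑ a ∈ s, f a q) p = ∑ a ∈ s, pd i (f a) p := by
  simp [pd, fderiv_fun_sum hf]

lemma pd_mul {f g : EuclideanSpace ℝ (Fin n) → ℝ} (hf : DifferentiableAt ℝ f p)
    (hg : DifferentiableAt ℝ g p) (i : Fin n) :
    pd i (fun q => f q * g q) p = pd i f p * g p + f p * pd i g p := by
  simp [pd, fderiv_fun_mul hf hg]; ring

lemma pd_const_mul {f : EuclideanSpace ℝ (Fin n) → ℝ} (c : ℝ) (hf : DifferentiableAt ℝ f p)
    (i : Fin n) : pd i (fun q => c * f q) p = c * pd i f p := by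
  simp [pd, fderiv_const_mul hf]

/-- The Minkowski inner product as a continuous bilinear form. -/
def minkL : Minkowski n →L[ℝ] Minkowski n →L[ℝ] ℝ :=
  (innerSL ℝ).bilinearComp (.fst ℝ _ _) (.fst ℝ _ _) -
    (ContinuousLinearMap.mul ℝ ℝ).bilinearComp (.snd ℝ _ _) (.snd ℝ _ _)

lemma minkL_apply (x y : Minkowski n) : minkL x y = mink x y := by
  simp [minkL, mink]

lemma mink_comm (x y : Minkowski n) : mink x y = mink y x := by
  simp only [mink]; rw [real_inner_comm, mul_comm]

lemma mink_add_left (x y z : Minkowski n) : mink (x + y) z = mink x z + mink y z := by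
  simp [← minkL_apply]

lemma mink_smul_left (c : ℝ) (x z : Minkowski n) : mink (c • x) z = c * mink x z := by
  simp [← minkL_apply]

lemma mink_sum_left {ι : Type*} (s : Finset ι) (f : ι → Minkowski n) (z : Minkowski n) :
    mink (∑ a ∈ s, f a) z = ∑ a ∈ s, mink (f a) z := by
  simp [← minkL_apply]

lemma mink_sub_left (x y z : Minkowski n) : mink (x - y) z = mink x z - mink y z := by
  simp [← minkL_apply]

lemma mink_add_right (x y z : Minkowski n) : mink z (x + y) = mink z x + mink z y := by
  simp [← minkL_apply]

lemma mink_smul_right (c : ℝ) (x z : Minkowski n) : mink z (c • x) = c * mink z x := by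
  simp [← minkL_apply]

lemma mink_sum_right {ι : Type*} (s : Finset ι) (f : ι → Minkowski n) (z : Minkowski n) :
    mink z (∑ a ∈ s, f a) = ∑ a ∈ s, mink z (f a) := by
  simp [← minkL_apply]

lemma mink_zero_left (z : Minkowski n) : mink 0 z = 0 := by simp [← minkL_apply]

/-- The Minkowski inner product is nondegenerate. -/
lemma eq_zero_of_mink_eq_zero {w : Minkowski n} (h : ∀ z, mink w z = 0) : w = 0 := by
  have h1 := h (w.1, 0)
  have h2 := h (0, w.2)
  simp only [mink, mul_zero, sub_zero, inner_zero_right, zero_sub, neg_eq_zero,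
    mul_self_eq_zero, inner_self_eq_zero] at h1 h2
  exact Prod.ext h1 h2

lemma hasFDerivAt_mink {E : Type*} [NormedAddCommGroup E] [NormedSpace ℝ E]
    {f g : E → Minkowski n} {f' g' : E →L[ℝ] Minkowski n} {p : E}
    (hf : HasFDerivAt f f' p) (hg : HasFDerivAt g g' p) :
    HasFDerivAt (fun q => mink (f q) (g q))
      ((minkL (f p)).comp g' + (minkL.flip (g p)).comp f') p := by
  have := minkL.hasFDerivAt_of_bilinear hf hg
  simp only [minkL_apply] at this
  refine this.congr_fderiv ?_
  ext v
  simp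

lemma pd_mink {f g : EuclideanSpace ℝ (Fin n) → Minkowski n} (hf : DifferentiableAt ℝ f p)
    (hg : DifferentiableAt ℝ g p) (i : Fin n) :
    pd i (fun q => mink (f q) (g q)) p = mink (pd i f p) (g p) + mink (f p) (pd i g p) := by
  unfold pd
  rw [(hasFDerivAt_mink hf.hasFDerivAt hg.hasFDerivAt).fderiv]
  simp [minkL_apply, add_comm]

lemma contDiffOn_mink {E : Type*} [NormedAddCommGroup E] [NormedSpace ℝ E] {s : Set E}
    {f g : E → Minkowski n} (hf : ContDiffOn ℝ ∞ f s) (hg : ContDiffOn ℝ ∞ g s) :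
    ContDiffOn ℝ ∞ (fun q => mink (f q) (g q)) s := by
  simp only [← minkL_apply]
  exact (minkL.contDiff.comp_contDiffOn hf).clm_apply hg

/-- The components of `T` are smooth functions on `U`. -/
def SmoothOn {ι κ : Type*} (T : EuclideanSpace ℝ (Fin n) → Matrix ι κ ℝ)
    (U : Set (EuclideanSpace ℝ (Fin n))) : Prop :=
  ∀ i j, ContDiffOn ℝ ∞ (fun q => T q i j) U

lemma contDiffOn_det {ι : Type*} [Fintype ι] [DecidableEq ι]
    {T : EuclideanSpace ℝ (Fin n) → Matrix ι ι ℝ} (hT : SmoothOn T U) :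
    ContDiffOn ℝ ∞ (fun q => (T q).det) U := by
  simp only [Matrix.det_apply]
  refine ContDiffOn.sum fun σ _ => ContDiffOn.const_smul _ ?_
  exact contDiffOn_prod fun i _ => hT _ _

lemma SmoothOn.inv {ι : Type*} [Fintype ι] [DecidableEq ι]
    {T : EuclideanSpace ℝ (Fin n) → Matrix ι ι ℝ} (hT : SmoothOn T U)
    (h : ∀ q ∈ U, (T q).det ≠ 0) : SmoothOn (fun q => (T q)⁻¹) U := by
  intro i j
  simp only [Matrix.inv_def, Matrix.smul_apply, smul_eq_mul, Ring.inverse_eq_inv',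
    Matrix.adjugate_apply]
  refine ((contDiffOn_det hT).inv h).mul (contDiffOn_det fun a b => ?_)
  by_cases hab : a = j
  · subst hab; simpa using contDiffOn_const
  · simpa [Matrix.updateRow_ne hab] using hT a b

end Calculus

/-! ### Christoffel symbols and the symmetries of curvature -/

section Christoffel

open Matrix

variable {n : ℕ} {U : Set (EuclideanSpace ℝ (Fin n))} {p : EuclideanSpace ℝ (Fin n)}
  {γ : EuclideanSpace ℝ (Fin n) → Matrix (Fin n) (Fin n) ℝ}

/-- `γ` is a smooth Riemannian metric on the open set `U`. -/
structure IsMetricOn (γ : EuclideanSpace ℝ (Fin n) → Matrix (Fin n) (Fin n) ℝ)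
    (U : Set (EuclideanSpace ℝ (Fin n))) : Prop where
  isOpen : IsOpen U
  smooth : SmoothOn γ U
  posDef : ∀ q ∈ U, (γ q).PosDef

/-- The Christoffel symbols of the first kind, `γ(∇_{∂ᵢ} ∂ⱼ, ∂ₗ)`. -/
def christoffelLow (γ : EuclideanSpace ℝ (Fin n) → Matrix (Fin n) (Fin n) ℝ)
    (p : EuclideanSpace ℝ (Fin n)) (l i j : Fin n) : ℝ :=
  (1 / 2) * (pd i (fun q => γ q j l) p + pd j (fun q => γ q i l) p - pd l (fun q => γ q i j) p)

lemma christoffel_eq (k i j : Fin n) :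
    christoffel γ p k i j = ∑ l, (γ p)⁻¹ k l * christoffelLow γ p l i j := by
  simp only [christoffel, christoffelLow, Finset.mul_sum]
  exact Finset.sum_congr rfl fun _ _ => by ring

namespace IsMetricOn

lemma symm (h : IsMetricOn γ U) (hp : p ∈ U) (i j : Fin n) : γ p i j = γ p j i := by
  simpa using (h.posDef p hp).isHermitian.apply j i

lemma isUnit_det (h : IsMetricOn γ U) (hp : p ∈ U) : IsUnit (γ p).det :=
  (Matrix.isUnit_iff_isUnit_det _).1 (h.posDef p hp).isUnit

lemma inv_symm (h : IsMetricOn γ U) (hp : p ∈ U) (i j : Fin n) : (γ p)⁻¹ i j = (γ p)⁻¹ j i := by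
  simpa using (h.posDef p hp).inv.isHermitian.apply j i

lemma diff (h : IsMetricOn γ U) (hp : p ∈ U) (i j : Fin n) :
    DifferentiableAt ℝ (fun q => γ q i j) p :=
  differentiableAt_of_contDiffOn h.isOpen (h.smooth i j) hp

lemma pd_symm (h : IsMetricOn γ U) (hp : p ∈ U) (k i j : Fin n) :
    pd k (fun q => γ q i j) p = pd k (fun q => γ q j i) p :=
  pd_congr_on h.isOpen (fun _ hq => h.symm hq i j) hp k

lemma sum_inv_mul (h : IsMetricOn γ U) (hp : p ∈ U) (x : Fin n → ℝ) (k : Fin n) :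
    ∑ l, (γ p)⁻¹ k l * ∑ m, γ p l m * x m = x k := by
  have h1 : (γ p)⁻¹ *ᵥ ((γ p) *ᵥ x) = x := by
    rw [Matrix.mulVec_mulVec, Matrix.nonsing_inv_mul _ (h.isUnit_det hp), Matrix.one_mulVec]
  simpa [Matrix.mulVec, dotProduct] using congrFun h1 k

lemma sum_mul_inv (h : IsMetricOn γ U) (hp : p ∈ U) (x : Fin n → ℝ) (k : Fin n) :
    ∑ l, γ p k l * ∑ m, (γ p)⁻¹ l m * x m = x k := by
  have h1 : (γ p) *ᵥ ((γ p)⁻¹ *ᵥ x) = x := by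
    rw [Matrix.mulVec_mulVec, Matrix.mul_nonsing_inv _ (h.isUnit_det hp), Matrix.one_mulVec]
  simpa [Matrix.mulVec, dotProduct] using congrFun h1 k

lemma christoffelLow_symm (h : IsMetricOn γ U) (hp : p ∈ U) (l i j : Fin n) :
    christoffelLow γ p l i j = christoffelLow γ p l j i := by
  simp only [christoffelLow]; rw [h.pd_symm hp l i j]; ring

lemma christoffel_symm (h : IsMetricOn γ U) (hp : p ∈ U) (k i j : Fin n) :
    christoffel γ p k i j = christoffel γ p k j i := by
  simp only [christoffel_eq]
  exact Finset.sum_congr rfl fun l _ => by rw [h.christoffelLow_symm hp]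

lemma christoffelLow_eq (h : IsMetricOn γ U) (hp : p ∈ U) (l i j : Fin n) :
    christoffelLow γ p l i j = ∑ m, γ p l m * christoffel γ p m i j := by
  simp only [christoffel_eq]
  exact (h.sum_mul_inv hp (fun l => christoffelLow γ p l i j) l).symm

/-- The Levi-Civita connection is metric. -/
lemma pd_metric (h : IsMetricOn γ U) (hp : p ∈ U) (k i j : Fin n) :
    pd k (fun q => γ q i j) p = christoffelLow γ p j k i + christoffelLow γ p i k j := by
  simp only [christoffelLow]
  rw [h.pd_symm hp k j i]
  ring

lemma smooth_christoffelLow (h : IsMetricOn γ U) (l i j : Fin n) :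
    ContDiffOn ℝ ∞ (fun q => christoffelLow γ q l i j) U := by
  unfold christoffelLow
  exact contDiffOn_const.mul (((contDiffOn_pd h.isOpen (h.smooth _ _) _).add
    (contDiffOn_pd h.isOpen (h.smooth _ _) _)).sub (contDiffOn_pd h.isOpen (h.smooth _ _) _))

lemma smooth_inv (h : IsMetricOn γ U) : SmoothOn (fun q => (γ q)⁻¹) U :=
  h.smooth.inv fun _ hq => (h.posDef _ hq).det_pos.ne'

lemma smooth_christoffel (h : IsMetricOn γ U) (k i j : Fin n) :
    ContDiffOn ℝ ∞ (fun q => christoffel γ q k i j) U := by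
  simp only [christoffel_eq]
  exact ContDiffOn.sum fun l _ => (h.smooth_inv k l).mul (h.smooth_christoffelLow l i j)

lemma smooth_curv (h : IsMetricOn γ U) (l i j k : Fin n) :
    ContDiffOn ℝ ∞ (fun q => curv γ q l i j k) U := by
  unfold curv
  refine ((contDiffOn_pd h.isOpen (h.smooth_christoffel _ _ _) _).sub
    (contDiffOn_pd h.isOpen (h.smooth_christoffel _ _ _) _)).add (ContDiffOn.sum fun m _ => ?_)
  exact ((h.smooth_christoffel _ _ _).mul (h.smooth_christoffel _ _ _)).sub
    ((h.smooth_christoffel _ _ _).mul (h.smooth_christoffel _ _ _))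

lemma smooth_curvLow (h : IsMetricOn γ U) (k i j l : Fin n) :
    ContDiffOn ℝ ∞ (fun q => curvLow γ q k i j l) U := by
  unfold curvLow
  exact ContDiffOn.sum fun m _ => (h.smooth_curv _ _ _ _).mul (h.smooth _ _)

/-- The lowered curvature tensor in terms of the Christoffel symbols of the first kind. -/
lemma curvLow_eq (h : IsMetricOn γ U) (hp : p ∈ U) (k i j l : Fin n) :
    curvLow γ p k i j l = pd k (fun q => christoffelLow γ q l i j) p
      - pd i (fun q => christoffelLow γ q l k j) p
      - ∑ m, christoffelLow γ p m k l * christoffel γ p m i j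
      + ∑ m, christoffelLow γ p m i l * christoffel γ p m k j := by
  have hpd : ∀ k i j, pd k (fun q => christoffelLow γ q l i j) p =
      ∑ m, ((christoffelLow γ p m k l + christoffelLow γ p l k m) * christoffel γ p m i j
        + γ p l m * pd k (fun q => christoffel γ q m i j) p) := fun k i j => by
    rw [pd_congr_on h.isOpen (fun q hq => h.christoffelLow_eq hq l i j) hp, pd_sum]
    · refine Finset.sum_congr rfl fun m _ => ?_
      rw [pd_mul (h.diff hp _ _)
        (differentiableAt_of_contDiffOn h.isOpen (h.smooth_christoffel _ _ _) hp), h.pd_metric hp]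
    · exact fun m _ => (h.diff hp _ _).mul
        (differentiableAt_of_contDiffOn h.isOpen (h.smooth_christoffel _ _ _) hp)
  have hquad : ∀ k i j, ∑ m, (∑ a, christoffel γ p a i j * christoffel γ p m k a) * γ p m l =
      ∑ a, christoffelLow γ p l k a * christoffel γ p a i j := fun k i j => by
    simp only [Finset.sum_mul]
    rw [Finset.sum_comm]
    refine Finset.sum_congr rfl fun a _ => ?_
    rw [h.christoffelLow_eq hp, Finset.sum_mul]
    exact Finset.sum_congr rfl fun m _ => by rw [h.symm hp m l]; ring
  rw [hpd, hpd]
  have h1 := hquad k i j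
  have h2 := hquad i k j
  simp only [curvLow, curv, Finset.sum_sub_distrib, add_mul, sub_mul, Finset.sum_add_distrib]
  rw [h1, h2]
  simp only [h.symm hp l, mul_comm (γ p _ l)]
  ring

/-- The curvature tensor of a metric has the algebraic symmetries of a curvature tensor. -/
lemma isCurvLike (h : IsMetricOn γ U) (hp : p ∈ U) : IsCurvLike (curvLow γ p) := by
  have hdd : ∀ i j l : Fin n, DifferentiableAt ℝ (pd i (fun q => γ q j l)) p := fun i j l =>
    differentiableAt_of_contDiffOn h.isOpen (contDiffOn_pd h.isOpen (h.smooth _ _) _) hp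
  have hpd : ∀ k l i j, pd k (fun q => christoffelLow γ q l i j) p =
      1 / 2 * (pd k (pd i (fun q => γ q j l)) p + pd k (pd j (fun q => γ q i l)) p
        - pd k (pd l (fun q => γ q i j)) p) := fun k l i j => by
    unfold christoffelLow
    rw [pd_const_mul, pd_sub, pd_add]
    · exact hdd _ _ _
    · exact hdd _ _ _
    · exact (hdd _ _ _).add (hdd _ _ _)
    · exact hdd _ _ _
    · exact ((hdd _ _ _).add (hdd _ _ _)).sub (hdd _ _ _)
  have hc : ∀ k i j l, pd k (pd i (fun q => γ q j l)) p = pd i (pd k (fun q => γ q j l)) p :=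
    fun k i j l => pd_comm h.isOpen (h.smooth _ _) hp k i
  have hs : ∀ k i j l, pd k (pd i (fun q => γ q j l)) p = pd k (pd i (fun q => γ q l j)) p :=
    fun k i j l => pd_congr_on h.isOpen (fun q hq => h.pd_symm hq i j l) hp k
  set Q : Fin n → Fin n → Fin n → Fin n → ℝ :=
    fun k l i j => ∑ m, christoffelLow γ p m k l * christoffel γ p m i j with hQ
  have hQs : ∀ k l i j, Q k l i j = Q i j k l := fun k l i j => by
    simp only [hQ, christoffel_eq, Finset.mul_sum]
    rw [Finset.sum_comm]
    exact Finset.sum_congr rfl fun a _ => Finset.sum_congr rfl fun b _ => by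
      rw [h.inv_symm hp b a]; ring
  have hQl : ∀ k l i j, Q k l i j = Q l k i j := fun k l i j => by
    simp only [hQ]
    exact Finset.sum_congr rfl fun a _ => by rw [h.christoffelLow_symm hp]
  have hR : ∀ k i j l, curvLow γ p k i j l =
      1 / 2 * (pd k (pd j (fun q => γ q i l)) p - pd k (pd l (fun q => γ q i j)) p
        - pd i (pd j (fun q => γ q k l)) p + pd i (pd l (fun q => γ q k j)) p)
        - Q k l i j + Q i l k j := fun k i j l => by
    rw [h.curvLow_eq hp, hpd, hpd, hc k i]
    ring
  -- what remains is that partial derivatives commute and that `Q`, which is the product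
  -- `γ(∇_k ∂_l, ∇_i ∂_j)`, is symmetric
  constructor
  · intro k i j l
    rw [hR, hR]; ring
  · intro k i j l
    rw [hR, hR, hQs k j i l, hQs i j k l]; ring
  · intro k i j l
    rw [hR, hR]
    linarith [hQs j i l k, hQl l k j i, hQs k l j i, hQl j i k l, hQs i j k l, hQs l i j k,
      hQl j k l i, hQs k j l i, hQl l i k j, hc k j i l, hs j k i l, hc k l i j, hs l k i j,
      hc i j k l, hs j i k l, hc i l k j, hs l i k j]

end IsMetricOn

end Christoffel

/-! ### The equations of Gauss and Codazzi for hypersurfaces of Minkowski space -/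

section Immersion

open Matrix

variable {n : ℕ} {U : Set (EuclideanSpace ℝ (Fin n))} {p : EuclideanSpace ℝ (Fin n)}
  {γ A : EuclideanSpace ℝ (Fin n) → Matrix (Fin n) (Fin n) ℝ}
  {f ν : EuclideanSpace ℝ (Fin n) → Minkowski n}

/-- On the open set `U`, `f` is an immersion into Minkowski space which induces the metric `γ` and
has the timelike unit normal `ν` and the second fundamental form `A`. Since `⟨∂ⱼ f, ν⟩ = 0`, the
second fundamental form `-⟨∂ᵢ ∂ⱼ f, ν⟩` equals `⟨∂ⱼ f, ∂ᵢ ν⟩`. -/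
structure IsHypersurface (γ A : EuclideanSpace ℝ (Fin n) → Matrix (Fin n) (Fin n) ℝ)
    (U : Set (EuclideanSpace ℝ (Fin n))) (f ν : EuclideanSpace ℝ (Fin n) → Minkowski n) :
    Prop where
  smooth : ContDiffOn ℝ ∞ f U
  smooth_normal : ContDiffOn ℝ ∞ ν U
  metric : ∀ q ∈ U, ∀ i j, mink (pd i f q) (pd j f q) = γ q i j
  normal : ∀ q ∈ U, ∀ i, mink (pd i f q) (ν q) = 0
  unit : ∀ q ∈ U, mink (ν q) (ν q) = -1
  shape : ∀ q ∈ U, ∀ i j, mink (pd j f q) (pd i ν q) = A q i j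

/-- A family of vectors `e₀, …, eₙ₋₁, w` of Minkowski space with nondegenerate Gram matrix
`diag(G, -1)`. -/
structure IsFrame (G : Matrix (Fin n) (Fin n) ℝ) (e : Fin n → Minkowski n) (w : Minkowski n) :
    Prop where
  gram : ∀ i j, mink (e i) (e j) = G i j
  normal : ∀ i, mink (e i) w = 0
  unit : mink w w = -1

namespace IsFrame

variable {G : Matrix (Fin n) (Fin n) ℝ} {e : Fin n → Minkowski n} {w : Minkowski n}

lemma linearIndependent (h : IsFrame G e w) (hG : IsUnit G.det) :
    LinearIndependent ℝ (fun a : Option (Fin n) => a.elim w e) := by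
  rw [Fintype.linearIndependent_iff]
  intro c hc
  rw [Fintype.sum_option] at hc
  simp only [Option.elim] at hc
  have h0 : c none = 0 := by
    have := congrArg (fun z => mink z w) hc
    simpa [mink_add_left, mink_smul_left, mink_sum_left, h.normal, h.unit, mink_zero_left]
      using this
  have h1 : (fun i => c (some i)) ᵥ* G = 0 := by
    ext j
    have := congrArg (fun z => mink z (e j)) hc
    simpa [mink_add_left, mink_smul_left, mink_sum_left, mink_comm w, h.normal, h.gram,
      mink_zero_left, Matrix.vecMul, dotProduct] using this
  have h2 : (fun i => c (some i)) = 0 := by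
    have := congrArg (fun z => z ᵥ* G⁻¹) h1
    simpa [Matrix.vecMul_vecMul, Matrix.mul_nonsing_inv _ hG] using this
  rintro (_ | i)
  · exact h0
  · exact congrFun h2 i

/-- A frame, as a basis of Minkowski space. -/
def basis (h : IsFrame G e w) (hG : IsUnit G.det) :
    Module.Basis (Option (Fin n)) ℝ (Minkowski n) :=
  basisOfLinearIndependentOfCardEqFinrank (h.linearIndependent hG) (by simp)

lemma basis_some (h : IsFrame G e w) (hG : IsUnit G.det) (i : Fin n) :
    h.basis hG (some i) = e i := by
  simp [basis]

lemma basis_none (h : IsFrame G e w) (hG : IsUnit G.det) : h.basis hG none = w := by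
  simp [basis]

/-- A vector is determined by its products with the members of a frame. -/
lemma ext (h : IsFrame G e w) (hG : IsUnit G.det) {x y : Minkowski n}
    (he : ∀ i, mink x (e i) = mink y (e i)) (hw : mink x w = mink y w) : x = y := by
  rw [← sub_eq_zero]
  refine eq_zero_of_mink_eq_zero fun z => ?_
  rw [← (h.basis hG).sum_repr z, mink_sum_right, Fintype.sum_option]
  simp [mink_smul_right, mink_sub_left, basis_some, basis_none, he, hw]

end IsFrame

namespace IsHypersurface

lemma frame (hf : IsHypersurface γ A U f ν) (hp : p ∈ U) :
    IsFrame (γ p) (fun i => pd i f p) (ν p) :=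
  ⟨hf.metric p hp, hf.normal p hp, hf.unit p hp⟩

lemma diff (hf : IsHypersurface γ A U f ν) (hU : IsOpen U) (hp : p ∈ U) (i : Fin n) :
    DifferentiableAt ℝ (pd i f) p :=
  differentiableAt_of_contDiffOn hU (contDiffOn_pd hU hf.smooth i) hp

lemma diff_normal (hf : IsHypersurface γ A U f ν) (hU : IsOpen U) (hp : p ∈ U) :
    DifferentiableAt ℝ ν p :=
  differentiableAt_of_contDiffOn hU hf.smooth_normal hp

/-- Differentiating `⟨∂ⱼ f, ν⟩ = 0`. -/
lemma mink_pd_pd_normal (hf : IsHypersurface γ A U f ν) (hU : IsOpen U) (hp : p ∈ U)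
    (i j : Fin n) : mink (pd i (pd j f) p) (ν p) = -A p i j := by
  have h1 := pd_mink (hf.diff hU hp j) (hf.diff_normal hU hp) i
  rw [pd_congr_on hU (fun q hq => hf.normal q hq j) hp, hf.shape p hp] at h1
  simp [pd] at h1 ⊢
  linarith

lemma secondFF_eq (hf : IsHypersurface γ A U f ν) (hU : IsOpen U) (hp : p ∈ U) :
    (fun i j => -mink (pd i (pd j f) p) (ν p)) = A p := by
  ext i j; rw [hf.mink_pd_pd_normal hU hp, neg_neg]

lemma shape_symm (hf : IsHypersurface γ A U f ν) (hU : IsOpen U) (hp : p ∈ U) (i j : Fin n) :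
    A p i j = A p j i := by
  rw [← neg_inj, ← hf.mink_pd_pd_normal hU hp, ← hf.mink_pd_pd_normal hU hp,
    pd_comm hU hf.smooth hp]

lemma smooth_shape (hf : IsHypersurface γ A U f ν) (hU : IsOpen U) : SmoothOn A U := fun i j =>
  (contDiffOn_mink (contDiffOn_pd hU hf.smooth j) (contDiffOn_pd hU hf.smooth_normal i)).congr
    fun q hq => (hf.shape q hq i j).symm

/-- The tangential part of `∂ᵢ ∂ⱼ f` is given by the Levi-Civita connection of the induced metric. -/
lemma mink_pd_pd_tangent (hf : IsHypersurface γ A U f ν) (hU : IsOpen U) (hp : p ∈ U)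
    (i j l : Fin n) : mink (pd i (pd j f) p) (pd l f p) = christoffelLow γ p l i j := by
  have h1 : ∀ i j l, pd i (fun q => γ q j l) p =
      mink (pd i (pd j f) p) (pd l f p) + mink (pd i (pd l f) p) (pd j f p) := fun i j l => by
    rw [← pd_congr_on hU (fun q hq => hf.metric q hq j l) hp, pd_mink (hf.diff hU hp j)
      (hf.diff hU hp l), mink_comm (pd j f p)]
  simp only [christoffelLow, h1]
  rw [pd_comm hU hf.smooth hp j i, pd_comm hU hf.smooth hp l i, pd_comm hU hf.smooth hp l j]
  ring

lemma mink_pd_normal (hf : IsHypersurface γ A U f ν) (hU : IsOpen U) (hp : p ∈ U) (i : Fin n) :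
    mink (pd i ν p) (ν p) = 0 := by
  have h1 := pd_mink (hf.diff_normal hU hp) (hf.diff_normal hU hp) i
  rw [pd_congr_on hU (fun q hq => hf.unit q hq) hp, mink_comm (ν p)] at h1
  simp [pd] at h1 ⊢
  linarith

/-- The Gauss formula. -/
lemma gauss_formula (hf : IsHypersurface γ A U f ν) (hγ : IsMetricOn γ U) (hp : p ∈ U)
    (i j : Fin n) :
    pd i (pd j f) p = ∑ k, christoffel γ p k i j • pd k f p + A p i j • ν p := by
  have hU := hγ.isOpen
  refine (hf.frame hp).ext (hγ.isUnit_det hp) (fun l => ?_) ?_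
  · rw [hf.mink_pd_pd_tangent hU hp, mink_add_left, mink_sum_left, hγ.christoffelLow_eq hp]
    simp only [mink_smul_left, hf.metric p hp, mink_comm (ν p), hf.normal p hp, mul_zero, add_zero]
    exact Finset.sum_congr rfl fun m _ => by rw [hγ.symm hp, mul_comm]
  · rw [hf.mink_pd_pd_normal hU hp, mink_add_left, mink_sum_left]
    simp [mink_smul_left, hf.normal p hp, hf.unit p hp]

/-- The Weingarten formula. -/
lemma weingarten_formula (hf : IsHypersurface γ A U f ν) (hγ : IsMetricOn γ U) (hp : p ∈ U)
    (i : Fin n) :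
    pd i ν p = ∑ k, (∑ l, (γ p)⁻¹ k l * A p i l) • pd k f p := by
  have hU := hγ.isOpen
  refine (hf.frame hp).ext (hγ.isUnit_det hp) (fun l => ?_) ?_
  · rw [mink_sum_left, mink_comm, hf.shape p hp, ← hγ.sum_mul_inv hp (fun l => A p i l) l]
    simp only [mink_smul_left, hf.metric p hp]
    exact Finset.sum_congr rfl fun m _ => by rw [hγ.symm hp, mul_comm]
  · rw [hf.mink_pd_normal hU hp, mink_sum_left]
    simp [mink_smul_left, hf.normal p hp]

/-- Second derivatives of `f` pair through their tangential and normal parts; the sign of the normal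
term is that of `⟨ν, ν⟩ = -1`. -/
lemma mink_pd_pd_pd_pd (hf : IsHypersurface γ A U f ν) (hγ : IsMetricOn γ U) (hp : p ∈ U)
    (k l i j : Fin n) : mink (pd i (pd j f) p) (pd k (pd l f) p) =
      ∑ m, christoffelLow γ p m k l * christoffel γ p m i j - A p i j * A p k l := by
  have hU := hγ.isOpen
  rw [hf.gauss_formula hγ hp i j, mink_add_left, mink_sum_left, mink_smul_left, mink_comm (ν p),
    hf.mink_pd_pd_normal hU hp]
  simp only [mink_smul_left, mink_comm (pd _ f p) (pd k (pd l f) p), hf.mink_pd_pd_tangent hU hp]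
  simp only [mul_comm (christoffelLow _ _ _ _ _)]
  ring

/-- The Gauss equation: the third derivatives of `f` cancel in the difference of
`∂ₖ ⟨∂ᵢ ∂ⱼ f, ∂ₗ f⟩` and `∂ᵢ ⟨∂ₖ ∂ⱼ f, ∂ₗ f⟩`. -/
lemma gauss_equation (hf : IsHypersurface γ A U f ν) (hγ : IsMetricOn γ U) (hp : p ∈ U)
    (k i j l : Fin n) : curvLow γ p k i j l = A p k j * A p i l - A p i j * A p k l := by
  have hU := hγ.isOpen
  have h1 : ∀ k i j, pd k (fun q => christoffelLow γ q l i j) p =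
      mink (pd k (pd i (pd j f)) p) (pd l f p) + mink (pd i (pd j f) p) (pd k (pd l f) p) :=
    fun k i j => by
      rw [← pd_congr_on hU (fun q hq => hf.mink_pd_pd_tangent hU hq i j l) hp]
      exact pd_mink (differentiableAt_of_contDiffOn hU
        (contDiffOn_pd hU (contDiffOn_pd hU hf.smooth _) _) hp) (hf.diff hU hp l) k
  rw [hγ.curvLow_eq hp, h1, h1, pd_comm hU (contDiffOn_pd hU hf.smooth j) hp k i,
    hf.mink_pd_pd_pd_pd hγ hp, hf.mink_pd_pd_pd_pd hγ hp]
  ring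

/-- The Codazzi equation, from the third derivatives of `f` in the normal direction. -/
lemma isCodazziAt (hf : IsHypersurface γ A U f ν) (hγ : IsMetricOn γ U) (hp : p ∈ U) :
    IsCodazziAt γ A p := by
  have hU := hγ.isOpen
  have hs := hf.shape_symm hU hp
  have hcs : ∀ k i j, covDeriv γ A p k i j = covDeriv γ A p k j i := fun k i j => by
    simp only [covDeriv]
    rw [pd_congr_on hU (fun q hq => hf.shape_symm hU hq i j) hp]
    congr 1
    exact Finset.sum_congr rfl fun m _ => by rw [hs m j, hs m i]; ring
  refine ⟨Matrix.IsSymm.ext fun i j => hs j i, fun k i j => ⟨?_, hcs k i j⟩⟩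
  have h1 : ∀ k i j, pd k (fun q => A q i j) p =
      -mink (pd k (pd i (pd j f)) p) (ν p) - ∑ m, christoffel γ p m i j * A p k m :=
    fun k i j => by
      rw [pd_congr_on hU (g := fun q => -mink (pd i (pd j f) q) (ν q)) (fun q hq => by
        rw [hf.mink_pd_pd_normal hU hq, neg_neg]) hp, pd_neg, pd_mink
        (differentiableAt_of_contDiffOn hU (contDiffOn_pd hU (contDiffOn_pd hU hf.smooth _) _) hp)
        (hf.diff_normal hU hp), hf.gauss_formula hγ hp i j, mink_add_left, mink_sum_left]
      simp only [mink_smul_left, hf.shape p hp, mink_comm (ν p), hf.mink_pd_normal hU hp]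
      ring
  simp only [covDeriv, h1, pd_comm hU (contDiffOn_pd hU hf.smooth j) hp k i,
    Finset.sum_add_distrib, hγ.christoffel_symm hp _ k i, hs k, hs i]
  ring

end IsHypersurface

/-- A hypersurface of Minkowski four-space with positive definite second fundamental form `A` has
`A = P`. -/
lemma IsHypersurface.tensorP_eq {γ A : EuclideanSpace ℝ (Fin 3) → Matrix (Fin 3) (Fin 3) ℝ}
    {U : Set (EuclideanSpace ℝ (Fin 3))} {p : EuclideanSpace ℝ (Fin 3)}
    {f ν : EuclideanSpace ℝ (Fin 3) → Minkowski 3} (hf : IsHypersurface γ A U f ν)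
    (hγ : IsMetricOn γ U) (hp : p ∈ U) (hA : (A p).PosDef) : tensorP γ p = A p :=
  tensorP_eq_of_gauss (hγ.posDef p hp) hA fun k i j l => hf.gauss_equation hγ hp k i j l

lemma IsCodazziAt.congr {T T' : EuclideanSpace ℝ (Fin n) → Matrix (Fin n) (Fin n) ℝ}
    (hU : IsOpen U) (hp : p ∈ U) (hT : ∀ q ∈ U, T q = T' q) (h : IsCodazziAt γ T p) :
    IsCodazziAt γ T' p := by
  have h1 : ∀ k i j, covDeriv γ T p k i j = covDeriv γ T' p k i j := fun k i j => by
    simp only [covDeriv, hT p hp]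
    rw [pd_congr_on hU (fun q hq => by rw [hT q hq]) hp]
  simpa only [IsCodazziAt, h1, hT p hp] using h

end Immersion

/-! ### Linear total differential equations in coordinates -/

section FrameEquation

set_option maxSynthPendingDepth 4
set_option synthInstance.maxHeartbeats 200000

open Filter Topology

variable {n : ℕ} {κ : Type*} [Fintype κ] [DecidableEq κ] {W : Type*} [NormedAddCommGroup W]
  [NormedSpace ℝ W] {p : EuclideanSpace ℝ (Fin n)}

/-- The linear total differential equation `∂ᵢ x_α = Σ_β (θ i)_αβ x_β` for a family of vectors
`x_α` of `W`. -/
def matrixSystem (W : Type*) [NormedAddCommGroup W] [NormedSpace ℝ W]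
    (θ : EuclideanSpace ℝ (Fin n) → Fin n → Matrix κ κ ℝ) (p : EuclideanSpace ℝ (Fin n)) :
    EuclideanSpace ℝ (Fin n) →L[ℝ] (κ → W) →L[ℝ] (κ → W) :=
  ∑ i, ∑ α, ∑ β, θ p i α β • (EuclideanSpace.proj i : EuclideanSpace ℝ (Fin n) →L[ℝ] ℝ).smulRight
    ((ContinuousLinearMap.single ℝ (fun _ : κ => W) α).comp
      (ContinuousLinearMap.proj β : (κ → W) →L[ℝ] W))

lemma matrixSystem_apply (θ : EuclideanSpace ℝ (Fin n) → Fin n → Matrix κ κ ℝ)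
    (v : EuclideanSpace ℝ (Fin n)) (x : κ → W) (α : κ) :
    matrixSystem W θ p v x α = ∑ i, v i • ∑ β, θ p i α β • x β := by
  simp only [matrixSystem, sum_apply, Finset.sum_apply, smul_apply, Finset.smul_sum,
    ContinuousLinearMap.smulRight_apply, Pi.smul_apply, ContinuousLinearMap.comp_apply,
    ContinuousLinearMap.single_apply, ContinuousLinearMap.proj_apply]
  refine Finset.sum_congr rfl fun i _ => ?_
  rw [Finset.sum_eq_single α (fun a _ ha => by simp [ha.symm]) (by simp)]
  exact Finset.sum_congr rfl fun b _ => by rw [Pi.single_eq_same, smul_comm]; rfl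

lemma matrixSystem_single (θ : EuclideanSpace ℝ (Fin n) → Fin n → Matrix κ κ ℝ)
    (i : Fin n) (x : κ → W) (α : κ) :
    matrixSystem W θ p (EuclideanSpace.single i 1) x α = ∑ β, θ p i α β • x β := by
  rw [matrixSystem_apply]
  simp

lemma contDiffOn_matrixSystem {θ : EuclideanSpace ℝ (Fin n) → Fin n → Matrix κ κ ℝ}
    {U : Set (EuclideanSpace ℝ (Fin n))} (hθ : ∀ i, SmoothOn (fun q => θ q i) U) :
    ContDiffOn ℝ ∞ (matrixSystem W θ) U := by
  unfold matrixSystem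
  exact ContDiffOn.sum fun i _ => ContDiffOn.sum fun α _ => ContDiffOn.sum fun β _ =>
    (hθ i α β).smul contDiffOn_const

lemma isTotalSol_matrixSystem {θ : EuclideanSpace ℝ (Fin n) → Fin n → Matrix κ κ ℝ}
    {x : EuclideanSpace ℝ (Fin n) → κ → W}
    (hx : ∀ᶠ q in 𝓝 p, ∀ α, DifferentiableAt ℝ (fun q => x q α) q ∧
      ∀ i, pd i (fun q => x q α) q = ∑ β, θ q i α β • x q β) :
    IsTotalSol (matrixSystem W θ) p x := by
  filter_upwards [hx] with q hq
  refine hasFDerivAt_pi'.2 fun α => hasFDerivAt_ext_pd (hq α).1 fun i => ?_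
  rw [(hq α).2 i]
  simp [matrixSystem_single]

lemma IsTotalSol.pd_eq {θ : EuclideanSpace ℝ (Fin n) → Fin n → Matrix κ κ ℝ}
    {x : EuclideanSpace ℝ (Fin n) → κ → W} (hx : IsTotalSol (matrixSystem W θ) p x) :
    ∀ᶠ q in 𝓝 p, ∀ α, DifferentiableAt ℝ (fun q => x q α) q ∧
      ∀ i, pd i (fun q => x q α) q = ∑ β, θ q i α β • x q β := by
  filter_upwards [hx] with q hq α
  have h1 := hasFDerivAt_pi'.1 hq α
  refine ⟨h1.differentiableAt, fun i => ?_⟩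
  rw [pd, h1.fderiv]
  simp [matrixSystem_single]

/-- The Frobenius theorem for the equation `∂ᵢ x_α = Σ_β (θ i)_αβ x_β`. -/
theorem exists_matrixSystem_sol [CompleteSpace W]
    {θ : EuclideanSpace ℝ (Fin n) → Fin n → Matrix κ κ ℝ} {U : Set (EuclideanSpace ℝ (Fin n))}
    (hU : IsOpen U) (hθ : ∀ i, SmoothOn (fun q => θ q i) U) (hp : p ∈ U)
    (hflat : ∀ q ∈ U, ∀ a b α β, pd a (fun q => θ q b α β) q + ∑ μ, θ q b α μ * θ q a μ β =
      pd b (fun q => θ q a α β) q + ∑ μ, θ q a α μ * θ q b μ β) (x₀ : κ → W) :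
    ∃ x : EuclideanSpace ℝ (Fin n) → κ → W, x p = x₀ ∧ IsTotalSol (matrixSystem W θ) p x := by
  have hs := contDiffOn_matrixSystem (W := W) hθ
  refine exists_isTotalSol (contDiffAt_infty.1 (hs.contDiffAt (hU.mem_nhds hp)) 2) ?_ x₀
  filter_upwards [hU.mem_nhds hp] with q hq u v x
  -- flatness is bilinear in `u` and `v`, and on basis vectors it is the assumption on `θ`
  have hpd : ∀ a b : Fin n, ∀ α, fderiv ℝ (matrixSystem W θ) q (EuclideanSpace.single a 1)
      (EuclideanSpace.single b 1) x α = ∑ β, pd a (fun q => θ q b α β) q • x β := by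
    intro a b α
    have hd : DifferentiableAt ℝ (matrixSystem W θ) q := differentiableAt_of_contDiffOn hU hs hq
    have h1 := (((ContinuousLinearMap.proj α : (κ → W) →L[ℝ] W).hasFDerivAt).comp q
      ((hd.hasFDerivAt.clm_apply (hasFDerivAt_const (EuclideanSpace.single b (1 : ℝ)) q)).clm_apply
      (hasFDerivAt_const x q)))
    have h2 : HasFDerivAt (fun q => ∑ β, θ q b α β • x β)
        (∑ β, (fderiv ℝ (fun q => θ q b α β) q).smulRight (x β)) q :=
      HasFDerivAt.fun_sum fun β _ =>
        (differentiableAt_of_contDiffOn hU (hθ b α β) hq).hasFDerivAt.smul_const (x β)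
    have h3 : (⇑(ContinuousLinearMap.proj α : (κ → W) →L[ℝ] W) ∘ fun q =>
        matrixSystem W θ q (EuclideanSpace.single b (1 : ℝ)) x) =
        fun q => ∑ β, θ q b α β • x β := by
      ext q; simp [matrixSystem_single]
    rw [h3] at h1
    have h4 := congrArg (fun L => L (EuclideanSpace.single a (1 : ℝ))) (h1.unique h2)
    simpa [pd] using h4
  have hbasis : ∀ a b : Fin n, ∀ α,
      fderiv ℝ (matrixSystem W θ) q (EuclideanSpace.single a 1) (EuclideanSpace.single b 1) x α
        + matrixSystem W θ q (EuclideanSpace.single b 1)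
          (matrixSystem W θ q (EuclideanSpace.single a 1) x) α =
      fderiv ℝ (matrixSystem W θ) q (EuclideanSpace.single b 1) (EuclideanSpace.single a 1) x α
        + matrixSystem W θ q (EuclideanSpace.single a 1)
          (matrixSystem W θ q (EuclideanSpace.single b 1) x) α := by
    have h5 : ∀ a b : Fin n, ∀ α, fderiv ℝ (matrixSystem W θ) q (EuclideanSpace.single a 1)
        (EuclideanSpace.single b 1) x α + matrixSystem W θ q (EuclideanSpace.single b 1)
          (matrixSystem W θ q (EuclideanSpace.single a 1) x) α =
        ∑ β, (pd a (fun q => θ q b α β) q + ∑ μ, θ q b α μ * θ q a μ β) • x β := fun a b α => by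
      rw [hpd, matrixSystem_single]
      simp only [matrixSystem_single, add_smul, Finset.sum_add_distrib, Finset.smul_sum,
        smul_smul, Finset.sum_smul]
      rw [Finset.sum_comm (γ := κ)]
    intro a b α
    rw [h5, h5]
    exact Finset.sum_congr rfl fun β _ => by rw [hflat q hq]
  have hbil₁ : ∀ (u v : EuclideanSpace ℝ (Fin n)) (α : κ), fderiv ℝ (matrixSystem W θ) q u v x α =
      ∑ a, ∑ b, (u a * v b) • fderiv ℝ (matrixSystem W θ) q (EuclideanSpace.single a 1)
        (EuclideanSpace.single b 1) x α := fun u v α => by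
    conv_lhs => rw [eq_sum_smul_single u, eq_sum_smul_single v]
    simp only [map_sum, map_smul, sum_apply, smul_apply, Finset.sum_apply, Pi.smul_apply,
      Finset.smul_sum, smul_smul]
    rw [Finset.sum_comm]
    exact Finset.sum_congr rfl fun a _ => Finset.sum_congr rfl fun b _ => by rw [mul_comm]
  have hbil₂ : ∀ (u v : EuclideanSpace ℝ (Fin n)) (α : κ),
      matrixSystem W θ q v (matrixSystem W θ q u x) α =
      ∑ a, ∑ b, (u a * v b) • matrixSystem W θ q (EuclideanSpace.single b 1)
        (matrixSystem W θ q (EuclideanSpace.single a 1) x) α := fun u v α => by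
    conv_lhs => rw [eq_sum_smul_single u, eq_sum_smul_single v]
    simp only [map_sum, map_smul, sum_apply, smul_apply, Finset.sum_apply, Pi.smul_apply,
      Finset.smul_sum, smul_smul]
  ext α
  simp only [Pi.add_apply]
  rw [hbil₁ u v, hbil₁ v u, hbil₂ u v, hbil₂ v u, Finset.sum_comm (f := fun a b => (v a * u b) • _),
    Finset.sum_comm (f := fun a b => (v a * u b) • _)]
  simp only [← Finset.sum_add_distrib, ← smul_add, hbasis]
  exact Finset.sum_congr rfl fun a _ => Finset.sum_congr rfl fun b _ => by rw [mul_comm, hbasis]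

/-- A family of functions satisfying a linear total differential equation vanishes near a point
where it vanishes. -/
lemma eventually_eq_zero_of_pd_eq {θ : EuclideanSpace ℝ (Fin n) → Fin n → Matrix κ κ ℝ}
    {U : Set (EuclideanSpace ℝ (Fin n))} (hU : IsOpen U)
    (hθ : ∀ i, SmoothOn (fun q => θ q i) U) (hp : p ∈ U)
    {x : EuclideanSpace ℝ (Fin n) → κ → W}
    (hx : ∀ᶠ q in 𝓝 p, ∀ α, DifferentiableAt ℝ (fun q => x q α) q ∧
      ∀ i, pd i (fun q => x q α) q = ∑ β, θ q i α β • x q β)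
    (h0 : x p = 0) : ∀ᶠ q in 𝓝 p, x q = 0 := by
  have h1 := isTotalSol_matrixSystem hx
  have h2 : IsTotalSol (matrixSystem W θ) p (fun _ => (0 : κ → W)) :=
    Filter.Eventually.of_forall fun q => by
      have h3 : (matrixSystem W θ q).flip (0 : κ → W) = 0 := map_zero _
      rw [h3]
      exact hasFDerivAt_const (0 : κ → W) q
  exact h1.eventuallyEq ((contDiffOn_matrixSystem hθ).continuousOn.continuousAt
    (hU.mem_nhds hp)) h2 h0

end FrameEquation

/-! ### Local rigidity and existence of hypersurfaces -/

section Bonnet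

open Filter Topology Matrix

variable {n : ℕ} {U : Set (EuclideanSpace ℝ (Fin n))} {p : EuclideanSpace ℝ (Fin n)}
  {γ A : EuclideanSpace ℝ (Fin n) → Matrix (Fin n) (Fin n) ℝ}
  {f ν f' ν' : EuclideanSpace ℝ (Fin n) → Minkowski n}

/-- The coefficients of the equations of Gauss and Weingarten, as a linear equation for the
position `f` (index `none`), the normal `ν` (index `some none`) and the frame `∂ⱼ f` (index
`some (some j)`) of a hypersurface. -/
def frameMatrix (γ A : EuclideanSpace ℝ (Fin n) → Matrix (Fin n) (Fin n) ℝ)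
    (q : EuclideanSpace ℝ (Fin n)) (i : Fin n) :
    Matrix (Option (Option (Fin n))) (Option (Option (Fin n))) ℝ := fun α β =>
  match α, β with
  | none, some (some k) => if k = i then 1 else 0
  | some none, some (some k) => ∑ l, (γ q)⁻¹ k l * A q i l
  | some (some j), some none => A q i j
  | some (some j), some (some k) => christoffel γ q k i j
  | _, _ => 0

/-- The position itself does not enter the equations for the normal and the frame. -/
lemma frameMatrix_some_none (q : EuclideanSpace ℝ (Fin n)) (i : Fin n) (α : Option (Fin n)) :
    frameMatrix γ A q i (some α) none = 0 := by
  rcases α with _ | a <;> rfl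

/-- The position, the normal and the coordinate frame of a hypersurface. -/
def frameVec (f ν : EuclideanSpace ℝ (Fin n) → Minkowski n) (q : EuclideanSpace ℝ (Fin n)) :
    Option (Option (Fin n)) → Minkowski n
  | none => f q
  | some none => ν q
  | some (some j) => pd j f q

lemma smoothOn_frameMatrix (hγ : IsMetricOn γ U) (hA : SmoothOn A U) (i : Fin n) :
    SmoothOn (fun q => frameMatrix γ A q i) U := by
  rintro (_ | _ | j) (_ | _ | k) <;> simp only [frameMatrix]
  · exact contDiffOn_const
  · exact contDiffOn_const
  · exact contDiffOn_const
  · exact contDiffOn_const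
  · exact contDiffOn_const
  · exact ContDiffOn.sum fun l _ => (hγ.smooth_inv k l).mul (hA i l)
  · exact contDiffOn_const
  · exact hA i j
  · exact hγ.smooth_christoffel k i j

/-- The formulas of Gauss and Weingarten, as one linear equation. -/
lemma IsHypersurface.pd_frameVec (hf : IsHypersurface γ A U f ν) (hγ : IsMetricOn γ U)
    (hp : p ∈ U) (α : Option (Option (Fin n))) :
    DifferentiableAt ℝ (fun q => frameVec f ν q α) p ∧
      ∀ i, pd i (fun q => frameVec f ν q α) p = ∑ β, frameMatrix γ A p i α β • frameVec f ν p β := by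
  rcases α with _ | _ | j
  · refine ⟨differentiableAt_of_contDiffOn hγ.isOpen hf.smooth hp, fun i => ?_⟩
    simp [frameVec, frameMatrix, Fintype.sum_option]
  · refine ⟨hf.diff_normal hγ.isOpen hp, fun i => ?_⟩
    simpa [frameVec, frameMatrix, Fintype.sum_option] using hf.weingarten_formula hγ hp i
  · refine ⟨hf.diff hγ.isOpen hp j, fun i => ?_⟩
    simpa [frameVec, frameMatrix, Fintype.sum_option, add_comm] using hf.gauss_formula hγ hp i j

lemma IsMinkowskiIsometry.mink_linear {L : Minkowski n ≃ᵃ[ℝ] Minkowski n}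
    (hL : IsMinkowskiIsometry L) (x y : Minkowski n) :
    mink (L.linear x) (L.linear y) = mink x y := by
  have h1 : ∀ z, mink (L.linear z) (L.linear z) = mink z z := fun z => by
    have := hL z 0
    rwa [show L z - L 0 = L.linear z by
      have := L.map_vadd 0 z
      simp at this
      rw [this]; abel, sub_zero] at this
  have h2 := h1 (x + y)
  simp only [map_add, mink_add_left, mink_add_right, h1] at h2
  linarith [mink_comm (L.linear y) (L.linear x), mink_comm y x]

/-- Two frames with the same Gram matrix differ by a linear isometry. -/
lemma IsFrame.exists_linearEquiv {G : Matrix (Fin n) (Fin n) ℝ} {e e' : Fin n → Minkowski n}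
    {w w' : Minkowski n} (h : IsFrame G e w) (h' : IsFrame G e' w') (hG : IsUnit G.det) :
    ∃ T : Minkowski n ≃ₗ[ℝ] Minkowski n, (∀ i, T (e i) = e' i) ∧ T w = w' ∧
      ∀ x y, mink (T x) (T y) = mink x y := by
  set T := (h.basis hG).equiv (h'.basis hG) (Equiv.refl _) with hT
  have hTe : ∀ i, T (e i) = e' i := fun i => by
    rw [← h.basis_some hG i, hT, Module.Basis.equiv_apply]
    simp [h'.basis_some hG]
  have hTw : T w = w' := by
    conv_lhs => rw [← h.basis_none hG, hT, Module.Basis.equiv_apply]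
    simp [h'.basis_none hG]
  refine ⟨T, hTe, hTw, fun x y => ?_⟩
  rw [← (h.basis hG).sum_repr x, ← (h.basis hG).sum_repr y]
  simp only [map_add, map_sum, map_smul, Fintype.sum_option, h.basis_some, h.basis_none, hTe, hTw,
    mink_add_left, mink_add_right, mink_sum_left, mink_sum_right, mink_smul_left, mink_smul_right,
    h.gram, h.normal, h.unit, h'.gram, h'.normal, h'.unit, mink_comm w, mink_comm w']

/-- Hypersurfaces with the same first and second fundamental forms differ, locally, by an isometry
of Minkowski space. -/
theorem IsHypersurface.exists_isometry (hf : IsHypersurface γ A U f ν)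
    (hf' : IsHypersurface γ A U f' ν') (hγ : IsMetricOn γ U) (hp : p ∈ U) :
    ∃ L : Minkowski n ≃ᵃ[ℝ] Minkowski n, IsMinkowskiIsometry L ∧
      ∀ᶠ q in 𝓝 p, f' q = L (f q) ∧ ν' q = L.linear (ν q) := by
  obtain ⟨T, hTe, hTw, hT⟩ := (hf.frame hp).exists_linearEquiv (hf'.frame hp) (hγ.isUnit_det hp)
  set L : Minkowski n ≃ᵃ[ℝ] Minkowski n := T.toAffineEquiv.trans
    (AffineEquiv.constVAdd ℝ (Minkowski n) (f' p - T (f p))) with hL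
  have hLa : ∀ x, L x = f' p - T (f p) + T x := fun x => by simp [hL]
  have hLl : ∀ x, L.linear x = T x := fun x => rfl
  refine ⟨L, fun x y => ?_, ?_⟩
  · rw [hLa, hLa, add_sub_add_left_eq_sub, ← map_sub, hT]
  -- the difference of the two frames, after the isometry, solves the frame equation
  set x : EuclideanSpace ℝ (Fin n) → Option (Option (Fin n)) → Minkowski n := fun q α =>
    frameVec f' ν' q α - T (frameVec f ν q α) - (if α = none then f' p - T (f p) else 0) with hx
  have hTd : ∀ q ∈ U, ∀ α, DifferentiableAt ℝ (fun q => T (frameVec f ν q α)) q ∧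
      ∀ i, pd i (fun q => T (frameVec f ν q α)) q = T (pd i (fun q => frameVec f ν q α) q) :=
    fun q hq α => by
      have h1 := T.toContinuousLinearEquiv.toContinuousLinearMap.hasFDerivAt.comp q
        (hf.pd_frameVec hγ hq α).1.hasFDerivAt
      refine ⟨h1.differentiableAt, fun i => ?_⟩
      have h2 : fderiv ℝ (fun q => T (frameVec f ν q α)) q = _ := h1.fderiv
      rw [pd, h2]
      rfl
  have hz := eventually_eq_zero_of_pd_eq (x := x) hγ.isOpen
    (smoothOn_frameMatrix hγ (hf.smooth_shape hγ.isOpen)) hp ?_ ?_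
  · filter_upwards [hz] with q hq
    have h1 := congrFun hq none
    have h2 := congrFun hq (some none)
    simp only [hx, frameVec, if_true, Pi.zero_apply, reduceCtorEq, if_false, sub_zero] at h1 h2
    rw [hLa, hLl]
    exact ⟨by rw [sub_eq_zero] at h1; rw [← h1]; abel, sub_eq_zero.1 h2⟩
  · filter_upwards [hγ.isOpen.mem_nhds hp] with q hq α
    have hd' := hf'.pd_frameVec hγ hq α
    have hd := hf.pd_frameVec hγ hq α
    refine ⟨(hd'.1.fun_sub (hTd q hq α).1).sub (differentiableAt_const _), fun i => ?_⟩
    have h3 : pd i (fun q => x q α) q =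
        pd i (fun q => frameVec f' ν' q α) q - pd i (fun q => T (frameVec f ν q α)) q := by
      simp only [hx]
      rw [pd_sub (hd'.1.fun_sub (hTd q hq α).1) (differentiableAt_const _),
        pd_sub hd'.1 (hTd q hq α).1]
      simp
    rw [h3, (hTd q hq α).2, hd.2, hd'.2, map_sum, ← Finset.sum_sub_distrib]
    refine Finset.sum_congr rfl fun β _ => ?_
    rcases β with _ | β
    · rcases α with _ | _ | j <;> simp [frameMatrix]
    · simp [hx, smul_sub]
  · ext1 α
    rcases α with _ | _ | j
    · simp [hx, frameVec]
    · simp [hx, frameVec, hTw]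
    · simp [hx, frameVec, hTe]

/-- The equations of Gauss and Codazzi say that the frame equation is flat. -/
lemma flat_frameMatrix (hγ : IsMetricOn γ U) (hA : SmoothOn A U)
    (hG : ∀ q ∈ U, ∀ k i j l, curvLow γ q k i j l = A q k j * A q i l - A q i j * A q k l)
    (hC : ∀ q ∈ U, IsCodazziAt γ A q) (hp : p ∈ U) (a b : Fin n)
    (α β : Option (Option (Fin n))) :
    pd a (fun q => frameMatrix γ A q b α β) p
      + ∑ μ, frameMatrix γ A p b α μ * frameMatrix γ A p a μ β =
    pd b (fun q => frameMatrix γ A q a α β) p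
      + ∑ μ, frameMatrix γ A p a α μ * frameMatrix γ A p b μ β := by
  have hs : ∀ i j, A p i j = A p j i := fun i j => (hC p hp).1.apply j i
  have hcod : ∀ a b j, pd a (fun q => A q b j) p + ∑ k, christoffel γ p k b j * A p a k =
      pd b (fun q => A q a j) p + ∑ k, christoffel γ p k a j * A p b k := fun a b j => by
    have := ((hC p hp).2 a b j).1
    simp only [covDeriv, Finset.sum_add_distrib, hγ.christoffel_symm hp _ b a] at this
    linarith
  have hgauss : ∀ l j, curv γ p l a b j =
      ∑ m, (γ p)⁻¹ l m * (A p a j * A p b m - A p b j * A p a m) := fun l j => by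
    rw [curv_eq_sum_curvLow (hγ.posDef p hp)]
    exact Finset.sum_congr rfl fun m _ => by rw [hG p hp]
  -- the covariant derivative commutes with raising an index: the derivative of `γ⁻¹ A` in terms of
  -- that of `A`
  have hB : ∀ a b l, pd a (fun q => ∑ m, (γ q)⁻¹ l m * A q b m) p
      + ∑ k, (∑ m, (γ p)⁻¹ k m * A p b m) * christoffel γ p l a k =
      ∑ m, (γ p)⁻¹ l m * (pd a (fun q => A q b m) p - ∑ k, christoffel γ p k a m * A p b k) := by
    intro a b l
    set B : EuclideanSpace ℝ (Fin n) → Fin n → ℝ := fun q l => ∑ m, (γ q)⁻¹ l m * A q b m with hBdef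
    have hBs : ∀ l, ContDiffOn ℝ ∞ (fun q => B q l) U := fun l =>
      ContDiffOn.sum fun m _ => (hγ.smooth_inv l m).mul (hA b m)
    have hBd : ∀ l, DifferentiableAt ℝ (fun q => B q l) p := fun l =>
      differentiableAt_of_contDiffOn hγ.isOpen (hBs l) hp
    have hlow : ∀ q ∈ U, ∀ m, ∑ l, γ q m l * B q l = A q b m := fun q hq m =>
      hγ.sum_mul_inv hq (fun m => A q b m) m
    rw [← hγ.sum_inv_mul hp (fun l => pd a (fun q => B q l) p + ∑ k, B p k * christoffel γ p l a k) l]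
    refine Finset.sum_congr rfl fun m _ => ?_
    congr 1
    have h1 : pd a (fun q => A q b m) p =
        ∑ l, ((christoffelLow γ p l a m + christoffelLow γ p m a l) * B p l
          + γ p m l * pd a (fun q => B q l) p) := by
      rw [← pd_congr_on hγ.isOpen (fun q hq => hlow q hq m) hp,
        pd_sum fun l _ => (hγ.diff hp m l).fun_mul (hBd l)]
      exact Finset.sum_congr rfl fun l _ => by rw [pd_mul (hγ.diff hp m l) (hBd l), hγ.pd_metric hp]
    have h2 : ∑ l, γ p m l * ∑ k, B p k * christoffel γ p l a k =
        ∑ k, christoffelLow γ p m a k * B p k := by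
      simp only [Finset.mul_sum]
      rw [Finset.sum_comm]
      refine Finset.sum_congr rfl fun k _ => ?_
      rw [hγ.christoffelLow_eq hp, Finset.sum_mul]
      exact Finset.sum_congr rfl fun l _ => by ring
    have h3 : ∑ k, christoffel γ p k a m * A p b k = ∑ l, christoffelLow γ p l a m * B p l := by
      simp only [← hlow p hp, Finset.mul_sum]
      rw [Finset.sum_comm]
      refine Finset.sum_congr rfl fun k _ => ?_
      rw [hγ.christoffelLow_eq hp, Finset.sum_mul]
      exact Finset.sum_congr rfl fun l _ => by rw [hγ.symm hp l k]; ring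
    rw [h1, h3]
    simp only [mul_add, Finset.sum_add_distrib, add_mul, h2]
    ring
  rcases α with _ | _ | j <;> rcases β with _ | _ | l <;>
    simp only [frameMatrix, Fintype.sum_option, pd_const, mul_zero, zero_mul,
      Finset.sum_const_zero, add_zero, zero_add]
  · simp [hs a b]
  · simp [hγ.christoffel_symm hp l a b]
  · simp only [Finset.sum_mul]
    rw [Finset.sum_comm]
    exact Finset.sum_congr rfl fun k _ => Finset.sum_congr rfl fun m _ => by
      rw [hγ.inv_symm hp m k]; ring
  · rw [hB, hB]
    exact Finset.sum_congr rfl fun m _ => by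
      linear_combination (γ p)⁻¹ l m * hcod a b m
  · exact hcod a b j
  · have := hgauss l j
    simp only [curv, mul_sub, Finset.sum_sub_distrib] at this
    simp only [Finset.mul_sum]
    have e1 : ∀ a b, ∑ m, (γ p)⁻¹ l m * (A p a j * A p b m) =
        ∑ m, A p a j * ((γ p)⁻¹ l m * A p b m) := fun a b =>
      Finset.sum_congr rfl fun m _ => by ring
    rw [e1, e1] at this
    linarith

open scoped MatrixOrder Matrix.Norms.L2Operator in
/-- Every positive definite matrix is the Gram matrix of a spacelike frame. -/
lemma exists_isFrame {G : Matrix (Fin n) (Fin n) ℝ} (hG : G.PosDef) :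
    ∃ (e : Fin n → Minkowski n) (w : Minkowski n), IsFrame G e w := by
  obtain ⟨B, hB⟩ := CStarAlgebra.nonneg_iff_eq_star_mul_self.mp hG.posSemidef.nonneg
  refine ⟨fun i => (WithLp.toLp 2 fun k => B k i, 0), (0, 1), ⟨fun i j => ?_, fun i => ?_, ?_⟩⟩
  · rw [hB]
    simp [mink, Matrix.mul_apply, PiLp.inner_apply, mul_comm]
  · simp [mink]
  · simp [mink]

/-- The Gram matrix of the frame of a hypersurface. -/
def gramMatrix (γ : EuclideanSpace ℝ (Fin n) → Matrix (Fin n) (Fin n) ℝ)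
    (q : EuclideanSpace ℝ (Fin n)) : Matrix (Option (Fin n)) (Option (Fin n)) ℝ := fun α β =>
  match α, β with
  | none, none => -1
  | some i, some j => γ q i j
  | _, _ => 0

/-- The coefficients of the linear equation satisfied by the Gram matrix of any solution of the
frame equation. -/
def gramSystem (γ A : EuclideanSpace ℝ (Fin n) → Matrix (Fin n) (Fin n) ℝ)
    (q : EuclideanSpace ℝ (Fin n)) (i : Fin n) :
    Matrix (Option (Fin n) × Option (Fin n)) (Option (Fin n) × Option (Fin n)) ℝ := fun α β =>
  (if α.2 = β.2 then frameMatrix γ A q i (some α.1) (some β.1) else 0) +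
    if α.1 = β.1 then frameMatrix γ A q i (some α.2) (some β.2) else 0

lemma sum_gramSystem_mul (q : EuclideanSpace ℝ (Fin n)) (i : Fin n) (α β : Option (Fin n))
    (S : Option (Fin n) × Option (Fin n) → ℝ) :
    ∑ μ, gramSystem γ A q i (α, β) μ * S μ =
      ∑ μ, frameMatrix γ A q i (some α) (some μ) * S (μ, β)
        + ∑ μ, frameMatrix γ A q i (some β) (some μ) * S (α, μ) := by
  simp [gramSystem, add_mul, Finset.sum_add_distrib, Fintype.sum_prod_type, ite_mul]

/-- The expected Gram matrix `diag(γ, -1)` solves the equation of `gramSystem`. For the block `γ` this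
says that the connection is metric. -/
lemma pd_gramMatrix (hγ : IsMetricOn γ U) (hp : p ∈ U) (α β : Option (Fin n)) :
    DifferentiableAt ℝ (fun q => gramMatrix γ q α β) p ∧
    ∀ i, pd i (fun q => gramMatrix γ q α β) p =
      ∑ μ, frameMatrix γ A p i (some α) (some μ) * gramMatrix γ p μ β
        + ∑ μ, frameMatrix γ A p i (some β) (some μ) * gramMatrix γ p α μ := by
  have h1 : ∀ i j, ∑ k, (∑ l, (γ p)⁻¹ k l * A p i l) * γ p k j = A p i j := fun i j => by
    rw [← hγ.sum_mul_inv hp (fun l => A p i l) j]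
    exact Finset.sum_congr rfl fun k _ => by rw [hγ.symm hp k j, mul_comm]
  have h2 : ∀ i a j, ∑ k, christoffel γ p k i a * γ p k j = christoffelLow γ p j i a :=
      fun i a j => by
    rw [hγ.christoffelLow_eq hp]
    exact Finset.sum_congr rfl fun k _ => by rw [hγ.symm hp k j, mul_comm]
  rcases α with _ | a <;> rcases β with _ | b <;>
    simp only [gramMatrix, frameMatrix, Fintype.sum_option, pd_const, mul_zero, zero_mul,
      Finset.sum_const_zero, add_zero, zero_add, differentiableAt_const, true_and]
  · simp
  · intro i; rw [h1]; ring
  · intro i; simp only [hγ.symm hp a, h1]; ring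
  · refine ⟨hγ.diff hp a b, fun i => ?_⟩
    simp only [hγ.symm hp a, h2, hγ.pd_metric hp]

/-- The fundamental theorem of hypersurfaces in Minkowski space, in its local form: a solution of the
Gauss and Codazzi equations is the second fundamental form of a hypersurface, which is found by
solving the frame equation. -/
theorem exists_isHypersurface (hγ : IsMetricOn γ U) (hA : SmoothOn A U)
    (hG : ∀ q ∈ U, ∀ k i j l, curvLow γ q k i j l = A q k j * A q i l - A q i j * A q k l)
    (hC : ∀ q ∈ U, IsCodazziAt γ A q) (hp : p ∈ U) :
    ∃ U' : Set (EuclideanSpace ℝ (Fin n)), IsOpen U' ∧ p ∈ U' ∧ U' ⊆ U ∧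
      ∃ f ν : EuclideanSpace ℝ (Fin n) → Minkowski n, IsHypersurface γ A U' f ν := by
  obtain ⟨e, w, hew⟩ := exists_isFrame (hγ.posDef p hp)
  obtain ⟨x, hx0, hx⟩ := exists_matrixSystem_sol hγ.isOpen (smoothOn_frameMatrix hγ hA) hp
    (fun q hq a b α β => flat_frameMatrix hγ hA hG hC hq a b α β)
    (fun α => match α with
      | none => 0
      | some none => w
      | some (some j) => e j)
  have hxpd := hx.pd_eq
  -- the Gram matrix of the solution and the expected one solve the same linear equation, and they
  -- agree at `p`
  have hgram : ∀ᶠ q in 𝓝 p, ∀ α β, mink (x q (some α)) (x q (some β)) = gramMatrix γ q α β := by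
    have hz := eventually_eq_zero_of_pd_eq (κ := Option (Fin n) × Option (Fin n))
      (θ := gramSystem γ A) (x := fun q α =>
        mink (x q (some α.1)) (x q (some α.2)) - gramMatrix γ q α.1 α.2) hγ.isOpen ?_ hp ?_ ?_
    · filter_upwards [hz] with q hq α β
      exact sub_eq_zero.1 (congrFun hq (α, β))
    · intro i α β
      simp only [gramSystem]
      refine ContDiffOn.add ?_ ?_ <;> split_ifs
      exacts [smoothOn_frameMatrix hγ hA i _ _, contDiffOn_const,
        smoothOn_frameMatrix hγ hA i _ _, contDiffOn_const]
    · filter_upwards [hxpd, hγ.isOpen.mem_nhds hp] with q hq hqU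
      rintro ⟨α, β⟩
      have h1 := hq (some α)
      have h2 := hq (some β)
      have h3 := pd_gramMatrix (A := A) hγ hqU α β
      have hd : DifferentiableAt ℝ (fun q => mink (x q (some α)) (x q (some β))) q :=
        (hasFDerivAt_mink h1.1.hasFDerivAt h2.1.hasFDerivAt).differentiableAt
      refine ⟨hd.fun_sub h3.1, fun i => ?_⟩
      have hsum : ∀ α, ∑ β, frameMatrix γ A q i (some α) β • x q β =
          ∑ μ, frameMatrix γ A q i (some α) (some μ) • x q (some μ) := fun α => by
        rw [Fintype.sum_option, frameMatrix_some_none, zero_smul, zero_add]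
      rw [pd_sub hd h3.1, pd_mink h1.1 h2.1, h1.2, h2.2, h3.2, hsum, hsum]
      simp only [smul_eq_mul]
      rw [sum_gramSystem_mul]
      simp only [mink_sum_left, mink_sum_right, mink_smul_left, mink_smul_right, mul_sub,
        Finset.sum_sub_distrib]
      ring
    · ext ⟨α, β⟩
      rcases α with _ | a <;> rcases β with _ | b <;>
        simp [hx0, gramMatrix, hew.gram, hew.normal, hew.unit, mink_comm w]
  obtain ⟨U', hU', hU'o, hpU'⟩ := eventually_nhds_iff.1 (hx.and (hxpd.and (hgram.and
    (hγ.isOpen.mem_nhds hp))))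
  have hsub : U' ⊆ U := fun q hq => (hU' q hq).2.2.2
  have hsm := contDiffOn_of_total hU'o ((contDiffOn_matrixSystem
    (smoothOn_frameMatrix hγ hA)).mono hsub) (fun q hq => (hU' q hq).1)
  have hf : ∀ q ∈ U', ∀ i, pd i (fun q => x q none) q = x q (some (some i)) := fun q hq i => by
    rw [((hU' q hq).2.1 none).2]
    simp [frameMatrix, Fintype.sum_option]
  have hν : ∀ q ∈ U', ∀ i, pd i (fun q => x q (some none)) q =
      ∑ k, (∑ l, (γ q)⁻¹ k l * A q i l) • x q (some (some k)) := fun q hq i => by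
    rw [((hU' q hq).2.1 (some none)).2]
    simp [frameMatrix, Fintype.sum_option]
  refine ⟨U', hU'o, hpU', hsub, fun q => x q none, fun q => x q (some none),
    contDiffOn_pi.1 hsm none, contDiffOn_pi.1 hsm (some none), fun q hq i j => ?_,
    fun q hq i => ?_, fun q hq => ?_, fun q hq i j => ?_⟩
  · rw [hf q hq, hf q hq, (hU' q hq).2.2.1]; rfl
  · rw [hf q hq, (hU' q hq).2.2.1]; rfl
  · rw [(hU' q hq).2.2.1]; rfl
  · rw [hf q hq, hν q hq, mink_sum_right]
    simp only [mink_smul_right, (hU' q hq).2.2.1, gramMatrix]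
    rw [← hγ.sum_mul_inv (hsub hq) (fun l => A q i l) j]
    exact Finset.sum_congr rfl fun k _ => by rw [mul_comm]

end Bonnet

/-! ### Coordinate vectors and metrics in charts -/

section Charts

open Filter Topology Set

variable {n : ℕ} {M : Type*} [TopologicalSpace M] [ChartedSpace (EuclideanSpace ℝ (Fin n)) M]
  [IsManifold (𝓡 n) ∞ M] {φ : OpenPartialHomeomorph M (EuclideanSpace ℝ (Fin n))}
  {p : EuclideanSpace ℝ (Fin n)}

lemma contMDiffAt_chart (hφ : φ ∈ Charts n M) {y : M} (hy : y ∈ φ.source) :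
    ContMDiffAt (𝓡 n) (𝓡 n) ∞ φ y :=
  contMDiffAt_of_mem_maximalAtlas hφ hy

lemma contMDiffAt_chart_symm (hφ : φ ∈ Charts n M) (hp : p ∈ φ.target) :
    ContMDiffAt (𝓡 n) (𝓡 n) ∞ φ.symm p :=
  contMDiffAt_symm_of_mem_maximalAtlas hφ hp

lemma mdifferentiable_chart_of_mem (hφ : φ ∈ Charts n M) :
    φ.MDifferentiable (𝓡 n) (𝓡 n) :=
  ⟨fun _ hy => ((contMDiffAt_chart hφ hy).mdifferentiableAt (by simp)).mdifferentiableWithinAt,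
    fun _ hp => ((contMDiffAt_chart_symm hφ hp).mdifferentiableAt
      (by simp)).mdifferentiableWithinAt⟩

lemma mfderiv_chart_symm_bijective (hφ : φ ∈ Charts n M) (hp : p ∈ φ.target) :
    Function.Bijective (mfderiv (𝓡 n) (𝓡 n) φ.symm p) :=
  (mdifferentiable_chart_of_mem hφ).symm.mfderiv_bijective hp

/-- The coordinate vector fields are smooth, as sections of the tangent bundle along `φ.symm`. -/
lemma contMDiffOn_coordVec (hφ : φ ∈ Charts n M) (i : Fin n) :
    ContMDiffOn (𝓡 n) ((𝓡 n).prod 𝓘(ℝ, EuclideanSpace ℝ (Fin n))) ∞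
      (fun q => Bundle.TotalSpace.mk' (EuclideanSpace ℝ (Fin n)) (φ.symm q) (coordVec φ q i))
      φ.target := by
  have h1 : ContMDiffOn (𝓡 n) (𝓡 n) ∞ φ.symm φ.target :=
    fun q hq => (contMDiffAt_chart_symm hφ hq).contMDiffWithinAt
  have h2 := h1.contMDiffOn_tangentMapWithin (m := ∞) le_rfl φ.open_target.uniqueMDiffOn
  have h3 : ContMDiffOn (𝓡 n) (𝓡 n).tangent ∞
      (fun q : EuclideanSpace ℝ (Fin n) => (⟨q, (EuclideanSpace.single i (1 : ℝ) :
        EuclideanSpace ℝ (Fin n))⟩ : TangentBundle (𝓡 n) (EuclideanSpace ℝ (Fin n))))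
      φ.target := by
    intro q hq
    exact (contMDiffWithinAt_vectorSpace_iff_contDiffWithinAt
      (V := fun q => (EuclideanSpace.single i (1 : ℝ) : EuclideanSpace ℝ (Fin n)))).2
      contDiffWithinAt_const
  have h4 := h2.comp h3 (fun q hq => hq)
  refine h4.congr fun q hq => ?_
  simp only [Function.comp, tangentMapWithin, coordVec, mfderivWithin_of_isOpen φ.open_target hq]

lemma mfderiv_chart_symm_toLp (v : Fin n → ℝ) :
    mfderiv (𝓡 n) (𝓡 n) φ.symm p (WithLp.toLp 2 v : EuclideanSpace ℝ (Fin n)) =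
      ∑ i, v i • coordVec φ p i := by
  have h (D : EuclideanSpace ℝ (Fin n) →L[ℝ] EuclideanSpace ℝ (Fin n)) :
      D (WithLp.toLp 2 v) = ∑ i, v i • D (EuclideanSpace.single i 1) := by
    conv_lhs => rw [eq_sum_smul_single (WithLp.toLp 2 v)]
    simp
  exact h (mfderiv (𝓡 n) (𝓡 n) φ.symm p)

lemma inner_sum_coordVec (g : Metric n M) (v w : Fin n → ℝ) :
    g.inner (φ.symm p) (∑ i, v i • coordVec φ p i) (∑ i, w i • coordVec φ p i) =
      ∑ i, ∑ j, v i * w j * coordMetric g φ p i j := by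
  rw [map_sum (g.inner (φ.symm p)), sum_apply]
  refine Finset.sum_congr rfl fun i _ => ?_
  rw [map_sum]
  refine Finset.sum_congr rfl fun j _ => ?_
  rw [map_smul, map_smul, smul_apply, smul_eq_mul, smul_eq_mul, coordMetric]
  ring

/-- The components of a Riemannian metric in a chart form a metric on the target of the chart. -/
lemma isMetricOn_coordMetric (g : Metric n M) (hφ : φ ∈ Charts n M) :
    IsMetricOn (coordMetric g φ) φ.target := by
  refine ⟨φ.open_target, fun i j => ?_, fun q hq => ?_⟩
  · rw [← contMDiffOn_iff_contDiffOn]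
    intro q hq
    have : ContMDiffWithinAt (𝓡 n) ((𝓡 n).prod 𝓘(ℝ)) ∞
        (fun m ↦ Bundle.TotalSpace.mk' ℝ (E := Bundle.Trivial M ℝ) (φ.symm m)
          (g.inner (φ.symm m) (coordVec φ m i) (coordVec φ m j))) φ.target q := by
      apply ContMDiffWithinAt.clm_bundle_apply₂ (F₁ := EuclideanSpace ℝ (Fin n))
        (F₂ := EuclideanSpace ℝ (Fin n))
      · exact ContMDiffAt.comp_contMDiffWithinAt q g.contMDiff.contMDiffAt
          (contMDiffAt_chart_symm hφ hq).contMDiffWithinAt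
      · exact contMDiffOn_coordVec hφ i q hq
      · exact contMDiffOn_coordVec hφ j q hq
    simp only [Bundle.contMDiffWithinAt_totalSpace] at this
    exact this.2
  · set D := mfderiv (𝓡 n) (𝓡 n) φ.symm q
    have hb := mfderiv_chart_symm_bijective hφ hq
    refine Matrix.PosDef.of_dotProduct_mulVec_pos ?_ fun v hv => ?_
    · ext i j
      simp only [Matrix.conjTranspose_apply, star_trivial]
      exact g.symm _ _ _
    · set w : TangentSpace (𝓡 n) (φ.symm q) := ∑ i, v i • coordVec φ q i with hw
      have hwD : w = D (WithLp.toLp 2 v) := (mfderiv_chart_symm_toLp v).symm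
      have hw0 : w ≠ 0 := by
        rw [hwD]
        intro h0
        have h1 : WithLp.toLp 2 v = (0 : EuclideanSpace ℝ (Fin n)) :=
          hb.1 (h0.trans (map_zero D).symm)
        exact hv (by simpa using congrArg (fun x : EuclideanSpace ℝ (Fin n) => x.ofLp) h1)
      have := g.pos _ w hw0
      rw [inner_sum_coordVec] at this
      refine this.trans_eq ?_
      simp only [dotProduct, Matrix.mulVec, star_trivial, Finset.mul_sum]
      refine Finset.sum_congr rfl fun i _ => Finset.sum_congr rfl fun j _ => ?_
      ring

end Charts

/-! ### Local hypersurfaces with second fundamental form `P` -/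

section CodazziSolution

variable {γ : EuclideanSpace ℝ (Fin 3) → Matrix (Fin 3) (Fin 3) ℝ}
  {U : Set (EuclideanSpace ℝ (Fin 3))} {p : EuclideanSpace ℝ (Fin 3)}

lemma IsMetricOn.mono {n : ℕ} {γ : EuclideanSpace ℝ (Fin n) → Matrix (Fin n) (Fin n) ℝ}
    {U V : Set (EuclideanSpace ℝ (Fin n))} (h : IsMetricOn γ U) (hV : IsOpen V) (hVU : V ⊆ U) :
    IsMetricOn γ V :=
  ⟨hV, fun i j => (h.smooth i j).mono hVU, fun q hq => h.posDef q (hVU hq)⟩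

/-- In negative curvature the determinant of the curvature form is positive, so that `P`, which
contains its square root, is smooth. -/
lemma IsMetricOn.smoothOn_tensorP (hγ : IsMetricOn γ U)
    (hneg : ∀ q ∈ U, ∀ X Y : Fin 3 → ℝ, LinearIndependent ℝ ![X, Y] →
      sectionalCurv γ q X Y < 0) : SmoothOn (tensorP γ) U := by
  have hC : ∀ q ∈ U, (curvForm γ q).PosDef := fun q hq =>
    posDef_curvForm (hγ.posDef q hq) (hγ.isCurvLike hq) (hneg q hq)
  have hs : SmoothOn (curvForm γ) U := fun i j => hγ.smooth_curvLow _ _ _ _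
  intro i j
  have h1 : ContDiffOn ℝ ∞
      (fun q => √(curvForm γ q).det * ((curvForm γ q)⁻¹) i j) U :=
    ((contDiffOn_det hs).sqrt fun q hq => (hC q hq).det_pos.ne').mul
      (hs.inv (fun q hq => (hC q hq).det_pos.ne') i j)
  refine h1.congr fun q hq => ?_
  rw [tensorP_eq_of_curvForm (hγ.posDef q hq) (hγ.isCurvLike hq) (hC q hq)]
  rfl

/-- If `P` is Codazzi, then locally there is a hypersurface with second fundamental form `P`. -/
lemma IsMetricOn.exists_isHypersurface_tensorP (hγ : IsMetricOn γ U)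
    (hneg : ∀ q ∈ U, ∀ X Y : Fin 3 → ℝ, LinearIndependent ℝ ![X, Y] →
      sectionalCurv γ q X Y < 0) (hC : ∀ q ∈ U, IsCodazziAt γ (tensorP γ) q) (hp : p ∈ U) :
    ∃ U' : Set (EuclideanSpace ℝ (Fin 3)), IsOpen U' ∧ p ∈ U' ∧ U' ⊆ U ∧
      ∃ f ν : EuclideanSpace ℝ (Fin 3) → Minkowski 3,
        IsHypersurface γ (tensorP γ) U' f ν :=
  exists_isHypersurface hγ (hγ.smoothOn_tensorP hneg)
    (fun q hq k i j l =>
      (tensorP_posDef_and_gauss (hγ.posDef q hq) (hγ.isCurvLike hq) (hneg q hq)).2 k i j l) hC hp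

end CodazziSolution

/-! ### Convex immersions of a manifold -/

section ConvexImmersion

open Filter Topology Set

variable {n : ℕ} {N : Type*} [TopologicalSpace N] [ChartedSpace (EuclideanSpace ℝ (Fin n)) N]
  [IsManifold (𝓡 n) ∞ N] {h : Metric n N} {O : Set N} {F ν : N → Minkowski n}
  {φ : OpenPartialHomeomorph N (EuclideanSpace ℝ (Fin n))} {p : EuclideanSpace ℝ (Fin n)}

/-- On the open set `O`, `F` is a smooth isometric immersion into Minkowski space with smooth
timelike unit normal `ν`. -/
structure IsImmersedOn (h : Metric n N) (O : Set N) (F ν : N → Minkowski n) : Prop where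
  isOpen : IsOpen O
  smooth : ContMDiffOn (𝓡 n) 𝓘(ℝ, Minkowski n) ∞ F O
  smooth_normal : ContMDiffOn (𝓡 n) 𝓘(ℝ, Minkowski n) ∞ ν O
  isometric : ∀ y ∈ O, ∀ u v, mink (dMink F y u) (dMink F y v) = h.inner y u v
  unit : ∀ y ∈ O, mink (ν y) (ν y) = -1
  normal : ∀ y ∈ O, ∀ u, mink (dMink F y u) (ν y) = 0

/-- `F` is an isometric immersion on `O` whose second fundamental form `⟨dF, dν⟩` with respect to the
timelike unit normal `ν` is positive definite. -/
structure IsConvexImmersionOn (h : Metric n N) (O : Set N) (F ν : N → Minkowski n) : Prop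
    extends IsImmersedOn h O F ν where
  convex : ∀ y ∈ O, ∀ u : TangentSpace (𝓡 n) y, u ≠ 0 → 0 < mink (dMink F y u) (dMink ν y u)

/-- The partial derivatives of a map in a chart are its differentials along the coordinate vectors. -/
lemma pd_comp_chart_symm (hφ : φ ∈ Charts n N) (hp : p ∈ φ.target)
    (hF : MDifferentiableAt (𝓡 n) 𝓘(ℝ, Minkowski n) F (φ.symm p)) (i : Fin n) :
    pd i (fun q => F (φ.symm q)) p = dMink F (φ.symm p) (coordVec φ p i) := by
  have h1 := mfderiv_comp p hF ((contMDiffAt_chart_symm hφ hp).mdifferentiableAt (by simp))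
  have h2 : mfderiv (𝓡 n) 𝓘(ℝ, Minkowski n) (F ∘ φ.symm) p = fderiv ℝ (F ∘ φ.symm) p :=
    mfderiv_eq_fderiv
  rw [pd, dMink, coordVec]
  change fderiv ℝ (F ∘ φ.symm) p _ = _
  rw [← h2, h1]
  rfl

/-- Every tangent vector is a combination of coordinate vectors. -/
lemma exists_eq_sum_coordVec (hφ : φ ∈ Charts n N) (hp : p ∈ φ.target)
    (u : TangentSpace (𝓡 n) (φ.symm p)) : ∃ v : Fin n → ℝ, u = ∑ i, v i • coordVec φ p i := by
  obtain ⟨w, hw⟩ := (mfderiv_chart_symm_bijective hφ hp).2 u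
  exact ⟨WithLp.ofLp (p := 2) w, by rw [← mfderiv_chart_symm_toLp, ← hw]; rfl⟩

lemma mink_dMink_sum (hφ : φ ∈ Charts n N) (hp : p ∈ φ.target) {G : N → Minkowski n}
    (hF : MDifferentiableAt (𝓡 n) 𝓘(ℝ, Minkowski n) F (φ.symm p))
    (hG : MDifferentiableAt (𝓡 n) 𝓘(ℝ, Minkowski n) G (φ.symm p)) (v w : Fin n → ℝ) :
    mink (dMink F (φ.symm p) (∑ i, v i • coordVec φ p i))
      (dMink G (φ.symm p) (∑ i, w i • coordVec φ p i)) =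
      ∑ i, ∑ j, v i * w j *
        mink (pd i (fun q => F (φ.symm q)) p) (pd j (fun q => G (φ.symm q)) p) := by
  simp only [pd_comp_chart_symm hφ hp hF, pd_comp_chart_symm hφ hp hG, map_sum, map_smul,
    mink_sum_left, mink_sum_right, mink_smul_left, mink_smul_right, Finset.mul_sum]
  rw [Finset.sum_comm]
  refine Finset.sum_congr rfl fun i _ => Finset.sum_congr rfl fun j _ => ?_
  ring

lemma sum_coordVec_eq_zero (hφ : φ ∈ Charts n N) (hp : p ∈ φ.target) {v : Fin n → ℝ}
    (hv : ∑ i, v i • coordVec φ p i = 0) : v = 0 := by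
  rw [← mfderiv_chart_symm_toLp] at hv
  have h1 : WithLp.toLp 2 v = (0 : EuclideanSpace ℝ (Fin n)) :=
    (mfderiv_chart_symm_bijective hφ hp).1 (hv.trans (map_zero _).symm)
  simpa using congrArg (fun x : EuclideanSpace ℝ (Fin n) => x.ofLp) h1

namespace IsImmersedOn

lemma contMDiffAt (hF : IsImmersedOn h O F ν) {y : N} (hy : y ∈ O) :
    ContMDiffAt (𝓡 n) 𝓘(ℝ, Minkowski n) ∞ F y :=
  (hF.smooth y hy).contMDiffAt (hF.isOpen.mem_nhds hy)

lemma contMDiffAt_normal (hF : IsImmersedOn h O F ν) {y : N} (hy : y ∈ O) :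
    ContMDiffAt (𝓡 n) 𝓘(ℝ, Minkowski n) ∞ ν y :=
  (hF.smooth_normal y hy).contMDiffAt (hF.isOpen.mem_nhds hy)

lemma mdiff (hF : IsImmersedOn h O F ν) {y : N} (hy : y ∈ O) :
    MDifferentiableAt (𝓡 n) 𝓘(ℝ, Minkowski n) F y :=
  (hF.contMDiffAt hy).mdifferentiableAt (by simp)

lemma mdiff_normal (hF : IsImmersedOn h O F ν) {y : N} (hy : y ∈ O) :
    MDifferentiableAt (𝓡 n) 𝓘(ℝ, Minkowski n) ν y :=
  (hF.contMDiffAt_normal hy).mdifferentiableAt (by simp)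

/-- An immersion in a chart is a hypersurface; its second fundamental form is written as
`⟨∂ⱼ F, ∂ᵢ ν⟩`, for which the condition `shape` holds by definition. -/
lemma isHypersurface (hF : IsImmersedOn h O F ν) (hφ : φ ∈ Charts n N) :
    IsHypersurface (coordMetric h φ)
      (fun q i j => mink (pd j (fun q => F (φ.symm q)) q) (pd i (fun q => ν (φ.symm q)) q))
      (φ.target ∩ φ.symm ⁻¹' O) (fun q => F (φ.symm q)) (fun q => ν (φ.symm q)) := by
  refine ⟨fun q hq => ?_, fun q hq => ?_, fun q hq i j => ?_, fun q hq i => ?_,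
    fun q hq => hF.unit _ hq.2, fun q hq i j => rfl⟩
  · have := (hF.contMDiffAt hq.2).comp q (contMDiffAt_chart_symm hφ hq.1)
    exact (contMDiffAt_iff_contDiffAt.1 this).contDiffWithinAt
  · have := (hF.contMDiffAt_normal hq.2).comp q (contMDiffAt_chart_symm hφ hq.1)
    exact (contMDiffAt_iff_contDiffAt.1 this).contDiffWithinAt
  · rw [pd_comp_chart_symm hφ hq.1 (hF.mdiff hq.2), pd_comp_chart_symm hφ hq.1 (hF.mdiff hq.2),
      hF.isometric _ hq.2]
    rfl
  · rw [pd_comp_chart_symm hφ hq.1 (hF.mdiff hq.2), hF.normal _ hq.2]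

/-- The form `⟨∂ⱼ F, ∂ᵢ ν⟩` is the second fundamental form `-⟨∂ᵢ ∂ⱼ F, ν⟩`. -/
lemma isHypersurface_secondFF (hF : IsImmersedOn h O F ν) (hφ : φ ∈ Charts n N) :
    IsHypersurface (coordMetric h φ) (secondFF F ν φ)
      (φ.target ∩ φ.symm ⁻¹' O) (fun q => F (φ.symm q)) (fun q => ν (φ.symm q)) := by
  have key := hF.isHypersurface hφ
  have hU : IsOpen (φ.target ∩ φ.symm ⁻¹' O) := φ.symm.isOpen_inter_preimage hF.isOpen
  refine ⟨key.1, key.2, key.3, key.4, key.5, fun q hq i j => ?_⟩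
  exact (congrFun (congrFun (key.secondFF_eq hU hq) i) j).symm

lemma mink_dMink_dMink_normal (hF : IsImmersedOn h O F ν) (hφ : φ ∈ Charts n N)
    (hp : p ∈ φ.target ∩ φ.symm ⁻¹' O) (v : Fin n → ℝ) :
    mink (dMink F (φ.symm p) (∑ i, v i • coordVec φ p i))
      (dMink ν (φ.symm p) (∑ i, v i • coordVec φ p i)) =
      v ⬝ᵥ Matrix.mulVec (secondFF F ν φ p) v := by
  rw [mink_dMink_sum hφ hp.1 (hF.mdiff hp.2) (hF.mdiff_normal hp.2)]
  simp only [(hF.isHypersurface_secondFF hφ).shape p hp, dotProduct, Matrix.mulVec,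
    Finset.mul_sum]
  rw [Finset.sum_comm]
  refine Finset.sum_congr rfl fun i _ => Finset.sum_congr rfl fun j _ => ?_
  ring

end IsImmersedOn

namespace IsConvexImmersionOn

lemma posDef (hF : IsConvexImmersionOn h O F ν) (hφ : φ ∈ Charts n N)
    (hp : p ∈ φ.target ∩ φ.symm ⁻¹' O) : (secondFF F ν φ p).PosDef := by
  have hU : IsOpen (φ.target ∩ φ.symm ⁻¹' O) := φ.symm.isOpen_inter_preimage hF.isOpen
  refine Matrix.PosDef.of_dotProduct_mulVec_pos ?_ fun v hv => ?_
  · refine Matrix.ext fun i j => ?_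
    exact (hF.isHypersurface_secondFF hφ).shape_symm hU hp j i
  · have hu : ∑ i, v i • coordVec φ p i ≠ 0 := fun h0 => hv (sum_coordVec_eq_zero hφ hp.1 h0)
    have := hF.convex _ hp.2 _ hu
    rwa [hF.mink_dMink_dMink_normal hφ hp] at this

end IsConvexImmersionOn

/-- For an embedding of the whole manifold, convexity is positivity of the second fundamental form
in all charts. -/
lemma isConvexImmersionOn_univ (hF : IsIsometricEmbedding h F) (hν : IsUnitNormal F ν)
    (hA : PosDefSecondFF F ν) : IsConvexImmersionOn h univ F ν := by
  have h1 : IsImmersedOn h univ F ν :=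
    ⟨isOpen_univ, hF.isSmoothEmbedding.contMDiff.contMDiffOn, hν.contMDiff.contMDiffOn,
      fun y _ => hF.isometric y, fun y _ => hν.unit y, fun y _ => hν.normal y⟩
  refine ⟨h1, fun y _ u hu => ?_⟩
  obtain ⟨φ, hφ, hy⟩ : ∃ φ ∈ Charts n N, y ∈ φ.source :=
    ⟨_, IsManifold.chart_mem_maximalAtlas y, mem_chart_source _ y⟩
  obtain ⟨p, hp, rfl⟩ : ∃ p ∈ φ.target, y = φ.symm p :=
    ⟨φ y, φ.map_source hy, (φ.left_inv hy).symm⟩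
  obtain ⟨v, rfl⟩ := exists_eq_sum_coordVec hφ hp u
  have hv : v ≠ 0 := by rintro rfl; simp at hu
  rw [h1.mink_dMink_dMink_normal hφ ⟨hp, trivial⟩]
  exact (hA φ hφ p hp).dotProduct_mulVec_pos hv

/-- A hypersurface given in a chart, with positive second fundamental form, is a convex
immersion. -/
lemma IsHypersurface.isConvexImmersionOn {A : EuclideanSpace ℝ (Fin n) → Matrix (Fin n) (Fin n) ℝ}
    {U : Set (EuclideanSpace ℝ (Fin n))} {f w : EuclideanSpace ℝ (Fin n) → Minkowski n}
    (hφ : φ ∈ Charts n N) (hU : IsOpen U) (hUφ : U ⊆ φ.target)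
    (hf : IsHypersurface (coordMetric h φ) A U f w) (hA : ∀ q ∈ U, (A q).PosDef) :
    IsConvexImmersionOn h (φ.source ∩ φ ⁻¹' U) (fun y => f (φ y)) (fun y => w (φ y)) := by
  have hO : IsOpen (φ.source ∩ φ ⁻¹' U) := φ.isOpen_inter_preimage hU
  have hs (G : EuclideanSpace ℝ (Fin n) → Minkowski n) (hG : ContDiffOn ℝ ∞ G U) :
      ∀ y ∈ φ.source ∩ φ ⁻¹' U, ContMDiffAt (𝓡 n) 𝓘(ℝ, Minkowski n) ∞ (fun y => G (φ y)) y :=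
    fun y hy => ContMDiffAt.comp y (g := G)
      (contMDiffAt_iff_contDiffAt.2 (hG.contDiffAt (hU.mem_nhds hy.2))) (contMDiffAt_chart hφ hy.1)
  have hp (G : EuclideanSpace ℝ (Fin n) → Minkowski n) {q} (hq : q ∈ U) (i : Fin n) :
      pd i (fun q => G (φ (φ.symm q))) q = pd i G q :=
    pd_congr_on hU (fun q hq => congrArg G (φ.right_inv (hUφ hq))) hq i
  have hd (G : EuclideanSpace ℝ (Fin n) → Minkowski n) (hG : ContDiffOn ℝ ∞ G U) {q}
      (hq : q ∈ U) : MDifferentiableAt (𝓡 n) 𝓘(ℝ, Minkowski n) (fun y => G (φ y)) (φ.symm q) :=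
    (hs G hG _ ⟨φ.map_target (hUφ hq), by simpa [φ.right_inv (hUφ hq)] using hq⟩).mdifferentiableAt
      (by simp)
  have hall {P : N → Prop} (H : ∀ q ∈ U, P (φ.symm q)) : ∀ y ∈ φ.source ∩ φ ⁻¹' U, P y :=
    fun y hy => by simpa [φ.left_inv hy.1] using H (φ y) hy.2
  refine ⟨⟨hO, fun y hy => (hs f hf.smooth y hy).contMDiffWithinAt,
    fun y hy => (hs w hf.smooth_normal y hy).contMDiffWithinAt, hall fun q hq u v => ?_,
    fun y hy => hf.unit _ hy.2, hall fun q hq u => ?_⟩, hall fun q hq u hu => ?_⟩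
  · obtain ⟨a, rfl⟩ := exists_eq_sum_coordVec hφ (hUφ hq) u
    obtain ⟨b, rfl⟩ := exists_eq_sum_coordVec hφ (hUφ hq) v
    rw [mink_dMink_sum hφ (hUφ hq) (hd f hf.smooth hq) (hd f hf.smooth hq), inner_sum_coordVec]
    simp only [hp f hq, hf.metric q hq]
  · obtain ⟨a, rfl⟩ := exists_eq_sum_coordVec hφ (hUφ hq) u
    rw [map_sum, mink_sum_left]
    refine Finset.sum_eq_zero fun i _ => ?_
    rw [map_smul, ← pd_comp_chart_symm hφ (hUφ hq) (hd f hf.smooth hq), hp f hq, mink_smul_left,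
      φ.right_inv (hUφ hq), hf.normal q hq, mul_zero]
  · obtain ⟨a, rfl⟩ := exists_eq_sum_coordVec hφ (hUφ hq) u
    have ha : a ≠ 0 := by rintro rfl; simp at hu
    rw [mink_dMink_sum hφ (hUφ hq) (hd f hf.smooth hq) (hd w hf.smooth_normal hq)]
    refine ((hA q hq).dotProduct_mulVec_pos ha).trans_eq ?_
    simp only [hp f hq, hp w hq, hf.shape q hq, dotProduct, Matrix.mulVec, star_trivial,
      Finset.mul_sum]
    rw [Finset.sum_comm]
    refine Finset.sum_congr rfl fun i _ => Finset.sum_congr rfl fun j _ => ?_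
    ring

end ConvexImmersion

/-! ### Charts of the universal cover -/

section LocalIsometry

open Filter Topology Set

variable {n : ℕ} {M : Type*} [TopologicalSpace M] [ChartedSpace (EuclideanSpace ℝ (Fin n)) M]
  [IsManifold (𝓡 n) ∞ M] {N : Type*} [TopologicalSpace N]
  [ChartedSpace (EuclideanSpace ℝ (Fin n)) N] [IsManifold (𝓡 n) ∞ N]

/-- By the inverse function theorem, a smooth homeomorphism onto an open set with injective
differential is a chart. -/
lemma mem_charts_of_injective (e : OpenPartialHomeomorph N (EuclideanSpace ℝ (Fin n)))
    (he : ∀ y ∈ e.source, ContMDiffAt (𝓡 n) (𝓡 n) ∞ e y)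
    (hi : ∀ y ∈ e.source, Function.Injective (mfderiv (𝓡 n) (𝓡 n) e y)) : e ∈ Charts n N := by
  refine e.mem_maximalAtlas_of_contMDiffOn (fun y hy => (he y hy).contMDiffWithinAt)
    fun q hq => ContMDiffAt.contMDiffWithinAt ?_
  have hy := e.map_target hq
  set y := e.symm q with hyq
  have hχ : chartAt (EuclideanSpace ℝ (Fin n)) y ∈ Charts n N :=
    IsManifold.chart_mem_maximalAtlas y
  set χ := chartAt (EuclideanSpace ℝ (Fin n)) y
  have hyχ : y ∈ χ.source := mem_chart_source _ y
  have hp := χ.map_source hyχ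
  have hleft : χ.symm (χ y) = y := χ.left_inv hyχ
  -- by the inverse function theorem in a chart `χ` of the atlas, the transition map `e ∘ χ⁻¹` has a
  -- smooth inverse
  have hsm : ContDiffAt ℝ ∞ (χ.symm.trans e) (χ y) := by
    refine contMDiffAt_iff_contDiffAt.1 ?_
    refine ContMDiffAt.comp (χ y) (g := e) (f := χ.symm) ?_ (contMDiffAt_chart_symm hχ hp)
    rw [hleft]; exact he y hy
  have hd : HasFDerivAt (χ.symm.trans e) (fderiv ℝ (χ.symm.trans e) (χ y)) (χ y) :=
    (hsm.differentiableAt (by simp)).hasFDerivAt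
  have hinj : Function.Injective (fderiv ℝ (χ.symm.trans e) (χ y)) := by
    have h1 : mfderiv (𝓡 n) (𝓡 n) (e ∘ χ.symm) (χ y) = fderiv ℝ (e ∘ χ.symm) (χ y) :=
      mfderiv_eq_fderiv
    have h2 := mfderiv_comp (I := 𝓡 n) (I' := 𝓡 n) (I'' := 𝓡 n) (χ y) (g := e) (f := χ.symm)
      (by rw [hleft]; exact (he y hy).mdifferentiableAt (by simp))
      ((contMDiffAt_chart_symm hχ hp).mdifferentiableAt (by simp))
    change Function.Injective (fderiv ℝ (e ∘ χ.symm) (χ y))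
    rw [← h1, h2]
    have h3 : ∀ z, z = y → Function.Injective (mfderiv (𝓡 n) (𝓡 n) e z) := by
      rintro _ rfl; exact hi y hy
    exact (h3 _ hleft).comp (mfderiv_chart_symm_bijective hχ hp).1
  have hq' : q ∈ (χ.symm.trans e).target := by
    simp only [OpenPartialHomeomorph.trans_target, OpenPartialHomeomorph.symm_target,
      mem_inter_iff, mem_preimage]
    exact ⟨hq, hyχ⟩
  have hsymm : (χ.symm.trans e).symm q = χ y := rfl
  have hsm' : ContDiffAt ℝ ∞ (χ.symm.trans e).symm q := by
    refine (χ.symm.trans e).contDiffAt_symm (f₀' := (LinearEquiv.ofInjectiveEndo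
      (fderiv ℝ (χ.symm.trans e) (χ y)).toLinearMap hinj).toContinuousLinearEquiv) hq' ?_ ?_
    · rw [hsymm]; exact hd
    · rw [hsymm]; exact hsm
  have h3 : ContMDiffAt (𝓡 n) (𝓡 n) ∞ (χ.symm ∘ (χ.symm.trans e).symm) q :=
    ContMDiffAt.comp q (by rw [hsymm]; exact contMDiffAt_chart_symm hχ hp)
      (contMDiffAt_iff_contDiffAt.2 hsm')
  refine h3.congr_of_eventuallyEq ?_
  filter_upwards [(χ.symm.trans e).open_target.mem_nhds hq'] with z hz
  simp only [OpenPartialHomeomorph.trans_target, OpenPartialHomeomorph.symm_target,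
    mem_inter_iff, mem_preimage] at hz
  exact (χ.left_inv hz.2).symm

variable {g : Metric n M} {h : Metric n N} {π : N → M}

/-- Transport of the metric along an equality of base points; all tangent spaces are the model
space. -/
lemma inner_congr {x x' : M} (hx : x = x') (u v : EuclideanSpace ℝ (Fin n)) :
    g.inner x (show TangentSpace (𝓡 n) x from u) (show TangentSpace (𝓡 n) x from v) =
      g.inner x' (show TangentSpace (𝓡 n) x' from u) (show TangentSpace (𝓡 n) x' from v) := by
  subst hx; rfl

lemma IsRiemannianUniversalCover.mfderiv_injective (hπ : IsRiemannianUniversalCover h g π)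
    (y : N) : Function.Injective (mfderiv (𝓡 n) (𝓡 n) π y) := by
  rw [injective_iff_map_eq_zero]
  intro u hu
  by_contra h0
  have := h.pos y u h0
  rw [hπ.pullback, hu] at this
  simp at this

/-- Charts of `M` lift to charts of the cover, with the same coordinate expression of the
metric. -/
lemma IsRiemannianUniversalCover.exists_chart (hπ : IsRiemannianUniversalCover h g π)
    {φ : OpenPartialHomeomorph M (EuclideanSpace ℝ (Fin n))} (hφ : φ ∈ Charts n M) {y : N}
    (hy : π y ∈ φ.source) : ∃ ψ ∈ Charts n N, y ∈ ψ.source ∧ (∀ z ∈ ψ.source, ψ z = φ (π z)) ∧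
      ψ.target ⊆ φ.target ∧ ∀ q ∈ ψ.target, coordMetric h ψ q = coordMetric g φ q := by
  obtain ⟨e, hye, he⟩ := hπ.isCoveringMap.isLocalHomeomorph y
  have hsrc : ∀ z ∈ (e.trans φ).source, π z ∈ φ.source := fun z hz => by
    rw [OpenPartialHomeomorph.trans_source, ← he] at hz
    exact hz.2
  have hsm : ∀ z ∈ (e.trans φ).source, ContMDiffAt (𝓡 n) (𝓡 n) ∞ (φ ∘ π) z := fun z hz =>
    (contMDiffAt_chart hφ (hsrc z hz)).comp z hπ.contMDiff.contMDiffAt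
  have hψeq : ⇑(e.trans φ) = φ ∘ π := by rw [OpenPartialHomeomorph.coe_trans, he]
  have hψ : e.trans φ ∈ Charts n N := by
    refine mem_charts_of_injective _ (by rwa [hψeq]) fun z hz => ?_
    rw [hψeq, mfderiv_comp (I' := 𝓡 n) z
      ((contMDiffAt_chart hφ (hsrc z hz)).mdifferentiableAt (by simp))
      (hπ.contMDiff.contMDiffAt.mdifferentiableAt (by simp))]
    exact ((mdifferentiable_chart_of_mem hφ).mfderiv_bijective (hsrc z hz)).1.comp
      (hπ.mfderiv_injective z)
  have htgt : (e.trans φ).target ⊆ φ.target := by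
    rw [OpenPartialHomeomorph.trans_target]; exact inter_subset_left
  refine ⟨e.trans φ, hψ, ?_, fun z _ => congrFun hψeq z, htgt, fun q hq => ?_⟩
  · rw [OpenPartialHomeomorph.trans_source]
    exact ⟨hye, by simpa [← he] using hy⟩
  · have hev : ∀ r ∈ (e.trans φ).target, π ((e.trans φ).symm r) = φ.symm r := fun r hr => by
      rw [OpenPartialHomeomorph.trans_target] at hr
      rw [he]
      exact e.right_inv hr.2
    have hq' := (e.trans φ).map_target hq
    have hd : ∀ i, (mfderiv (𝓡 n) (𝓡 n) π ((e.trans φ).symm q) (coordVec (e.trans φ) q i) :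
        EuclideanSpace ℝ (Fin n)) = coordVec φ q i := fun i => by
      have h1 := mfderiv_comp (I := 𝓡 n) (I' := 𝓡 n) (I'' := 𝓡 n) q (g := π)
        (f := (e.trans φ).symm) (hπ.contMDiff.contMDiffAt.mdifferentiableAt (by simp))
        ((contMDiffAt_chart_symm hψ hq).mdifferentiableAt (by simp))
      have h2 : mfderiv (𝓡 n) (𝓡 n) (π ∘ (e.trans φ).symm) q =
          (mfderiv (𝓡 n) (𝓡 n) φ.symm q :) := Filter.EventuallyEq.mfderiv_eq
        (eventuallyEq_of_mem ((e.trans φ).open_target.mem_nhds hq) hev)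
      have h3 := h2.symm.trans h1
      exact (DFunLike.congr_fun h3 (EuclideanSpace.single i 1)).symm
    ext i j
    simp only [coordMetric]
    rw [hπ.pullback]
    refine (inner_congr (hev q hq) _ _).trans ?_
    congr 1
    · exact congrArg _ (hd i)
    · exact hd j

end LocalIsometry

/-! ### Isometries of Minkowski space acting on immersions -/

section Rigidity

open Filter Topology Set

variable {n : ℕ} {N : Type*} [TopologicalSpace N] [ChartedSpace (EuclideanSpace ℝ (Fin n)) N]
  [IsManifold (𝓡 n) ∞ N] {h : Metric n N} {O O' : Set N} {F ν F' ν' : N → Minkowski n}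
  {L L' : Minkowski n ≃ᵃ[ℝ] Minkowski n} {y : N}

/-- The linear part of an affine equivalence of Minkowski space, as a continuous linear map. -/
def linearPart (L : Minkowski n ≃ᵃ[ℝ] Minkowski n) : Minkowski n →L[ℝ] Minkowski n :=
  LinearMap.toContinuousLinearMap (L.linear : Minkowski n →ₗ[ℝ] Minkowski n)

lemma affine_apply_eq (x : Minkowski n) : L x = linearPart L x + L 0 := by
  have : L x = L.linear x + L 0 := by simpa using L.map_vadd 0 x
  exact this

lemma hasFDerivAt_affine (x : Minkowski n) : HasFDerivAt L (linearPart L) x := by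
  have : (L : Minkowski n → Minkowski n) = fun x => linearPart L x + L 0 :=
    funext affine_apply_eq
  rw [this]
  exact (linearPart L).hasFDerivAt.add_const _

lemma contDiff_affine : ContDiff ℝ ∞ L := by
  have : (L : Minkowski n → Minkowski n) = fun x => linearPart L x + L 0 :=
    funext affine_apply_eq
  rw [this]
  exact (linearPart L).contDiff.add contDiff_const

lemma dMink_affine_comp (hF : MDifferentiableAt (𝓡 n) 𝓘(ℝ, Minkowski n) F y)
    (u : TangentSpace (𝓡 n) y) :
    dMink (fun z => L (F z)) y u = L.linear (dMink F y u) := by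
  have h1 : HasMFDerivAt (𝓡 n) 𝓘(ℝ, Minkowski n) (fun z => L (F z)) y _ :=
    (hasFDerivAt_affine (L := L) (F y)).hasMFDerivAt.comp y hF.hasMFDerivAt
  rw [dMink, h1.mfderiv]
  rfl

lemma dMink_linear_comp (hF : MDifferentiableAt (𝓡 n) 𝓘(ℝ, Minkowski n) F y)
    (u : TangentSpace (𝓡 n) y) :
    dMink (fun z => L.linear (F z)) y u = L.linear (dMink F y u) := by
  have h1 : HasMFDerivAt (𝓡 n) 𝓘(ℝ, Minkowski n) (fun z => linearPart L (F z)) y _ :=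
    (linearPart L).hasFDerivAt.hasMFDerivAt.comp y hF.hasMFDerivAt
  rw [dMink]
  change mfderiv (𝓡 n) 𝓘(ℝ, Minkowski n) (fun z => linearPart L (F z)) y u = _
  rw [h1.mfderiv]
  rfl

lemma IsConvexImmersionOn.comp_isometry (hF : IsConvexImmersionOn h O F ν)
    (hL : IsMinkowskiIsometry L) :
    IsConvexImmersionOn h O (fun z => L (F z)) (fun z => L.linear (ν z)) := by
  refine ⟨⟨hF.isOpen, contDiff_affine.contMDiff.comp_contMDiffOn hF.smooth,
    (linearPart L).contDiff.contMDiff.comp_contMDiffOn hF.smooth_normal, fun y hy u v => ?_,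
    fun y hy => ?_, fun y hy u => ?_⟩, fun y hy u hu => ?_⟩
  · rw [dMink_affine_comp (hF.mdiff hy), dMink_affine_comp (hF.mdiff hy), hL.mink_linear,
      hF.isometric y hy]
  · rw [hL.mink_linear, hF.unit y hy]
  · rw [dMink_affine_comp (hF.mdiff hy), hL.mink_linear, hF.normal y hy]
  · rw [dMink_affine_comp (hF.mdiff hy), dMink_linear_comp (hF.mdiff_normal hy), hL.mink_linear]
    exact hF.convex y hy u hu

/-- Being a convex immersion is a local property. -/
lemma isConvexImmersionOn_univ_of_local (H : ∀ y, ∃ O F' ν', y ∈ O ∧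
    IsConvexImmersionOn h O F' ν' ∧ F =ᶠ[𝓝 y] F' ∧ ν =ᶠ[𝓝 y] ν') :
    IsConvexImmersionOn h univ F ν := by
  have hd : ∀ {F F' : N → Minkowski n} {y : N}, F =ᶠ[𝓝 y] F' → dMink F y = dMink F' y := by
    intro F F' y hFF
    ext1 u
    have := hFF.mfderiv_eq (I := 𝓡 n) (I' := 𝓘(ℝ, Minkowski n))
    exact DFunLike.congr_fun this u
  refine ⟨⟨isOpen_univ, fun y _ => ?_, fun y _ => ?_, fun y _ u v => ?_, fun y _ => ?_,
    fun y _ u => ?_⟩, fun y _ u hu => ?_⟩ <;> obtain ⟨O, F', ν', hy, hF', h1, h2⟩ := H y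
  · exact ((hF'.contMDiffAt hy).congr_of_eventuallyEq h1).contMDiffWithinAt
  · exact ((hF'.contMDiffAt_normal hy).congr_of_eventuallyEq h2).contMDiffWithinAt
  · rw [hd h1]; exact hF'.isometric y hy u v
  · rw [h2.eq_of_nhds]; exact hF'.unit y hy
  · rw [hd h1, h2.eq_of_nhds]; exact hF'.normal y hy u
  · rw [hd h1, hd h2]; exact hF'.convex y hy u hu

/-- The tangent vectors and the normal span, so an isometry is determined by its effect on an
immersion and its normal. -/
lemma IsImmersedOn.isometry_unique (hF : IsImmersedOn h O F ν) (hy : y ∈ O)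
    (h1 : ∀ᶠ z in 𝓝 y, L (F z) = L' (F z)) (h2 : L.linear (ν y) = L'.linear (ν y)) :
    L = L' := by
  obtain ⟨φ, hφ, hyφ⟩ : ∃ φ ∈ Charts n N, y ∈ φ.source :=
    ⟨_, IsManifold.chart_mem_maximalAtlas y, mem_chart_source _ y⟩
  obtain ⟨p, hp, rfl⟩ : ∃ p ∈ φ.target, y = φ.symm p :=
    ⟨φ y, φ.map_source hyφ, (φ.left_inv hyφ).symm⟩
  have hdd : ∀ u, L.linear (dMink F (φ.symm p) u) = L'.linear (dMink F (φ.symm p) u) := fun u => by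
    rw [← dMink_affine_comp (hF.mdiff hy), ← dMink_affine_comp (hF.mdiff hy)]
    have := Filter.EventuallyEq.mfderiv_eq (f₁ := fun z => L (F z)) (f := fun z => L' (F z)) h1
      (I := 𝓡 n) (I' := 𝓘(ℝ, Minkowski n))
    exact DFunLike.congr_fun this u
  have hframe := (hF.isHypersurface hφ).frame (p := p) ⟨hp, hy⟩
  have hG := (isMetricOn_coordMetric h hφ).isUnit_det hp
  have hlin : L.linear = L'.linear := by
    apply LinearEquiv.toLinearMap_injective
    refine (hframe.basis hG).ext fun a => ?_
    rcases a with _ | i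
    · rw [hframe.basis_none]; exact h2
    · rw [hframe.basis_some, pd_comp_chart_symm hφ hp (hF.mdiff hy)]; exact hdd _
  ext1 x
  have hx : ∀ L : Minkowski n ≃ᵃ[ℝ] Minkowski n,
      L x = L.linear (x - F (φ.symm p)) + L (F (φ.symm p)) := fun L => by
    have := L.map_vadd (F (φ.symm p)) (x - F (φ.symm p))
    simpa using this
  rw [hx L, hx L', hlin, h1.self_of_nhds]

end Rigidity

/-! ### Rigidity of convex immersions in dimension three -/

section Dimension3

open Filter Topology Set

variable {N : Type*} [TopologicalSpace N] [ChartedSpace (EuclideanSpace ℝ (Fin 3)) N]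
  [IsManifold (𝓡 3) ∞ N] {h : Metric 3 N} {O O' : Set N} {F ν F' ν' : N → Minkowski 3} {y : N}
  {φ : OpenPartialHomeomorph N (EuclideanSpace ℝ (Fin 3))} {p : EuclideanSpace ℝ (Fin 3)}

/-- The second fundamental form of a convex immersion is intrinsic: it is the tensor `P`. -/
lemma IsConvexImmersionOn.secondFF_eq_tensorP (hF : IsConvexImmersionOn h O F ν)
    (hφ : φ ∈ Charts 3 N) (hp : p ∈ φ.target ∩ φ.symm ⁻¹' O) :
    secondFF F ν φ p = tensorP (coordMetric h φ) p :=
  ((hF.isHypersurface_secondFF hφ).tensorP_eq ((isMetricOn_coordMetric h hφ).mono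
    (φ.symm.isOpen_inter_preimage hF.isOpen) inter_subset_left) hp (hF.posDef hφ hp)).symm

lemma IsConvexImmersionOn.isHypersurface_tensorP (hF : IsConvexImmersionOn h O F ν)
    (hφ : φ ∈ Charts 3 N) :
    IsHypersurface (coordMetric h φ) (tensorP (coordMetric h φ)) (φ.target ∩ φ.symm ⁻¹' O)
      (fun q => F (φ.symm q)) (fun q => ν (φ.symm q)) := by
  have := hF.isHypersurface_secondFF hφ
  exact ⟨this.1, this.2, this.3, this.4, this.5, fun q hq i j => by
    rw [this.shape q hq, hF.secondFF_eq_tensorP hφ hq]⟩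

lemma IsHypersurface.mono {n : ℕ} {γ A : EuclideanSpace ℝ (Fin n) → Matrix (Fin n) (Fin n) ℝ}
    {U V : Set (EuclideanSpace ℝ (Fin n))} {f w : EuclideanSpace ℝ (Fin n) → Minkowski n}
    (hf : IsHypersurface γ A U f w) (hV : V ⊆ U) : IsHypersurface γ A V f w :=
  ⟨hf.1.mono hV, hf.2.mono hV, fun q hq => hf.3 q (hV hq), fun q hq => hf.4 q (hV hq),
    fun q hq => hf.5 q (hV hq), fun q hq => hf.6 q (hV hq)⟩

/-- Two convex immersions of the same three-manifold differ, locally, by an isometry of Minkowski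
space: they have the same second fundamental form `P`. -/
lemma IsConvexImmersionOn.exists_isometry (hF : IsConvexImmersionOn h O F ν)
    (hF' : IsConvexImmersionOn h O' F' ν') (hy : y ∈ O) (hy' : y ∈ O') :
    ∃ L : Minkowski 3 ≃ᵃ[ℝ] Minkowski 3, IsMinkowskiIsometry L ∧
      ∀ᶠ z in 𝓝 y, F' z = L (F z) ∧ ν' z = L.linear (ν z) := by
  obtain ⟨φ, hφ, hyφ⟩ : ∃ φ ∈ Charts 3 N, y ∈ φ.source :=
    ⟨_, IsManifold.chart_mem_maximalAtlas y, mem_chart_source _ y⟩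
  have hU : IsOpen (φ.target ∩ φ.symm ⁻¹' (O ∩ O')) :=
    φ.symm.isOpen_inter_preimage (hF.isOpen.inter hF'.isOpen)
  have hp : φ y ∈ φ.target ∩ φ.symm ⁻¹' (O ∩ O') :=
    ⟨φ.map_source hyφ, by simpa [φ.left_inv hyφ] using ⟨hy, hy'⟩⟩
  obtain ⟨L, hL, hev⟩ := ((hF.isHypersurface_tensorP hφ).mono
    (V := φ.target ∩ φ.symm ⁻¹' (O ∩ O')) fun q hq => ⟨hq.1, hq.2.1⟩).exists_isometry
    ((hF'.isHypersurface_tensorP hφ).mono fun q hq => ⟨hq.1, hq.2.2⟩)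
    ((isMetricOn_coordMetric h hφ).mono hU inter_subset_left) hp
  refine ⟨L, hL, ?_⟩
  filter_upwards [(φ.continuousAt hyφ).eventually hev, φ.open_source.mem_nhds hyφ] with z hz hzs
  simpa [φ.left_inv hzs] using hz

variable {M : Type*} [TopologicalSpace M] [ChartedSpace (EuclideanSpace ℝ (Fin 3)) M]
  [IsManifold (𝓡 3) ∞ M] {g : Metric 3 M} {π : N → M}

/-- If the universal cover has a convex immersion, then `P` is Codazzi on `M`. In charts lifted from `M`
the metrics of the cover and of `M`, and hence their tensors `P`, coincide; there `P` is the second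
fundamental form of the immersion, which satisfies the Codazzi equation. -/
lemma IsConvexImmersionOn.codazziP (hF : IsConvexImmersionOn h univ F ν)
    (hπ : IsRiemannianUniversalCover h g π) : CodazziP g := by
  intro φ hφ p hp
  obtain ⟨y, hy⟩ := hπ.surjective (φ.symm p)
  obtain ⟨ψ, hψ, hyψ, hψφ, htgt, hmet⟩ := hπ.exists_chart hφ (y := y) (hy ▸ φ.map_target hp)
  have hpψ : p ∈ ψ.target := by
    have := ψ.map_source hyψ
    rwa [hψφ y hyψ, hy, φ.right_inv hp] at this
  have hγ : IsMetricOn (coordMetric g φ) ψ.target :=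
    (isMetricOn_coordMetric g hφ).mono ψ.open_target htgt
  have h1 := (hF.isHypersurface_secondFF hψ).mono (V := ψ.target) fun q hq => ⟨hq, trivial⟩
  have h2 : IsHypersurface (coordMetric g φ) (secondFF F ν ψ) ψ.target
      (fun q => F (ψ.symm q)) (fun q => ν (ψ.symm q)) :=
    ⟨h1.1, h1.2, fun q hq => hmet q hq ▸ h1.3 q hq, h1.4, h1.5, h1.6⟩
  exact (h2.isCodazziAt hγ hpψ).congr ψ.open_target hpψ fun q hq =>
    (h2.tensorP_eq hγ hq (hF.posDef hψ ⟨hq, trivial⟩)).symm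

/-- If `P` is Codazzi on `M`, then the universal cover has convex immersions near each point. -/
lemma exists_isConvexImmersionOn (hπ : IsRiemannianUniversalCover h g π)
    (hg : NegativeSectionalCurvature g) (hC : CodazziP g) (y : N) :
    ∃ O F ν, y ∈ O ∧ IsConvexImmersionOn h O F ν := by
  obtain ⟨φ, hφ, hyφ⟩ : ∃ φ ∈ Charts 3 M, π y ∈ φ.source :=
    ⟨_, IsManifold.chart_mem_maximalAtlas (π y), mem_chart_source _ (π y)⟩
  obtain ⟨ψ, hψ, hyψ, hψφ, htgt, hmet⟩ := hπ.exists_chart hφ hyφ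
  have hγ : IsMetricOn (coordMetric g φ) ψ.target :=
    (isMetricOn_coordMetric g hφ).mono ψ.open_target htgt
  obtain ⟨U, hU, hyU, hUψ, f, w, hf⟩ := hγ.exists_isHypersurface_tensorP
    (fun q hq => hg φ hφ q (htgt hq)) (fun q hq => hC φ hφ q (htgt hq)) (ψ.map_source hyψ)
  refine ⟨ψ.source ∩ ψ ⁻¹' U, fun z => f (ψ z), fun z => w (ψ z), ⟨hyψ, hyU⟩,
    IsHypersurface.isConvexImmersionOn (h := h)
    (A := tensorP (coordMetric g φ)) hψ hU hUψ
    ⟨hf.1, hf.2, fun q hq => (hmet q (hUψ hq)).symm ▸ hf.3 q hq, hf.4, hf.5, hf.6⟩ fun q hq => ?_⟩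
  have hq' := hUψ hq
  exact (tensorP_posDef_and_gauss (hγ.posDef q hq') (hγ.isCurvLike hq')
    (hg φ hφ q (htgt hq'))).1

end Dimension3

/-! ### Continuation over simply connected spaces -/

section Monodromy

open Filter Topology Set

variable {B G X : Type*} [TopologicalSpace B] [Group G]

/-- Analytic continuation over a simply connected base: local functions that agree on overlaps up
to a locally constant element of a group `G`, which is determined by its action on them, patch
together to a global function. The obstruction is a `G`-covering of `B`, and `B` has a section
of it. -/
theorem exists_global_of_local [SimplyConnectedSpace B] [LocallyPathConnectedSpace B]
    (act : G → X → X) (act_mul : ∀ a b x, act (a * b) x = act a (act b x))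
    (O : B → Set B) (hO : ∀ x, IsOpen (O x)) (hx : ∀ x, x ∈ O x) (s : B → B → X)
    (hex : ∀ x x' y, y ∈ O x → y ∈ O x' → ∃ a, ∀ᶠ z in 𝓝 y, s x' z = act a (s x z))
    (huniq : ∀ x y a b, y ∈ O x → (∀ᶠ z in 𝓝 y, act a (s x z) = act b (s x z)) → a = b) :
    ∃ S : B → X, ∀ y, ∃ a, ∀ᶠ z in 𝓝 y, S z = act a (s y z) := by
  classical
  choose c hc using hex
  set cc : B → B → B → G := fun x x' y => if h : y ∈ O x ∧ y ∈ O x' then c x x' y h.1 h.2 else 1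
    with hcc
  have hcc' : ∀ x x' y, y ∈ O x → y ∈ O x' → ∀ᶠ z in 𝓝 y, s x' z = act (cc x x' y) (s x z) := by
    intro x x' y h h'
    simpa only [hcc, h, h', and_self, dite_true] using hc x x' y h h'
  have hloc : ∀ x x' y, y ∈ O x → y ∈ O x' → ∀ᶠ z in 𝓝 y, cc x x' z = cc x x' y := by
    intro x x' y h h'
    filter_upwards [(hcc' x x' y h h').eventually_nhds, (hO x).mem_nhds h, (hO x').mem_nhds h']
      with z hz hzx hzx'
    refine huniq x z _ _ hzx ?_
    filter_upwards [hz, hcc' x x' z hzx hzx'] with w h1 h2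
    rw [← h1, ← h2]
  let _ : TopologicalSpace G := ⊥
  have : DiscreteTopology G := ⟨rfl⟩
  -- the principal bundle with discrete fibre `G` and transition functions `cc`; a point over `y`
  -- in the chart `x` with value `v` stands for the germ of `act v (s x ·)` at `y`
  let Z : FiberBundleCore B B G :=
    { baseSet := O
      isOpen_baseSet := hO
      indexAt := id
      mem_baseSet_at := hx
      coordChange := fun x x' y v => v * (cc x x' y)⁻¹
      coordChange_self := fun x y hy v => by
        have h1 : (1 : G) * cc x x y = 1 := by
          refine huniq x y _ _ hy ?_
          filter_upwards [hcc' x x y hy hy] with z hz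
          rw [act_mul, ← hz]
        rw [one_mul] at h1
        rw [h1, inv_one, mul_one]
      continuousOn_coordChange := fun x x' => by
        rintro ⟨y, v⟩ ⟨⟨hy, hy'⟩, -⟩
        refine ContinuousAt.continuousWithinAt ?_
        have : (fun p : B × G => p.2 * (cc x x' p.1)⁻¹) =ᶠ[𝓝 (y, v)] fun _ => v * (cc x x' y)⁻¹ := by
          rw [nhds_prod_eq, nhds_discrete G]
          filter_upwards [(hloc x x' y hy hy').prod_mk (eventually_pure.2 rfl :
            ∀ᶠ w in pure v, w = v)] with p hp
          rw [hp.1, hp.2]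
        exact continuousAt_const.congr this.symm
      coordChange_comp := fun x x' x'' y hy v => by
        have h1 : cc x' x'' y * cc x x' y = cc x x'' y := by
          refine huniq x y _ _ hy.1.1 ?_
          filter_upwards [hcc' x x' y hy.1.1 hy.1.2, hcc' x' x'' y hy.1.2 hy.2,
            hcc' x x'' y hy.1.1 hy.2] with z hz1 hz2 hz3
          rw [act_mul, ← hz1, ← hz2, hz3]
        rw [← h1]; group }
  -- the bundle is a covering, and a section of it is a lift of the identity
  have hcov : IsCoveringMap Z.proj := FiberBundle.isCoveringMap (F := G) (E := Z.Fiber)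
  obtain ⟨x₀⟩ : Nonempty B := inferInstance
  obtain ⟨F, ⟨-, hF⟩, -⟩ := hcov.existsUnique_continuousMap_lifts (ContinuousMap.id B) x₀
    (⟨x₀, (1 : G)⟩ : Z.TotalSpace) rfl
  have hF' : ∀ y, (F y).proj = y := fun y => congrFun hF y
  let v : B → G := fun y => (F y).2
  refine ⟨fun y => act (v y) (s y y), fun y => ⟨v y * (cc y y y)⁻¹, ?_⟩⟩
  have hT : ContinuousAt (fun z => (Z.localTriv y (F z)).2) y := by
    refine continuous_snd.continuousAt.comp ?_
    refine ((Z.localTriv y).continuousAt ?_).comp F.continuous.continuousAt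
    rw [Z.mem_localTriv_source, hF']
    exact hx y
  have hT' : ∀ z, (Z.localTriv y (F z)).2 = v z * (cc z y z)⁻¹ := fun z => by
    rw [Z.localTriv_apply]
    change v z * (cc (F z).proj y (F z).proj)⁻¹ = _
    rw [hF']
  simp only [hT'] at hT
  have hconst : ∀ᶠ z in 𝓝 y, v z * (cc z y z)⁻¹ = v y * (cc y y y)⁻¹ :=
    hT.eventually (by simp : ∀ᶠ w in 𝓝 (v y * (cc y y y)⁻¹), w = v y * (cc y y y)⁻¹)
  filter_upwards [hconst, (hO y).mem_nhds (hx y)] with z hz hzy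
  rw [← hz, (hcc' z y z (hx z) hzy).self_of_nhds, ← act_mul]
  congr 1
  group

end Monodromy

/-! ### The global immersion -/

section Development

open Filter Topology Set

variable {n : ℕ}

lemma IsMinkowskiIsometry.one : IsMinkowskiIsometry (1 : Minkowski n ≃ᵃ[ℝ] Minkowski n) :=
  fun _ _ => rfl

lemma IsMinkowskiIsometry.mul {L L' : Minkowski n ≃ᵃ[ℝ] Minkowski n} (h : IsMinkowskiIsometry L)
    (h' : IsMinkowskiIsometry L') : IsMinkowskiIsometry (L * L') := fun x y => by
  rw [AffineEquiv.mul_def, AffineEquiv.trans_apply, AffineEquiv.trans_apply, h, h']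

lemma IsMinkowskiIsometry.inv {L : Minkowski n ≃ᵃ[ℝ] Minkowski n} (h : IsMinkowskiIsometry L) :
    IsMinkowskiIsometry L⁻¹ := fun x y => by
  have := h (L⁻¹ x) (L⁻¹ y)
  rw [← this, AffineEquiv.inv_def, AffineEquiv.apply_symm_apply, AffineEquiv.apply_symm_apply]

variable (n) in
/-- The isometry group of Minkowski space. -/
def isometryGroup : Subgroup (Minkowski n ≃ᵃ[ℝ] Minkowski n) where
  carrier := {L | IsMinkowskiIsometry L}
  one_mem' := .one
  mul_mem' := .mul
  inv_mem' := .inv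

variable {M : Type*} [TopologicalSpace M] [ChartedSpace (EuclideanSpace ℝ (Fin 3)) M]
  [IsManifold (𝓡 3) ∞ M] {N : Type*} [TopologicalSpace N]
  [ChartedSpace (EuclideanSpace ℝ (Fin 3)) N] [IsManifold (𝓡 3) ∞ N]
  {g : Metric 3 M} {h : Metric 3 N} {π : N → M}

/-- If `P` is Codazzi, the local immersions with second fundamental form `P` patch together: by
rigidity they differ by unique isometries of Minkowski space, and the universal cover is simply
connected. -/
theorem exists_isConvexImmersionOn_univ (hπ : IsRiemannianUniversalCover h g π)
    (hg : NegativeSectionalCurvature g) (hC : CodazziP g) :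
    ∃ F ν, IsConvexImmersionOn h univ F ν := by
  have := hπ.simplyConnected
  have : LocallyPathConnectedSpace N :=
    ChartedSpace.locallyPathConnectedSpace (EuclideanSpace ℝ (Fin 3)) N
  choose O F ν hy hF using exists_isConvexImmersionOn hπ hg hC
  obtain ⟨S, hS⟩ := exists_global_of_local (B := N) (G := isometryGroup 3)
    (X := Minkowski 3 × Minkowski 3) (fun L x => (L.1 x.1, L.1.linear x.2)) (fun a b x => rfl)
    O (fun x => (hF x).isOpen) hy (fun x z => (F x z, ν x z))
    (fun x x' y hyx hyx' => by
      obtain ⟨L, hL, hev⟩ := (hF x).exists_isometry (hF x') hyx hyx'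
      exact ⟨⟨L, hL⟩, hev.mono fun z hz => Prod.ext hz.1 hz.2⟩)
    (fun x y a b hyx hev => Subtype.ext ((hF x).isometry_unique hyx
      (hev.mono fun z hz => congrArg Prod.fst hz) (congrArg Prod.snd hev.self_of_nhds)))
  refine ⟨fun y => (S y).1, fun y => (S y).2, isConvexImmersionOn_univ_of_local fun y => ?_⟩
  obtain ⟨a, ha⟩ := hS y
  exact ⟨O y, _, _, hy y, (hF y).comp_isometry a.2, ha.mono fun z hz => congrArg Prod.fst hz,
    ha.mono fun z hz => congrArg Prod.snd hz⟩

/-- Two convex immersions of a connected three-manifold differ by an isometry of Minkowski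
space. -/
theorem IsConvexImmersionOn.exists_global_isometry [PreconnectedSpace N] [Nonempty N]
    {F ν F' ν' : N → Minkowski 3}
    (hF : IsConvexImmersionOn h univ F ν) (hF' : IsConvexImmersionOn h univ F' ν') :
    ∃ L : Minkowski 3 ≃ᵃ[ℝ] Minkowski 3, IsMinkowskiIsometry L ∧
      ∀ z, F' z = L (F z) ∧ ν' z = L.linear (ν z) := by
  choose L hL hev using fun y => hF.exists_isometry hF' (y := y) trivial trivial
  have hloc : IsLocallyConstant L := by
    rw [IsLocallyConstant.iff_eventually_eq]
    intro y
    filter_upwards [(hev y).eventually_nhds] with z hz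
    refine hF.isometry_unique (y := z) trivial ?_ ?_
    · filter_upwards [hz, hev z] with w h1 h2
      rw [← h1.1, ← h2.1]
    · rw [← hz.self_of_nhds.2, ← (hev z).self_of_nhds.2]
  obtain ⟨y₀⟩ := ‹Nonempty N›
  refine ⟨L y₀, hL y₀, fun z => ?_⟩
  rw [hloc.apply_eq_of_preconnectedSpace y₀ z]
  exact (hev z).self_of_nhds

end Development

/-! ### Maps through which segments lift -/

section SegmentLifting

open Filter Topology Set Metric unitInterval

/-- A map that expands lengths by at least the factor `c` on a closed ball of radius `r` lifts the
segments of length at most `c r` that start at the image of the centre: the lift of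
`t ↦ G q₀ + t v` is the integral curve of `(dG)⁻¹ v`, whose speed is at most `‖v‖ / c`. -/
theorem exists_segment_lift_of_expanding {E : Type*} [NormedAddCommGroup E] [NormedSpace ℝ E]
    [FiniteDimensional ℝ E] {G : E → E} {U : Set E} (hU : IsOpen U) (hG : ContDiffOn ℝ ∞ G U)
    {q₀ : E} {r c : ℝ} (hr : 0 ≤ r) (hc : 0 < c) (hrU : closedBall q₀ r ⊆ U)
    (hexp : ∀ q ∈ closedBall q₀ r, ∀ w, c * ‖w‖ ≤ ‖fderiv ℝ G q w‖) {v : E} (hv : ‖v‖ ≤ c * r) :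
    ∃ α : ℝ → E, Continuous α ∧ α 0 = q₀ ∧ (∀ t, α t ∈ closedBall q₀ r) ∧
      ∀ t ∈ Icc (0 : ℝ) 1, G (α t) = G q₀ + t • v := by
  have hinj : ∀ q ∈ closedBall q₀ r, Function.Injective (fderiv ℝ G q) := fun q hq => by
    rw [injective_iff_map_eq_zero]
    intro w hw
    have := hexp q hq w
    rw [hw, norm_zero] at this
    exact norm_le_zero_iff.1 (nonpos_of_mul_nonpos_right this hc)
  choose! e he using fun q (hq : q ∈ closedBall q₀ r) =>
    (show ∃ e : E ≃L[ℝ] E, (e : E →L[ℝ] E) = fderiv ℝ G q from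
      ⟨(LinearEquiv.ofInjectiveEndo (fderiv ℝ G q).toLinearMap
        (hinj q hq)).toContinuousLinearEquiv, rfl⟩)
  set X : E → E := fun q => ContinuousLinearMap.inverse (fderiv ℝ G q) v with hX
  have hXe : ∀ q ∈ closedBall q₀ r, X q = (e q).symm v := fun q hq => by
    simp only [hX]
    rw [← he q hq, ContinuousLinearMap.inverse_equiv]
    rfl
  have hGX : ∀ q ∈ closedBall q₀ r, fderiv ℝ G q (X q) = v := fun q hq => by
    rw [hXe q hq, ← he q hq]; simp
  have hXL : ∀ q ∈ closedBall q₀ r, ‖X q‖ ≤ ‖v‖ / c := fun q hq => by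
    rw [le_div_iff₀ hc, mul_comm, ← hGX q hq]
    exact (hexp q hq _)
  have hXs : ContDiffOn ℝ 1 X (closedBall q₀ r) := fun q hq => by
    have h1 : ContDiffAt ℝ 1 (fderiv ℝ G) q :=
      ((hG.contDiffAt (hU.mem_nhds (hrU hq))).fderiv_right (m := 1) (by norm_cast))
    have h2 : ContDiffAt ℝ 1 ContinuousLinearMap.inverse (fderiv ℝ G q) := by
      rw [← he q hq]; exact contDiffAt_map_inverse (e q)
    exact ((h2.comp q h1).clm_apply contDiffAt_const).contDiffWithinAt
  obtain ⟨K, hK⟩ := hXs.exists_lipschitzOnWith one_ne_zero (convex_closedBall q₀ r)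
    (isCompact_closedBall q₀ r)
  lift r to NNReal using hr
  obtain ⟨ℓ, hℓ⟩ : ∃ ℓ : NNReal, (ℓ : ℝ) = ‖v‖ / c := ⟨⟨‖v‖ / c, by positivity⟩, rfl⟩
  have hPL : IsPicardLindelof (fun _ => X) (tmin := 0) (tmax := 1) ⟨0, by simp⟩ q₀ r 0 ℓ K :=
    .of_time_independent (fun q hq => hℓ ▸ hXL q hq) hK (by
      simp only [NNReal.coe_zero, sub_zero, sub_self]
      rw [max_eq_left zero_le_one, mul_one, hℓ, div_le_iff₀ hc, mul_comm]
      exact hv)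
  obtain ⟨α, hα⟩ := ODE.FunSpace.exists_isFixedPt_next hPL (mem_closedBall_self le_rfl)
  have hmem : ∀ t, α.compProj t ∈ closedBall q₀ r := fun t =>
    α.compProj_mem_closedBall hPL.mul_max_le
  have h0 : α.compProj (0 : ℝ) = q₀ := by
    have : α.compProj ((⟨0, by simp⟩ : Icc (0 : ℝ) 1) : ℝ) = q₀ := by
      rw [ODE.FunSpace.compProj_val, ← hα, ODE.FunSpace.next_apply₀]
    exact this
  have hder : ∀ t ∈ Icc (0 : ℝ) 1,
      HasDerivWithinAt α.compProj (X (α.compProj t)) (Icc 0 1) t := fun t ht => by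
    have h1 := ODE.hasDerivWithinAt_picard_Icc (f := fun _ => X) (t₀ := 0) (by simp)
      hPL.continuousOn_uncurry α.continuous_compProj.continuousOn (fun t _ => hmem t) q₀ ht
    refine h1.congr_of_mem (fun s hs => ?_) ht
    rw [ODE.FunSpace.compProj_apply]
    conv_lhs => rw [← hα]
    rw [ODE.FunSpace.next_apply, projIcc_of_mem _ hs]
  refine ⟨α.compProj, α.continuous_compProj, h0, hmem, fun t ht => ?_⟩
  have hd : ∀ t ∈ Icc (0 : ℝ) 1,
      HasDerivWithinAt (fun t => G (α.compProj t) - t • v) 0 (Icc 0 1) t := fun t ht => by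
    have h1 : HasFDerivAt G (fderiv ℝ G (α.compProj t)) (α.compProj t) :=
      ((hG.contDiffAt (hU.mem_nhds (hrU (hmem t)))).differentiableAt (by simp)).hasFDerivAt
    have h2 := (h1.comp_hasDerivWithinAt t (hder t ht)).sub
      ((hasDerivWithinAt_id t (Icc 0 1)).smul_const v)
    rw [hGX _ (hmem t), one_smul, sub_self] at h2
    exact h2
  have hconst := constant_of_derivWithin_zero (fun t ht => (hd t ht).differentiableWithinAt)
    (fun t ht => (hd t (Ico_subset_Icc_self ht)).derivWithin
      (uniqueDiffOn_Icc zero_lt_one t (Ico_subset_Icc_self ht))) t ht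
  simp only [h0, zero_smul, sub_zero] at hconst
  rw [← hconst]; abel

variable {N E : Type*} [TopologicalSpace N] [NormedAddCommGroup E] [NormedSpace ℝ E]
  {f : N → E} {δ : ℝ}

/-- All segments of length at most `δ` lift through `f`, from every starting point. -/
def HasSegmentLifts (f : N → E) (δ : ℝ) : Prop :=
  ∀ (y : N) (v : E), ‖v‖ ≤ δ → ∃ γ : C(I, N), γ 0 = y ∧ ∀ t : I, f (γ t) = f y + (t : ℝ) • v

/-- Lifts of two successive segments are concatenated. -/
lemma HasSegmentLifts.double (h : HasSegmentLifts f δ) : HasSegmentLifts f (2 * δ) := by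
  intro y v hv
  have hv2 : ‖(1 / 2 : ℝ) • v‖ ≤ δ := by
    rw [norm_smul, Real.norm_eq_abs, abs_of_pos (by norm_num)]; linarith
  obtain ⟨γ, hγ0, hγ⟩ := h y _ hv2
  obtain ⟨γ', hγ0', hγ'⟩ := h (γ 1) _ hv2
  let p : Path y (γ 1) := ⟨γ, hγ0, rfl⟩
  let p' : Path (γ 1) (γ' 1) := ⟨γ', hγ0', rfl⟩
  refine ⟨(p.trans p').toContinuousMap, (p.trans p').source, fun t => ?_⟩
  change f ((p.trans p') t) = _
  rw [Path.trans_apply]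
  split_ifs with ht
  · refine (hγ _).trans ?_
    rw [smul_smul]; congr 2; ring
  · refine (hγ' _).trans ?_
    rw [hγ, smul_smul, smul_smul, add_assoc, ← add_smul]
    congr 2
    simp only [Icc.coe_one]
    ring

lemma HasSegmentLifts.exists_lift (h : HasSegmentLifts f δ) (hδ : 0 < δ) (y : N) (v : E) :
    ∃ γ : C(I, N), γ 0 = y ∧ ∀ t : I, f (γ t) = f y + (t : ℝ) • v := by
  have hk : ∀ k : ℕ, HasSegmentLifts f (2 ^ k * δ) := fun k => by
    induction k with
    | zero => simpa using h
    | succ k ih => rw [pow_succ', mul_assoc]; exact ih.double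
  obtain ⟨k, hk'⟩ := pow_unbounded_of_one_lt (‖v‖ / δ) (by norm_num : (1 : ℝ) < 2)
  exact hk k y v ((div_lt_iff₀ hδ).1 hk').le

/-- A local homeomorphism from a connected space to a normed space, through which segments of
uniform length lift, is a homeomorphism: lifting the rays from a point gives a continuous section,
whose image is open and closed. -/
theorem HasSegmentLifts.bijective [T2Space N] [ConnectedSpace N] (h : HasSegmentLifts f δ)
    (hδ : 0 < δ) (hf : IsLocalHomeomorph f) :
    Function.Bijective f := by
  obtain ⟨y₀⟩ : Nonempty N := inferInstance
  choose Γ hΓ0 hΓ using h.exists_lift hδ y₀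
  have hcont : Continuous (fun q : I × E => Γ (q.2 - f y₀) q.1) := by
    refine hf.continuous_lift (T2Space.isSeparatedMap f)
      (⟨fun q : I × E => f y₀ + (q.1 : ℝ) • (q.2 - f y₀), by fun_prop⟩ : C(I × E, E)) ?_ ?_ ?_
    · ext q; exact hΓ _ _
    · simp only [hΓ0]; exact continuous_const
    · exact fun a => (Γ (a - f y₀)).continuous
  set s : E → N := fun x => Γ (x - f y₀) 1 with hs
  have hsc : Continuous s := hcont.comp (continuous_const.prodMk continuous_id)
  have hfs : ∀ x, f (s x) = x := fun x => by
    simp only [hs]; rw [hΓ]; simp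
  have hsl : IsLocalHomeomorph s :=
    IsLocalHomeomorph.of_comp (g := f) (f := s) (by
      have : f ∘ s = id := funext hfs
      rw [this]; exact (Homeomorph.refl E).isLocalHomeomorph) hf hsc
  have hclosed : IsClosed (range s) := by
    have : range s = {y | s (f y) = y} := by
      ext y
      refine ⟨?_, fun hy => ⟨_, hy⟩⟩
      rintro ⟨x, rfl⟩
      exact congrArg s (hfs x)
    rw [this]
    exact isClosed_eq (hsc.comp hf.continuous) continuous_id
  have huniv : range s = univ :=
    IsClopen.eq_univ ⟨hclosed, hsl.isOpenMap.isOpen_range⟩ (range_nonempty s)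
  refine ⟨fun a b hab => ?_, fun x => ⟨_, hfs x⟩⟩
  obtain ⟨x, rfl⟩ : a ∈ range s := huniv ▸ trivial
  obtain ⟨x', rfl⟩ : b ∈ range s := huniv ▸ trivial
  rw [hfs, hfs] at hab
  rw [hab]

end SegmentLifting

/-! ### The spatial projection expands lengths -/

section Expansion

open Filter Topology Set Metric unitInterval Matrix

variable {n : ℕ}

/-- The projection of a spacelike hypersurface to the spatial directions does not decrease
lengths. -/
lemma IsHypersurface.le_norm_fderiv_fst_sq
    {γ A : EuclideanSpace ℝ (Fin n) → Matrix (Fin n) (Fin n) ℝ} {U : Set (EuclideanSpace ℝ (Fin n))}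
    {f w : EuclideanSpace ℝ (Fin n) → Minkowski n} (hf : IsHypersurface γ A U f w)
    (hU : IsOpen U) {q : EuclideanSpace ℝ (Fin n)} (hq : q ∈ U) (v : EuclideanSpace ℝ (Fin n)) :
    v.ofLp ⬝ᵥ γ q *ᵥ v.ofLp ≤ ‖fderiv ℝ (fun q => (f q).1) q v‖ ^ 2 := by
  have hd : HasFDerivAt f (fderiv ℝ f q) q :=
    (differentiableAt_of_contDiffOn hU hf.smooth hq).hasFDerivAt
  have h1 : fderiv ℝ (fun q => (f q).1) q v = (fderiv ℝ f q v).1 := by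
    rw [hd.fst.fderiv]; rfl
  have h2 : mink (fderiv ℝ f q v) (fderiv ℝ f q v) = v.ofLp ⬝ᵥ γ q *ᵥ v.ofLp := by
    rw [fderiv_apply_eq_sum_pd]
    simp only [mink_sum_left, mink_sum_right, mink_smul_left, mink_smul_right, hf.metric q hq,
      dotProduct, mulVec, Finset.mul_sum]
    rw [Finset.sum_comm]
    refine Finset.sum_congr rfl fun i _ => Finset.sum_congr rfl fun j _ => ?_
    ring
  rw [h1, ← h2, mink, real_inner_self_eq_norm_sq]
  nlinarith [mul_self_nonneg (fderiv ℝ f q v).2]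

/-- On compact sets a metric dominates a multiple of the Euclidean metric. -/
lemma IsMetricOn.exists_lower_bound {γ : EuclideanSpace ℝ (Fin n) → Matrix (Fin n) (Fin n) ℝ}
    {U K : Set (EuclideanSpace ℝ (Fin n))} (hγ : IsMetricOn γ U) (hK : IsCompact K) (hKU : K ⊆ U) :
    ∃ c > 0, ∀ q ∈ K, ∀ v : EuclideanSpace ℝ (Fin n),
      (c * ‖v‖) ^ 2 ≤ v.ofLp ⬝ᵥ γ q *ᵥ v.ofLp := by
  set Q : EuclideanSpace ℝ (Fin n) × EuclideanSpace ℝ (Fin n) → ℝ :=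
    fun z => z.2.ofLp ⬝ᵥ γ z.1 *ᵥ z.2.ofLp with hQ
  have hcont : ContinuousOn Q (K ×ˢ sphere 0 1) := by
    simp only [hQ, dotProduct, mulVec]
    refine continuousOn_finsetSum _ fun i _ => ContinuousOn.mul (by fun_prop) ?_
    refine continuousOn_finsetSum _ fun j _ => ContinuousOn.mul ?_ (by fun_prop)
    exact ((hγ.smooth i j).continuousOn.mono hKU).comp continuousOn_fst fun z hz => hz.1
  have hpos : ∀ z ∈ K ×ˢ sphere (0 : EuclideanSpace ℝ (Fin n)) 1, 0 < Q z := fun z hz => by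
    have hz0 : z.2.ofLp ≠ 0 := fun h0 => by
      have : z.2 = 0 := by ext i; simp [h0]
      have h1 := hz.2
      simp [this] at h1
    simpa using (hγ.posDef z.1 (hKU hz.1)).dotProduct_mulVec_pos hz0
  obtain ⟨m, hm, hmQ⟩ : ∃ m > 0, ∀ z ∈ K ×ˢ sphere (0 : EuclideanSpace ℝ (Fin n)) 1, m ≤ Q z := by
    rcases (K ×ˢ sphere (0 : EuclideanSpace ℝ (Fin n)) 1).eq_empty_or_nonempty with h0 | hne
    · exact ⟨1, one_pos, by simp [h0]⟩
    · obtain ⟨z, hz, hmin⟩ := (hK.prod (isCompact_sphere 0 1)).exists_isMinOn hne hcont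
      exact ⟨Q z, hpos z hz, fun z' hz' => hmin hz'⟩
  refine ⟨√m, Real.sqrt_pos.2 hm, fun q hq v => ?_⟩
  rcases eq_or_ne v 0 with rfl | hv
  · simp
  have hv' : ‖v‖ ≠ 0 := norm_ne_zero_iff.2 hv
  have h1 := hmQ (q, ‖v‖⁻¹ • v) ⟨hq, by simp [norm_smul, hv']⟩
  simp only [hQ, WithLp.ofLp_smul, mulVec_smul, dotProduct_smul, smul_dotProduct,
    smul_eq_mul] at h1
  rw [mul_pow, Real.sq_sqrt hm.le]
  calc m * ‖v‖ ^ 2 ≤ (‖v‖⁻¹ * (‖v‖⁻¹ * (v.ofLp ⬝ᵥ γ q *ᵥ v.ofLp))) * ‖v‖ ^ 2 := by gcongr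
    _ = _ := by field_simp

variable {M : Type*} [TopologicalSpace M] [ChartedSpace (EuclideanSpace ℝ (Fin n)) M]
  [IsManifold (𝓡 n) ∞ M] {N : Type*} [TopologicalSpace N]
  [ChartedSpace (EuclideanSpace ℝ (Fin n)) N] [IsManifold (𝓡 n) ∞ N]
  {g : Metric n M} {h : Metric n N} {π : N → M} {F ν : N → Minkowski n}

/-- Coordinate balls of `M` lift to the cover, starting at any point over them. Outside of the ball
the lift is continued along the radial retraction, so as to have a map on a simply connected
space. -/
lemma IsRiemannianUniversalCover.exists_ball_lift (hπ : IsRiemannianUniversalCover h g π)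
    {φ : OpenPartialHomeomorph M (EuclideanSpace ℝ (Fin n))} (hφ : φ ∈ Charts n M)
    {p : EuclideanSpace ℝ (Fin n)} {r : ℝ} (hr : 0 < r) (hball : closedBall p r ⊆ φ.target)
    {y : N} (hy : π y ∈ φ.source) (hyr : φ (π y) ∈ ball p r) :
    ∃ s : C(EuclideanSpace ℝ (Fin n), N), s (φ (π y)) = y ∧ ∀ q ∈ ball p r,
      ∃ ψ ∈ Charts n N, ∃ V ⊆ ψ.target, IsOpen V ∧ q ∈ V ∧ ∀ q' ∈ V, s q' = ψ.symm q' ∧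
        coordMetric h ψ q' = coordMetric g φ q' := by
  set ρ : EuclideanSpace ℝ (Fin n) → EuclideanSpace ℝ (Fin n) :=
    fun q => p + (r / max r ‖q - p‖) • (q - p) with hρ
  have hmax : ∀ q, 0 < max r ‖q - p‖ := fun q => lt_max_of_lt_left hr
  have hρc : Continuous ρ := by
    have h1 : Continuous fun q => r / max r ‖q - p‖ :=
      continuous_const.div (by fun_prop) fun q => (hmax q).ne'
    exact continuous_const.add (h1.smul (continuous_id.sub continuous_const))
  have hρm : ∀ q, ρ q ∈ closedBall p r := fun q => by
    simp only [hρ, mem_closedBall, dist_eq_norm, add_sub_cancel_left, norm_smul]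
    rw [Real.norm_of_nonneg (div_pos hr (hmax q)).le, div_mul_eq_mul_div, div_le_iff₀ (hmax q)]
    gcongr
    exact le_max_right _ _
  have hρid : ∀ q ∈ ball p r, ρ q = q := fun q hq => by
    rw [mem_ball, dist_eq_norm] at hq
    simp only [hρ]
    rw [max_eq_left hq.le, div_self hr.ne', one_smul, add_sub_cancel]
  let b : C(EuclideanSpace ℝ (Fin n), M) :=
    ⟨fun q => φ.symm (ρ q), φ.continuousOn_symm.comp_continuous hρc fun q => hball (hρm q)⟩
  obtain ⟨s, ⟨hs0, hs⟩, -⟩ := hπ.isCoveringMap.existsUnique_continuousMap_lifts b (φ (π y)) y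
    (show π y = φ.symm (ρ (φ (π y))) by rw [hρid _ hyr, φ.left_inv hy])
  refine ⟨s, hs0, fun q hq => ?_⟩
  have hπs : ∀ q ∈ ball p r, π (s q) = φ.symm q := fun q hq => by
    have : π (s q) = φ.symm (ρ q) := congrFun hs q
    rw [this, hρid q hq]
  have hqt : ∀ q ∈ ball p r, q ∈ φ.target := fun q hq => hball (ball_subset_closedBall hq)
  obtain ⟨ψ, hψ, hsψ, hψφ, htgt, hmet⟩ := hπ.exists_chart hφ (y := s q)
    (by rw [hπs q hq]; exact φ.map_target (hqt q hq))
  have hψs : ∀ q' ∈ ball p r, s q' ∈ ψ.source → ψ (s q') = q' := fun q' hq' hs' => by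
    rw [hψφ _ hs', hπs q' hq', φ.right_inv (hqt q' hq')]
  refine ⟨ψ, hψ, ball p r ∩ s ⁻¹' ψ.source, fun q' hq' => ?_,
    isOpen_ball.inter (ψ.open_source.preimage s.continuous), ⟨hq, hsψ⟩, fun q' hq' => ?_⟩
  · rw [← hψs q' hq'.1 hq'.2]; exact ψ.map_source hq'.2
  · have h1 := hψs q' hq'.1 hq'.2
    refine ⟨by rw [← h1, ψ.left_inv hq'.2, h1], hmet q' ?_⟩
    rw [← h1]; exact ψ.map_source hq'.2

/-- Since `M` is compact, segments of uniform length lift through the spatial projection of an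
immersion of its universal cover: in a lift of a coordinate ball of `M` the projection expands
lengths by a factor that depends on the ball only, and finitely many balls suffice. -/
theorem exists_hasSegmentLifts [CompactSpace M] (hπ : IsRiemannianUniversalCover h g π)
    (hF : IsImmersedOn h univ F ν) : ∃ δ > 0, HasSegmentLifts (fun y => (F y).1) δ := by
  suffices H : ∃ δ > 0, ∀ y, π y ∈ (univ : Set M) → ∀ v : EuclideanSpace ℝ (Fin n), ‖v‖ ≤ δ →
      ∃ γ : C(I, N), γ 0 = y ∧ ∀ t : I, (F (γ t)).1 = (F y).1 + (t : ℝ) • v by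
    obtain ⟨δ, hδ, H⟩ := H
    exact ⟨δ, hδ, fun y v hv => H y trivial v hv⟩
  refine isCompact_univ.induction_on (p := fun S => ∃ δ > 0, ∀ y, π y ∈ S →
    ∀ v : EuclideanSpace ℝ (Fin n), ‖v‖ ≤ δ → ∃ γ : C(I, N), γ 0 = y ∧
      ∀ t : I, (F (γ t)).1 = (F y).1 + (t : ℝ) • v) ⟨1, one_pos, by simp⟩ ?_ ?_ ?_
  · rintro S T hST ⟨δ, hδ, H⟩
    exact ⟨δ, hδ, fun y hy => H y (hST hy)⟩
  · rintro S T ⟨δ, hδ, H⟩ ⟨δ', hδ', H'⟩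
    refine ⟨min δ δ', lt_min hδ hδ', fun y hy v hv => ?_⟩
    rcases hy with hy | hy
    · exact H y hy v (hv.trans (min_le_left _ _))
    · exact H' y hy v (hv.trans (min_le_right _ _))
  intro x _
  obtain ⟨φ, hφ, hxφ⟩ : ∃ φ ∈ Charts n M, x ∈ φ.source :=
    ⟨_, IsManifold.chart_mem_maximalAtlas x, mem_chart_source _ x⟩
  set p := φ x
  obtain ⟨r, hr, hball⟩ : ∃ r > 0, closedBall p (2 * r) ⊆ φ.target := by
    obtain ⟨ε, hε, hb⟩ := Metric.isOpen_iff.1 φ.open_target p (φ.map_source hxφ)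
    exact ⟨ε / 4, by positivity, (closedBall_subset_ball (by linarith)).trans hb⟩
  obtain ⟨c, hc, hcb⟩ := (isMetricOn_coordMetric g hφ).exists_lower_bound
    (isCompact_closedBall p (2 * r)) hball
  refine ⟨φ.source ∩ φ ⁻¹' ball p r, mem_nhdsWithin_of_mem_nhds
    ((φ.isOpen_inter_preimage isOpen_ball).mem_nhds ⟨hxφ, mem_ball_self hr⟩), c * r, by positivity,
    fun y hy v hv => ?_⟩
  have hbb : closedBall (φ (π y)) r ⊆ ball p (2 * r) := by
    refine closedBall_subset_ball' ?_
    have : dist (φ (π y)) p < r := hy.2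
    linarith
  obtain ⟨s, hs0, hs⟩ := hπ.exists_ball_lift hφ (by positivity) hball hy.1
    (hbb (mem_closedBall_self hr.le))
  have hloc : ∀ q ∈ ball p (2 * r), ContDiffAt ℝ ∞ (fun q => (F (s q)).1) q ∧
      ∀ w, c * ‖w‖ ≤ ‖fderiv ℝ (fun q => (F (s q)).1) q w‖ := fun q hq => by
    obtain ⟨ψ, hψ, V, hVψ, hV, hqV, hVs⟩ := hs q hq
    have hyp := (hF.isHypersurface_secondFF hψ).mono (V := V) fun q' hq' => ⟨hVψ hq', trivial⟩
    have hev : (fun q => (F (s q)).1) =ᶠ[𝓝 q] fun q => (F (ψ.symm q)).1 :=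
      eventuallyEq_of_mem (hV.mem_nhds hqV) fun q' hq' => by
        simp only [(hVs q' hq').1]
    refine ⟨((hyp.smooth.contDiffAt (hV.mem_nhds hqV)).fst).congr_of_eventuallyEq hev,
      fun w => ?_⟩
    rw [hev.fderiv_eq]
    have h1 := hyp.le_norm_fderiv_fst_sq hV hqV w
    rw [(hVs q hqV).2] at h1
    exact abs_le_of_sq_le_sq' ((hcb q (ball_subset_closedBall hq) w).trans h1) (norm_nonneg _) |>.2
  obtain ⟨α, hαc, hα0, hαm, hα⟩ := exists_segment_lift_of_expanding
    (G := fun q => (F (s q)).1) isOpen_ball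
    (fun q hq => (hloc q hq).1.contDiffWithinAt) hr.le hc hbb
    (fun q hq w => (hloc q (hbb hq)).2 w) hv
  refine ⟨⟨fun t => s (α t), s.continuous.comp (hαc.comp continuous_subtype_val)⟩, ?_, fun t => ?_⟩
  · simp [hα0, hs0]
  · have := hα t t.2
    rw [hs0] at this
    exact this

end Expansion

/-! ### Immersions of the universal cover are entire graphs -/

section Embedding

open Filter Topology Set

variable {n : ℕ} {M : Type*} [TopologicalSpace M] [ChartedSpace (EuclideanSpace ℝ (Fin n)) M]
  [IsManifold (𝓡 n) ∞ M] {N : Type*} [TopologicalSpace N]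
  [ChartedSpace (EuclideanSpace ℝ (Fin n)) N] [IsManifold (𝓡 n) ∞ N]
  {g : Metric n M} {h : Metric n N} {π : N → M} {F ν : N → Minkowski n} {O : Set N}

lemma IsRiemannianUniversalCover.t2Space [T2Space M] (hπ : IsRiemannianUniversalCover h g π) :
    T2Space N := by
  refine ⟨fun x y hxy => ?_⟩
  by_cases hp : π x = π y
  · exact hπ.isCoveringMap.isSeparatedMap x y hp hxy
  · exact separated_by_continuous hπ.isCoveringMap.continuous hp

namespace IsImmersedOn

lemma contMDiffAt_fst (hF : IsImmersedOn h O F ν) {y : N} (hy : y ∈ O) :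
    ContMDiffAt (𝓡 n) (𝓡 n) ∞ (fun y => (F y).1) y :=
  (contMDiffAt_iff_contDiffAt.2 contDiffAt_fst : ContMDiffAt 𝓘(ℝ, Minkowski n) (𝓡 n) ∞
    (Prod.fst : Minkowski n → EuclideanSpace ℝ (Fin n)) (F y)).comp y (hF.contMDiffAt hy)

lemma contMDiffAt_snd (hF : IsImmersedOn h O F ν) {y : N} (hy : y ∈ O) :
    ContMDiffAt (𝓡 n) 𝓘(ℝ) ∞ (fun y => (F y).2) y :=
  (contMDiffAt_iff_contDiffAt.2 contDiffAt_snd : ContMDiffAt 𝓘(ℝ, Minkowski n) 𝓘(ℝ) ∞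
    (Prod.snd : Minkowski n → ℝ) (F y)).comp y (hF.contMDiffAt hy)

/-- The image of the differential is spacelike, so its spatial part determines a tangent vector. -/
lemma mfderiv_fst_injective (hF : IsImmersedOn h O F ν) {y : N} (hy : y ∈ O) :
    Function.Injective (mfderiv (𝓡 n) (𝓡 n) (fun y => (F y).1) y) := by
  rw [injective_iff_map_eq_zero]
  intro u hu
  have h1 : mfderiv (𝓡 n) (𝓡 n) (fun y => (F y).1) y u = (dMink F y u).1 := by
    have h2 : HasMFDerivAt (𝓡 n) (𝓡 n) (fun y => (F y).1) y _ :=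
      ((hasFDerivAt_fst (𝕜 := ℝ) (p := F y)).hasMFDerivAt :
        HasMFDerivAt 𝓘(ℝ, Minkowski n) (𝓡 n) Prod.fst (F y) _).comp y (hF.mdiff hy).hasMFDerivAt
    rw [h2.mfderiv]
    rfl
  by_contra h0
  have h3 := h.pos y u h0
  have hz : (dMink F y u).1 = (0 : EuclideanSpace ℝ (Fin n)) := h1.symm.trans hu
  rw [← hF.isometric y hy, mink, hz, inner_zero_left] at h3
  nlinarith [mul_self_nonneg (dMink F y u).2]

lemma isLocalHomeomorph_fst (hF : IsImmersedOn h univ F ν) :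
    IsLocalHomeomorph (fun y => (F y).1) := by
  refine IsLocalHomeomorph.mk _ fun y => ?_
  obtain ⟨φ, hφ, hyφ⟩ : ∃ φ ∈ Charts n N, y ∈ φ.source :=
    ⟨_, IsManifold.chart_mem_maximalAtlas y, mem_chart_source _ y⟩
  set f : N → EuclideanSpace ℝ (Fin n) := fun y => (F y).1 with hf
  have hp := φ.map_source hyφ
  have hsm : ContDiffAt ℝ ∞ (f ∘ φ.symm) (φ y) :=
    contMDiffAt_iff_contDiffAt.1 (ContMDiffAt.comp (φ y) (hF.contMDiffAt_fst trivial)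
      (contMDiffAt_chart_symm hφ hp))
  have hinj : Function.Injective (fderiv ℝ (f ∘ φ.symm) (φ y)) := by
    have h1 : mfderiv (𝓡 n) (𝓡 n) (f ∘ φ.symm) (φ y) = fderiv ℝ (f ∘ φ.symm) (φ y) :=
      mfderiv_eq_fderiv
    rw [← h1, mfderiv_comp (I' := 𝓡 n) (φ y)
      ((hF.contMDiffAt_fst trivial).mdifferentiableAt (by simp))
      ((contMDiffAt_chart_symm hφ hp).mdifferentiableAt (by simp))]
    exact (hF.mfderiv_fst_injective trivial).comp (mfderiv_chart_symm_bijective hφ hp).1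
  have hd : HasFDerivAt (f ∘ φ.symm) ((LinearEquiv.ofInjectiveEndo
      (fderiv ℝ (f ∘ φ.symm) (φ y)).toLinearMap hinj).toContinuousLinearEquiv :
        EuclideanSpace ℝ (Fin n) →L[ℝ] EuclideanSpace ℝ (Fin n)) (φ y) :=
    (hsm.differentiableAt (by simp)).hasFDerivAt
  refine ⟨φ.trans (hsm.toOpenPartialHomeomorph _ hd (by simp)), ?_, fun z hz => ?_⟩
  · rw [OpenPartialHomeomorph.trans_source]
    exact ⟨hyφ, hsm.mem_toOpenPartialHomeomorph_source hd (by simp)⟩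
  · rw [OpenPartialHomeomorph.trans_source] at hz
    rw [OpenPartialHomeomorph.trans_apply, ContDiffAt.toOpenPartialHomeomorph_coe,
      Function.comp, φ.left_inv hz.1]

/-- An isometric immersion of the universal cover of a compact manifold is an entire spacelike
graph, and in particular an embedding. -/
theorem isSmoothEmbedding [T2Space M] [CompactSpace M] (hπ : IsRiemannianUniversalCover h g π)
    (hF : IsImmersedOn h univ F ν) :
    Manifold.IsSmoothEmbedding (𝓡 n) 𝓘(ℝ, Minkowski n) ∞ F := by
  have := hπ.simplyConnected
  have := hπ.t2Space
  obtain ⟨δ, hδ, hlift⟩ := exists_hasSegmentLifts hπ hF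
  have hloc := hF.isLocalHomeomorph_fst
  have hbij := hlift.bijective hδ hloc
  set e : N ≃ₜ EuclideanSpace ℝ (Fin n) := hloc.toHomeomorphOfBijective hbij
  have he : ∀ y, e y = (F y).1 := fun y => rfl
  have hes : ∀ q, (F (e.symm q)).1 = q := fun q => e.apply_symm_apply q
  have hchart : e.toOpenPartialHomeomorph ∈ Charts n N :=
    mem_charts_of_injective _ (fun y _ => hF.contMDiffAt_fst trivial)
      fun y _ => hF.mfderiv_fst_injective trivial
  obtain ⟨u, hue⟩ : ∃ u : EuclideanSpace ℝ (Fin n) → ℝ, u = fun q => (F (e.symm q)).2 := ⟨_, rfl⟩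
  have hu : ContDiff ℝ ∞ u := by
    rw [contDiff_iff_contDiffAt, hue]
    intro q
    exact contMDiffAt_iff_contDiffAt.1 (ContMDiffAt.comp (g := fun y => (F y).2)
      (f := e.toOpenPartialHomeomorph.symm) q (hF.contMDiffAt_snd trivial)
      (contMDiffAt_chart_symm hchart (p := q) trivial))
  -- shearing the graph to the horizontal plane gives a slice chart
  let S : Minkowski n ≃ₜ Minkowski n :=
    { toFun := fun x => (x.1, x.2 - u x.1)
      invFun := fun x => (x.1, x.2 + u x.1)
      left_inv := fun x => by simp
      right_inv := fun x => by simp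
      continuous_toFun := by
        have := hu.continuous
        fun_prop
      continuous_invFun := by
        have := hu.continuous
        fun_prop }
  have hS : S.toOpenPartialHomeomorph ∈
      IsManifold.maximalAtlas 𝓘(ℝ, Minkowski n) ∞ (Minkowski n) := by
    refine OpenPartialHomeomorph.mem_maximalAtlas_of_contMDiffOn _ ?_ ?_
    · have : ContDiff ℝ ∞ fun x : Minkowski n => (x.1, x.2 - u x.1) :=
        contDiff_fst.prodMk (contDiff_snd.sub (hu.comp contDiff_fst))
      exact this.contMDiff.contMDiffOn
    · have : ContDiff ℝ ∞ fun x : Minkowski n => (x.1, x.2 + u x.1) :=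
        contDiff_fst.prodMk (contDiff_snd.add (hu.comp contDiff_fst))
      exact this.contMDiff.contMDiffOn
  refine ⟨⟨ℝ, inferInstance, inferInstance, fun y => ?_⟩, ?_⟩
  · refine Manifold.IsImmersionAtOfComplement.mk_of_charts (ContinuousLinearEquiv.refl ℝ _)
      e.toOpenPartialHomeomorph S.toOpenPartialHomeomorph trivial trivial hchart hS
      (fun _ _ => trivial) fun q _ => ?_
    change S (F (e.symm q)) = (q, 0)
    change ((F (e.symm q)).1, (F (e.symm q)).2 - u (F (e.symm q)).1) = (q, (0 : ℝ))
    rw [hes, hue, sub_self]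
  · have hFc : Continuous F := continuous_iff_continuousAt.2 fun y =>
      (hF.contMDiffAt trivial).continuousAt
    exact IsEmbedding.of_comp hFc continuous_fst e.isEmbedding

end IsImmersedOn

lemma IsConvexImmersionOn.isUnitNormal (hF : IsConvexImmersionOn h univ F ν) :
    IsUnitNormal F ν :=
  ⟨fun _ => hF.contMDiffAt_normal trivial, fun y => hF.unit y trivial,
    fun y => hF.normal y trivial⟩

lemma IsConvexImmersionOn.posDefSecondFF (hF : IsConvexImmersionOn h univ F ν) :
    PosDefSecondFF F ν :=
  fun _ hφ _ hp => hF.posDef hφ ⟨hp, trivial⟩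

end Embedding

/-! ### Deck transformations -/

section DeckTransformations

open Filter Topology Set

variable {n : ℕ} {M : Type*} [TopologicalSpace M] [ChartedSpace (EuclideanSpace ℝ (Fin n)) M]
  [IsManifold (𝓡 n) ∞ M] {N : Type*} [TopologicalSpace N]
  [ChartedSpace (EuclideanSpace ℝ (Fin n)) N] [IsManifold (𝓡 n) ∞ N]
  {g : Metric n M} {h : Metric n N} {π : N → M} {F ν : N → Minkowski n}

namespace IsRiemannianUniversalCover

/-- Deck transformations are determined by one value. -/
lemma deck_unique (hπ : IsRiemannianUniversalCover h g π) {s t : N ≃ₜ N} (hs : ∀ y, π (s y) = π y)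
    (ht : ∀ y, π (t y) = π y) {y : N} (hy : s y = t y) : s = t := by
  have := hπ.simplyConnected
  refine Homeomorph.ext fun z => congrFun (hπ.isCoveringMap.eq_of_comp_eq s.continuous t.continuous
    (funext fun z => ?_) y hy) z
  rw [Function.comp, Function.comp, hs, ht]

/-- The deck transformations act transitively on the fibres of a universal cover. -/
lemma exists_deck (hπ : IsRiemannianUniversalCover h g π) {y y' : N} (hy : π y = π y') :
    ∃ s : N ≃ₜ N, (∀ z, π (s z) = π z) ∧ s y = y' := by
  have := hπ.simplyConnected
  have : LocallyPathConnectedSpace N :=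
    ChartedSpace.locallyPathConnectedSpace (EuclideanSpace ℝ (Fin n)) N
  have key : ∀ a b : N, π a = π b → ∃ s : C(N, N), s a = b ∧ π ∘ s = π := fun a b hab =>
    (hπ.isCoveringMap.existsUnique_continuousMap_lifts ⟨π, hπ.isCoveringMap.continuous⟩ a b
      hab.symm).exists
  obtain ⟨s, hsy, hs⟩ := key y y' hy
  obtain ⟨t, hty, ht⟩ := key y' y hy.symm
  have hid : ∀ (a b : C(N, N)) (z : N), π ∘ a = π → π ∘ b = π → a (b z) = z →
      ∀ w, a (b w) = w := fun a b z ha hb hz w =>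
    congrFun (hπ.isCoveringMap.eq_of_comp_eq (a.continuous.comp b.continuous) continuous_id
      (by rw [Function.comp_id, ← Function.comp_assoc, ha, hb]) z hz) w
  exact ⟨⟨⟨s, t, hid t s y ht hs (by rw [hsy, hty]), hid s t y' hs ht (by rw [hty, hsy])⟩,
    s.continuous, t.continuous⟩, fun z => congrFun hs z, hsy⟩

/-- There is a compact set that meets all fibres of the universal cover of a compact manifold. -/
lemma exists_compact_image [CompactSpace M] (hπ : IsRiemannianUniversalCover h g π) :
    ∃ K : Set N, IsCompact K ∧ ∀ x, ∃ y ∈ K, π y = x := by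
  have : LocallyCompactSpace N := ChartedSpace.locallyCompactSpace (EuclideanSpace ℝ (Fin n)) N
  suffices H : ∃ K : Set N, IsCompact K ∧ univ ⊆ π '' K by
    obtain ⟨K, hK, hu⟩ := H
    exact ⟨K, hK, fun x => hu (mem_univ x)⟩
  refine isCompact_univ.induction_on (p := fun S => ∃ K : Set N, IsCompact K ∧ S ⊆ π '' K)
    ⟨∅, isCompact_empty, empty_subset _⟩ ?_ ?_ ?_
  · rintro S T hST ⟨K, hK, hT⟩
    exact ⟨K, hK, hST.trans hT⟩
  · rintro S T ⟨K, hK, hS⟩ ⟨K', hK', hT⟩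
    exact ⟨K ∪ K', hK.union hK', by rw [image_union]; exact union_subset_union hS hT⟩
  · intro x _
    obtain ⟨y, rfl⟩ := hπ.surjective x
    obtain ⟨K, hK, hKy⟩ := exists_compact_mem_nhds y
    exact ⟨π '' K, mem_nhdsWithin_of_mem_nhds (hπ.isCoveringMap.isOpenMap.image_mem_nhds hKy),
      K, hK, subset_rfl⟩

/-- Convex immersions can be composed with deck transformations. -/
lemma isConvexImmersionOn_comp_deck (hπ : IsRiemannianUniversalCover h g π)
    (hF : IsConvexImmersionOn h univ F ν) {s : N ≃ₜ N} (hs : ∀ y, π (s y) = π y) :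
    IsConvexImmersionOn h univ (fun y => F (s y)) (fun y => ν (s y)) := by
  refine isConvexImmersionOn_univ_of_local fun y => ?_
  obtain ⟨φ, hφ, hyφ⟩ : ∃ φ ∈ Charts n M, π y ∈ φ.source :=
    ⟨_, IsManifold.chart_mem_maximalAtlas (π y), mem_chart_source _ (π y)⟩
  obtain ⟨ψ, hψ, hyψ, hψφ, htgt, hmet⟩ := hπ.exists_chart hφ hyφ
  obtain ⟨ψ', hψ', hyψ', hψφ', htgt', hmet'⟩ := hπ.exists_chart hφ (y := s y) (by rwa [hs])
  have h1 := (hF.isHypersurface_secondFF hψ').mono (V := ψ.target ∩ ψ'.target)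
    fun q hq => ⟨hq.2, trivial⟩
  have h2 : IsHypersurface (coordMetric h ψ) (secondFF F ν ψ') (ψ.target ∩ ψ'.target)
      (fun q => F (ψ'.symm q)) (fun q => ν (ψ'.symm q)) :=
    ⟨h1.1, h1.2, fun q hq => by rw [hmet q hq.1, ← hmet' q hq.2]; exact h1.3 q hq,
      h1.4, h1.5, h1.6⟩
  -- in the charts lifted from `M`, the deck transformation is the identity
  have hψψ : ∀ z ∈ ψ.source, s z ∈ ψ'.source → ψ z = ψ' (s z) := fun z hz hz' => by
    rw [hψφ z hz, hψφ' _ hz', hs]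
  have hev : ∀ᶠ z in 𝓝 y, s z = ψ'.symm (ψ z) := by
    filter_upwards [ψ.open_source.mem_nhds hyψ,
      (ψ'.open_source.preimage s.continuous).mem_nhds hyψ'] with z hz hz'
    rw [hψψ z hz hz', ψ'.left_inv hz']
  have h3 := h2.isConvexImmersionOn hψ (ψ.open_target.inter ψ'.open_target) inter_subset_left
    fun q hq => hF.posDef hψ' ⟨hq.2, trivial⟩
  refine ⟨_, _, _, ?_, h3, hev.mono fun z hz => congrArg F hz, hev.mono fun z hz => congrArg ν hz⟩
  refine ⟨hyψ, ψ.map_source hyψ, ?_⟩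
  rw [hψψ y hyψ hyψ']
  exact ψ'.map_source hyψ'

end IsRiemannianUniversalCover

/-- The isometries of Minkowski space that induce a deck transformation on the hypersurface. -/
def deckIsometries (π : N → M) (F ν : N → Minkowski n) :
    Subgroup (Minkowski n ≃ᵃ[ℝ] Minkowski n) where
  carrier := {L | IsMinkowskiIsometry L ∧ ∃ s : N ≃ₜ N, (∀ y, π (s y) = π y) ∧
    ∀ y, F (s y) = L (F y) ∧ ν (s y) = L.linear (ν y)}
  one_mem' := ⟨.one, Homeomorph.refl N, fun _ => rfl, fun _ => ⟨rfl, rfl⟩⟩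
  mul_mem' := by
    rintro L L' ⟨hL, s, hs, h⟩ ⟨hL', s', hs', h'⟩
    refine ⟨hL.mul hL', s'.trans s, fun y => ?_, fun y => ?_⟩
    · rw [Homeomorph.trans_apply, hs, hs']
    · rw [Homeomorph.trans_apply, (h _).1, (h' _).1, (h _).2, (h' _).2]
      exact ⟨rfl, rfl⟩
  inv_mem' := by
    rintro L ⟨hL, s, hs, h⟩
    refine ⟨hL.inv, s.symm, fun y => ?_, fun y => ?_⟩
    · rw [← hs, s.apply_symm_apply]
    · have h1 := h (s.symm y)
      rw [s.apply_symm_apply] at h1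
      rw [h1.1, h1.2]
      exact ⟨(L.symm_apply_apply _).symm, (L.linear.symm_apply_apply _).symm⟩

end DeckTransformations

/-! ### Cocompactness -/

section CoCompact

open Filter Topology Set

variable {M : Type*} [TopologicalSpace M] [ChartedSpace (EuclideanSpace ℝ (Fin 3)) M]
  [IsManifold (𝓡 3) ∞ M] {N : Type*} [TopologicalSpace N]
  [ChartedSpace (EuclideanSpace ℝ (Fin 3)) N] [IsManifold (𝓡 3) ∞ N]
  {g : Metric 3 M} {h : Metric 3 N} {π : N → M} {F ν : N → Minkowski 3}

/-- By rigidity the deck transformations are induced by isometries of Minkowski space. These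
isometries act on the hypersurface as the deck transformations do on the universal cover. -/
theorem IsConvexImmersionOn.isCoCompact [T2Space M] [CompactSpace M]
    (hF : IsConvexImmersionOn h univ F ν) (hπ : IsRiemannianUniversalCover h g π)
    (hemb : IsEmbedding F) : IsCoCompact (range F) := by
  have := hπ.simplyConnected
  have huniq : ∀ {L L' : Minkowski 3 ≃ᵃ[ℝ] Minkowski 3} {s : N ≃ₜ N},
      (∀ y, F (s y) = L (F y) ∧ ν (s y) = L.linear (ν y)) →
      (∀ y, F (s y) = L' (F y) ∧ ν (s y) = L'.linear (ν y)) → L = L' := fun {L L' s} h1 h2 => by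
    obtain ⟨y⟩ : Nonempty N := inferInstance
    exact hF.isometry_unique (y := y) trivial
      (Eventually.of_forall fun z => (h1 z).1.symm.trans (h2 z).1) ((h1 y).2.symm.trans (h2 y).2)
  refine ⟨deckIsometries π F ν, fun L hL => hL.1, ?_, ?_, ?_, ?_⟩
  · rintro L ⟨-, s, -, hs⟩
    ext x
    constructor
    · rintro ⟨_, ⟨y, rfl⟩, rfl⟩
      exact ⟨s y, (hs y).1⟩
    · rintro ⟨y, rfl⟩
      exact ⟨F (s.symm y), ⟨_, rfl⟩, by rw [← (hs _).1, s.apply_symm_apply]⟩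
  · rintro L ⟨-, s, hπs, hs⟩ _ ⟨y, rfl⟩ hLy
    have h1 : s = Homeomorph.refl N := by
      refine hπ.deck_unique hπs (fun _ => rfl) (y := y) (hemb.injective ?_)
      rw [(hs y).1, hLy]
      rfl
    subst h1
    exact huniq hs fun _ => ⟨rfl, rfl⟩
  · intro K hKS hK
    have hK' : IsCompact (F ⁻¹' K) := (hemb.isInducing.isCompact_preimage_iff hKS).2 hK
    have key : {L | L ∈ deckIsometries π F ν ∧ ∃ z ∈ (F ⁻¹' K) ×ˢ (F ⁻¹' K),
        L (F z.1) = F z.2}.Finite := by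
      refine (hK'.prod hK').induction_on (p := fun S => {L | L ∈ deckIsometries π F ν ∧
        ∃ z ∈ S, L (F z.1) = F z.2}.Finite) (by simp) ?_ ?_ ?_
      · rintro S T hST hT
        exact hT.subset fun L hL => ⟨hL.1, hL.2.imp fun z hz => ⟨hST hz.1, hz.2⟩⟩
      · rintro S T hS hT
        refine (hS.union hT).subset ?_
        rintro L ⟨hL, z, hz | hz, hLz⟩
        · exact Or.inl ⟨hL, z, hz, hLz⟩
        · exact Or.inr ⟨hL, z, hz, hLz⟩
      rintro ⟨a, b⟩ -
      have hπc := hπ.isCoveringMap.continuous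
      by_cases hab : π a = π b
      · -- near `(a, b)` only the deck transformation `t` with `t a = b` can occur
        obtain ⟨t, hπt, hta⟩ := hπ.exists_deck hab
        obtain ⟨e, hbe, he⟩ := hπ.isCoveringMap.isLocalHomeomorph b
        refine ⟨(t ⁻¹' e.source) ×ˢ e.source, mem_nhdsWithin_of_mem_nhds (prod_mem_nhds
          ((e.open_source.preimage t.continuous).mem_nhds (by rwa [mem_preimage, hta]))
          (e.open_source.mem_nhds hbe)), Set.Subsingleton.finite ?_⟩
        have hst : ∀ {L : Minkowski 3 ≃ᵃ[ℝ] Minkowski 3} {s : N ≃ₜ N} {z : N × N},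
            (∀ y, π (s y) = π y) → (∀ y, F (s y) = L (F y) ∧ ν (s y) = L.linear (ν y)) →
            z ∈ (t ⁻¹' e.source) ×ˢ e.source → L (F z.1) = F z.2 → s = t := by
          intro L s z hπs hs hz hLz
          have hsz : s z.1 = z.2 := hemb.injective ((hs z.1).1.trans hLz)
          refine hπ.deck_unique hπs hπt (y := z.1) (e.injOn (hsz ▸ hz.2) hz.1 ?_)
          rw [← he, hπs, hπt]
        rintro L ⟨⟨-, s, hπs, hs⟩, z, hz, hLz⟩ L' ⟨⟨-, s', hπs', hs'⟩, z', hz', hLz'⟩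
        obtain rfl := hst hπs hs hz hLz
        obtain rfl := hst hπs' hs' hz' hLz'
        exact huniq hs hs'
      · obtain ⟨A, B, hA, hB, haA, hbB, hAB⟩ := t2_separation hab
        refine ⟨(π ⁻¹' A) ×ˢ (π ⁻¹' B), mem_nhdsWithin_of_mem_nhds (prod_mem_nhds
          ((hA.preimage hπc).mem_nhds haA) ((hB.preimage hπc).mem_nhds hbB)), ?_⟩
        convert Set.finite_empty
        refine eq_empty_of_forall_notMem ?_
        rintro L ⟨⟨-, s, hπs, hs⟩, z, hz, hLz⟩
        have hsz : s z.1 = z.2 := hemb.injective ((hs z.1).1.trans hLz)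
        refine Set.disjoint_left.1 hAB hz.1 ?_
        have : π z.2 ∈ B := hz.2
        rwa [← hsz, hπs] at this
    refine key.subset ?_
    rintro L ⟨hL, x, ⟨x', hx', rfl⟩, hx⟩
    obtain ⟨y, rfl⟩ := hKS hx'
    obtain ⟨y', hy'⟩ := hKS hx
    exact ⟨hL, (y, y'), ⟨hx', by rw [mem_preimage, hy']; exact hx⟩, hy'.symm⟩
  · obtain ⟨K, hK, hKπ⟩ := hπ.exists_compact_image
    refine ⟨F '' K, image_subset_range _ _, hK.image hemb.continuous, ?_⟩
    rintro _ ⟨y, rfl⟩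
    obtain ⟨y', hy', hyy'⟩ := hKπ (π y)
    obtain ⟨s, hπs, hs⟩ := hπ.exists_deck hyy'
    obtain ⟨L, hL, hLs⟩ := hF.exists_global_isometry (hπ.isConvexImmersionOn_comp_deck hF hπs)
    exact mem_biUnion (x := L) ⟨hL, s, hπs, hLs⟩
      ⟨F y', mem_image_of_mem F hy', by rw [← (hLs y').1, hs]⟩

end CoCompact

end CrossCurv

end

theorem mainTheorem2 {M N : Type*}
    [TopologicalSpace M] [T2Space M] [CompactSpace M]
    [ChartedSpace (EuclideanSpace ℝ (Fin 3)) M] [IsManifold (𝓡 3) ∞ M]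
    [TopologicalSpace N] [ChartedSpace (EuclideanSpace ℝ (Fin 3)) N] [IsManifold (𝓡 3) ∞ N]
    (g : CrossCurv.Metric 3 M) (hg : CrossCurv.NegativeSectionalCurvature g)
    (h : CrossCurv.Metric 3 N) (π : N → M)
    (hπ : CrossCurv.IsRiemannianUniversalCover h g π) :
    (CrossCurv.CodazziP g ↔
      ∃ F : N → CrossCurv.Minkowski 3, CrossCurv.IsIsometricEmbedding h F ∧
        CrossCurv.IsSpacelike F ∧ CrossCurv.IsLocallyConvex F ∧
        CrossCurv.IsCoCompact (Set.range F)) ∧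
    (∀ F ν : N → CrossCurv.Minkowski 3, CrossCurv.IsIsometricEmbedding h F →
      CrossCurv.IsUnitNormal F ν → CrossCurv.PosDefSecondFF F ν →
      CrossCurv.CodazziP g ∧
      ∀ φ ∈ CrossCurv.Charts 3 N, ∀ p ∈ φ.target,
        CrossCurv.secondFF F ν φ p =
          CrossCurv.tensorP (CrossCurv.coordMetric h φ) p) := by
  have key : ∀ {F ν}, CrossCurv.IsConvexImmersionOn h Set.univ F ν → CrossCurv.CodazziP g :=
    fun hF => hF.codazziP hπ
  refine ⟨⟨fun hC => ?_, ?_⟩, fun F ν hF hν hA => ?_⟩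
  · obtain ⟨F, ν, hF⟩ := CrossCurv.exists_isConvexImmersionOn_univ hπ hg hC
    have hemb := hF.isSmoothEmbedding hπ
    refine ⟨F, ⟨hemb, fun y => hF.isometric y trivial⟩, fun y u hu => ?_,
      ⟨ν, hF.isUnitNormal, hF.posDefSecondFF⟩, hF.isCoCompact hπ hemb.isEmbedding⟩
    rw [hF.isometric y trivial]
    exact h.pos y u hu
  · rintro ⟨F, hF, -, ⟨ν, hν, hA⟩, -⟩
    exact key (CrossCurv.isConvexImmersionOn_univ hF hν hA)
  · have hF' := CrossCurv.isConvexImmersionOn_univ hF hν hA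
    exact ⟨key hF', fun φ hφ p hp => hF'.secondFF_eq_tensorP hφ ⟨hp, trivial⟩⟩
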